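/- Let $G=\mathrm{GL}_n(q)$, $n\ge 2$, over a finite field $F_q$ of characteristic $p$, let $\ell\ne p$ be a prime, and let $R$ be a local principal ideal domain of characteristic $0$ with maximal ideal $\ell R$ that contains a primitive $p$-th root of unity; put $K=R/\ell R$. Let $B\le G$ be the upper triangular group and $U\le B$ the upper unitriangular group. For $S\subseteq G$ write $\widehat S=\sum_{s\in S}s\in RG$, and identify $S_n$ with the group of permutation matrices. Let $\underline e=\sum_{\sigma\in S_n}\mathrm{sg}(\sigma)\,\sigma\widehat B$, let $I=RG\cdot\underline e$ be the Steinberg lattice, and let $L=I/\ell I$, a $KG$-module. Let $f:I\times I\to R$ be the restriction to $I$ of the bilinear form $(g,h)\mapsto\delta_{g,h}$ on $RG$, scaled by $1/|B|$. For $c\ge 0$ put $I(c)=\{x\in I : f(x,I)\subseteq \ell^cR\}$ and $L(c)=(I(c)+\ell I)/\ell I$. Let $e=\min\{i\ge 2 : \ell \mid (q^i-1)/(q-1)\}$ and $d=\nu_\ell\big((q^e-1)/(q-1)\big)$. Suppose that $d=1$. Then the filtration $L=L(0)\supseteq L(1)\supseteq L(2)\supseteq\cdots$, with repetitions removed, is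 the radical series of $L$. That is, with $\mathrm{rad}^0(L)=L$ and $\mathrm{rad}^{i+1}(L)=\mathrm{rad}(\mathrm{rad}^i(L))$, where $\mathrm{rad}(M)$ is the intersection of the maximal submodules of $M$, there is an $r$ such that $L=\mathrm{rad}^0(L)\supsetneq\mathrm{rad}^1(L)\supsetneq\cdots\supsetneq\mathrm{rad}^r(L)=0$, and the terms of this series are precisely the distinct terms of the filtration. Moreover (still for $d=1$), $L(c)=\sum_{P\in\mathcal P^*(c)}L'(P)$ for every $c\ge 0$ of the form $c=\nu_\ell([G:P])$ with $P$ a subgroup of $G$ containing $B$. Here $\mathcal P^*(c)$ is the set of the block upper triangular groups $P\le G$ with $\nu_\ell([G:P])=c$ whose sequence of block sizes is weakly increasing and consists of numbers that are $1$ or of the form $e\ell^i$, $i\ge 0$; and $L'(P)$ is the $KG$-submodule of $L$ generated by the image of $E_\lambda=\sum_{u\in U}\lambda(u)\,u\,\underline e$, for any group homomorphism $\lambda:U\to R^*$ such that $P$ is generated by $B$ and the transpositions $(i,i+1)$ for which $\lambda$ is non-trivial on $\{I_n+aE^{i,i+1} : a\in F_q\}$ (all such $\lambda$ give the same submodule).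 -/

import Mathlib

namespace SteinbergLattice

open Matrix

noncomputable section

/-! ### The general linear group and its standard parabolic subgroups -/

section Groups

variable {n : ℕ} {F : Type*} [Field F]

/-- The group of invertible matrices that are block upper triangular with respect to the
(ordered) partition of the index set into the fibres of `b`. -/
def blockSubgroup {α : Type*} [LinearOrder α] (b : Fin n → α) : Subgroup (GL (Fin n) F) where
  carrier := {g | (g : Matrix (Fin n) (Fin n) F).BlockTriangular b}
  one_mem' := by
    simpa using (blockTriangular_one : (1 : Matrix (Fin n) (Fin n) F).BlockTriangular b)
  mul_mem' := by
    intro x y hx hy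
    simpa using Matrix.BlockTriangular.mul hx hy
  inv_mem' := by
    intro x hx
    simp only [Set.mem_ofPred_eq] at hx ⊢
    rw [Matrix.coe_units_inv]
    have := x.invertible
    exact blockTriangular_inv_of_blockTriangular hx

variable (n F) in
/-- The upper triangular group `B`. -/
def borel : Subgroup (GL (Fin n) F) := blockSubgroup (fun i : Fin n => i)

variable (n F) in
/-- The upper unitriangular group `U`. -/
def unitriangular : Subgroup (GL (Fin n) F) where
  carrier := {g | g ∈ borel n F ∧ ∀ i, (g : Matrix (Fin n) (Fin n) F) i i = 1}
  one_mem' := ⟨one_mem _, by simp⟩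
  mul_mem' := by
    rintro x y ⟨hx, hx1⟩ ⟨hy, hy1⟩
    refine ⟨mul_mem hx hy, fun i => ?_⟩
    rw [Units.val_mul, Matrix.mul_apply, Finset.sum_eq_single i]
    · rw [hx1, hy1, one_mul]
    · intro j _ hj
      rcases lt_or_gt_of_ne hj with h | h
      · have h0 : (x : Matrix (Fin n) (Fin n) F) i j = 0 := hx h
        rw [h0, zero_mul]
      · have h0 : (y : Matrix (Fin n) (Fin n) F) j i = 0 := hy h
        rw [h0, mul_zero]
    · simp
  inv_mem' := by
    rintro x ⟨hx, hx1⟩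
    have hi : x⁻¹ ∈ borel n F := inv_mem hx
    refine ⟨hi, fun i => ?_⟩
    have h : ((x * x⁻¹ : GL (Fin n) F) : Matrix (Fin n) (Fin n) F) i i = 1 := by simp
    rw [Units.val_mul, Matrix.mul_apply, Finset.sum_eq_single i] at h
    · rwa [hx1, one_mul] at h
    · intro j _ hj
      rcases lt_or_gt_of_ne hj with h | h
      · have h0 : (x : Matrix (Fin n) (Fin n) F) i j = 0 := hx h
        rw [h0, zero_mul]
      · have h0 : ((x⁻¹ : GL (Fin n) F) : Matrix (Fin n) (Fin n) F) j i = 0 := hi h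
        rw [h0, mul_zero]
    · simp

/-- The permutation matrix of `σ`, which maps the basis vector `e_i` to `e_{σ i}`. -/
def permGL (σ : Equiv.Perm (Fin n)) : GL (Fin n) F where
  val := Matrix.of fun i j => if i = σ j then 1 else 0
  inv := Matrix.of fun i j => if σ i = j then 1 else 0
  val_inv := by
    ext i j
    rw [Matrix.mul_apply, Finset.sum_eq_single (σ⁻¹ i)]
    · simp [Matrix.one_apply]
    · intro k _ hk
      have : i ≠ σ k := fun h => hk (by simp [h])
      simp [this]
    · simp
  inv_val := by
    ext i j
    rw [Matrix.mul_apply, Finset.sum_eq_single (σ i)]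
    · simp [Matrix.one_apply]
    · intro k _ hk
      simp [Ne.symm hk]
    · simp

/-- The standard parabolic subgroup `P_J = ⟨B, J⟩`, for a set `J` of permutations. -/
def parabolicOfSet (F : Type*) [Field F] (J : Set (Equiv.Perm (Fin n))) :
    Subgroup (GL (Fin n) F) :=
  Subgroup.closure ((borel n F : Set (GL (Fin n) F)) ∪ permGL '' J)

/-- The block upper triangular group with blocks of sizes `a_1, …, a_k`. -/
def parabolicOfComposition (F : Type*) [Field F] (a : Composition n) :
    Subgroup (GL (Fin n) F) := blockSubgroup a.index

/-- `J(lam)`: the transpositions `(i, i+1)` such that `lam` is non-trivial on the root subgroup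
`X_{i,i+1} = {1 + a E^{i,i+1}}`. -/
def supportSet {A : Type*} [Monoid A] (lam : unitriangular n F →* A) :
    Set (Equiv.Perm (Fin n)) :=
  {τ | ∃ i j : Fin n, (i : ℕ) + 1 = j ∧ τ = Equiv.swap i j ∧
    ∃ (a : F) (u : unitriangular n F),
      ((u : GL (Fin n) F) : Matrix (Fin n) (Fin n) F) = Matrix.transvection i j a ∧ lam u ≠ 1}

/-- `P(lam) = P_{J(lam)}`. -/
def parabolicOfChar {A : Type*} [Monoid A] (lam : unitriangular n F →* A) :
    Subgroup (GL (Fin n) F) := parabolicOfSet F (supportSet lam)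

variable (n F) in
/-- `c` is a `𝒫`-value: `c = ν_ℓ([G : P])` for some subgroup `P` of `G` containing `B`. -/
def IsPValue (ℓ c : ℕ) : Prop :=
  ∃ P : Subgroup (GL (Fin n) F), borel n F ≤ P ∧ padicValNat ℓ P.index = c

end Groups

/-! ### The numbers `e` and `d` -/

/-- `e = min {i ≥ 2 : ℓ ∣ (q ^ i - 1) / (q - 1)}`. -/
def eNumber (q ℓ : ℕ) : ℕ := sInf {i : ℕ | 2 ≤ i ∧ ℓ ∣ (q ^ i - 1) / (q - 1)}

/-- `d = ν_ℓ((q ^ e - 1) / (q - 1))`. -/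
def dNumber (q ℓ : ℕ) : ℕ := padicValNat ℓ ((q ^ eNumber q ℓ - 1) / (q - 1))

/-- `𝒫*(c)`, through the compositions `(1, …, 1, e, …, e, eℓ, …, eℓ, eℓ², …)` of `n` that
describe its elements: the blocks are weakly increasing, every block is `1` or some `e ℓ ^ i`, and
the corresponding parabolic subgroup has index of `ℓ`-adic valuation `c`. -/
def starCompositions (n : ℕ) (F : Type*) [Field F] (ℓ c : ℕ) : Set (Composition n) :=
  {a | a.blocks.Pairwise (· ≤ ·) ∧
    (∀ b ∈ a.blocks, b = 1 ∨ ∃ i : ℕ, b = eNumber (Nat.card F) ℓ * ℓ ^ i) ∧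
    padicValNat ℓ (parabolicOfComposition F a).index = c}

/-! ### The Steinberg lattice and its reduction modulo `ℓ` -/

section Lattice

variable (n : ℕ) (F : Type*) [Field F] [Fintype F] [DecidableEq F] (R : Type*) [CommRing R]

/-- The group algebra `RG`, `G = GL_n(F)`. -/
abbrev GroupAlg := MonoidAlgebra R (GL (Fin n) F)

open Classical in
/-- `Ŝ`, the sum in `RG` of the elements of a subset `S` of `G`. -/
def hat (S : Set (GL (Fin n) F)) : GroupAlg n F R :=
  ∑ g with g ∈ S, MonoidAlgebra.single g 1

/-- The element `∑_σ sg(σ) σ B̂` of `RG`. -/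
def steinbergElement : GroupAlg n F R :=
  ∑ σ : Equiv.Perm (Fin n),
    MonoidAlgebra.single (permGL σ) ((Equiv.Perm.sign σ : ℤ) : R) * hat n F R (borel n F)

/-- The Steinberg lattice `I`, the left ideal of `RG` generated by `steinbergElement`. -/
def lattice : Submodule (GroupAlg n F R) (GroupAlg n F R) :=
  Submodule.span (GroupAlg n F R) {steinbergElement n F R}

/-- The submodule `ℓ I` of `I`. -/
def latticeMul (ℓ : ℕ) : Submodule (GroupAlg n F R) (lattice n F R) where
  carrier := {x | ∃ y, x = ℓ • y}
  add_mem' := by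
    rintro _ _ ⟨x, rfl⟩ ⟨y, rfl⟩
    exact ⟨x + y, (smul_add _ _ _).symm⟩
  zero_mem' := ⟨0, (smul_zero _).symm⟩
  smul_mem' := by
    rintro r _ ⟨x, rfl⟩
    exact ⟨r • x, smul_comm _ _ _⟩

/-- `L = I / ℓ I`. -/
def reduction (ℓ : ℕ) : Type _ := lattice n F R ⧸ latticeMul n F R ℓ

instance (ℓ : ℕ) : AddCommGroup (reduction n F R ℓ) :=
  inferInstanceAs (AddCommGroup (lattice n F R ⧸ latticeMul n F R ℓ))

instance (ℓ : ℕ) : Module (GroupAlg n F R) (reduction n F R ℓ) :=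
  inferInstanceAs (Module (GroupAlg n F R) (lattice n F R ⧸ latticeMul n F R ℓ))

/-- The projection `I → L`. -/
def toReduction (ℓ : ℕ) : lattice n F R →ₗ[GroupAlg n F R] reduction n F R ℓ :=
  (latticeMul n F R ℓ).mkQ

theorem toReduction_surjective (ℓ : ℕ) : Function.Surjective (toReduction n F R ℓ) :=
  Submodule.mkQ_surjective _

theorem toReduction_eq_zero (ℓ : ℕ) (x : lattice n F R) :
    toReduction n F R ℓ x = 0 ↔ ∃ y, x = ℓ • y :=
  Submodule.Quotient.mk_eq_zero (latticeMul n F R ℓ)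

/-- `K = R / ℓ R`. -/
abbrev ResField (ℓ : ℕ) := R ⧸ Ideal.span {(ℓ : R)}

/-- The coefficientwise reduction `RG → KG`. -/
def redHom (ℓ : ℕ) : GroupAlg n F R →+* GroupAlg n F (ResField R ℓ) :=
  MonoidAlgebra.mapRingHom (GL (Fin n) F) (Ideal.Quotient.mk (Ideal.span {(ℓ : R)}))

theorem redHom_surjective (ℓ : ℕ) : Function.Surjective (redHom n F R ℓ) := by
  intro x
  induction x using MonoidAlgebra.induction_linear with
  | zero => exact ⟨0, map_zero _⟩
  | add x y hx hy =>
    obtain ⟨a, rfl⟩ := hx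
    obtain ⟨b, rfl⟩ := hy
    exact ⟨a + b, map_add _ _ _⟩
  | single g r =>
    obtain ⟨s, rfl⟩ := Ideal.Quotient.mk_surjective r
    exact ⟨MonoidAlgebra.single g s, by simp [redHom]⟩

theorem exists_of_redHom_eq_zero (ℓ : ℕ) (r : GroupAlg n F R) (h : redHom n F R ℓ r = 0) :
    ∃ s : GroupAlg n F R, r = ℓ • s := by
  have h1 : ∀ g, ∃ a : R, r.coeff g = ℓ * a := by
    intro g
    have h2 := congrArg (fun z => z.coeff g) h
    simp only [redHom, MonoidAlgebra.coeff_mapRingHom] at h2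
    have h3 : (Ideal.Quotient.mk (Ideal.span {(ℓ : R)})) (r.coeff g) = 0 := by simpa using h2
    rw [Ideal.Quotient.eq_zero_iff_mem, Ideal.mem_span_singleton] at h3
    exact h3
  choose a ha using h1
  refine ⟨MonoidAlgebra.ofCoeff (Finsupp.equivFunOnFinite.symm a), ?_⟩
  ext g
  rw [MonoidAlgebra.coeff_smul, Finsupp.smul_apply, ha g, nsmul_eq_mul]
  rfl

/-- `RG → End(L)` annihilates the kernel of `RG → KG`. -/
theorem ker_redHom_le (ℓ : ℕ) : RingHom.ker (redHom n F R ℓ) ≤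
    RingHom.ker (Module.toAddMonoidEnd (GroupAlg n F R) (reduction n F R ℓ)) := by
  intro r hr
  obtain ⟨s, rfl⟩ := exists_of_redHom_eq_zero n F R ℓ r hr
  rw [RingHom.mem_ker]
  ext x
  obtain ⟨y, rfl⟩ := toReduction_surjective n F R ℓ x
  change (ℓ • s) • toReduction n F R ℓ y = 0
  rw [← map_smul, toReduction_eq_zero]
  exact ⟨s • y, smul_assoc _ _ _⟩

/-- The structure of `KG`-module on `L`, for which `KG` acts through any lifts of its elements
to `RG`; see `redHom_smul`. -/
instance instModuleReduction (ℓ : ℕ) :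
    Module (GroupAlg n F (ResField R ℓ)) (reduction n F R ℓ) :=
  Module.compHom (reduction n F R ℓ)
    (RingHom.liftOfSurjective (redHom n F R ℓ) (redHom_surjective n F R ℓ)
      ⟨Module.toAddMonoidEnd (GroupAlg n F R) (reduction n F R ℓ), ker_redHom_le n F R ℓ⟩)

theorem redHom_smul (ℓ : ℕ) (r : GroupAlg n F R) (x : reduction n F R ℓ) :
    redHom n F R ℓ r • x = r • x := by
  change (RingHom.liftOfSurjective (redHom n F R ℓ) (redHom_surjective n F R ℓ)
      ⟨Module.toAddMonoidEnd (GroupAlg n F R) (reduction n F R ℓ), ker_redHom_le n F R ℓ⟩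
      (redHom n F R ℓ r)) x = _
  rw [RingHom.liftOfRightInverse_comp_apply]
  rfl

/-- The image `(M + ℓ I) / ℓ I` in `L` of an `RG`-submodule `M` of `I`, a `KG`-submodule. -/
def reduceSubmodule (ℓ : ℕ) (M : Submodule (GroupAlg n F R) (lattice n F R)) :
    Submodule (GroupAlg n F (ResField R ℓ)) (reduction n F R ℓ) where
  carrier := toReduction n F R ℓ '' M
  add_mem' := by
    rintro _ _ ⟨x, hx, rfl⟩ ⟨y, hy, rfl⟩
    exact ⟨x + y, add_mem hx hy, map_add _ _ _⟩
  zero_mem' := ⟨0, zero_mem M, map_zero _⟩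
  smul_mem' := by
    rintro r _ ⟨x, hx, rfl⟩
    obtain ⟨s, rfl⟩ := redHom_surjective n F R ℓ r
    exact ⟨s • x, M.smul_mem s hx, by rw [map_smul, redHom_smul]⟩

/-! ### The bilinear form and the filtrations -/

/-- The canonical symmetric bilinear form `(g, h) ↦ δ_{g,h}` on `RG`. -/
def canonicalForm (x y : GroupAlg n F R) : R := ∑ g, x.coeff g * y.coeff g

/-- The canonical form restricted to `I` and scaled by `1 / |B|`. It takes its values in `R`; for
the purpose of the definition they are regarded as elements of the field of fractions of `R`. -/
def gowForm [IsDomain R] (x y : lattice n F R) : FractionRing R :=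
  algebraMap R (FractionRing R) (canonicalForm n F R x y) /
    ((Nat.card (borel n F) : ℕ) : FractionRing R)

theorem canonicalForm_add_left (x x' y : GroupAlg n F R) :
    canonicalForm n F R (x + x') y = canonicalForm n F R x y + canonicalForm n F R x' y := by
  simp [canonicalForm, add_mul, Finset.sum_add_distrib]

theorem canonicalForm_smul_left (a : R) (x y : GroupAlg n F R) :
    canonicalForm n F R (a • x) y = a * canonicalForm n F R x y := by
  simp [canonicalForm, Finset.mul_sum, mul_assoc]

theorem canonicalForm_single_mul (g : GL (Fin n) F) (a : R) (x y : GroupAlg n F R) :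
    canonicalForm n F R (MonoidAlgebra.single g a * x) y =
      a * canonicalForm n F R x (MonoidAlgebra.single g⁻¹ 1 * y) := by
  unfold canonicalForm
  rw [Finset.mul_sum, ← Equiv.sum_comp (Equiv.mulLeft g)]
  refine Finset.sum_congr rfl fun h _ => ?_
  simp [MonoidAlgebra.coeff_single_mul_apply, mul_assoc]

variable [IsDomain R]

/-- `I(c) = {x ∈ I : f(x, I) ⊆ ℓ^c R}`. -/
def latticeFiltration (ℓ c : ℕ) : Submodule (GroupAlg n F R) (lattice n F R) where
  carrier := {x | ∀ y : lattice n F R,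
    ∃ r : R, gowForm n F R x y = algebraMap R (FractionRing R) ((ℓ : R) ^ c * r)}
  add_mem' := by
    intro x x' hx hx' y
    obtain ⟨r, hr⟩ := hx y
    obtain ⟨r', hr'⟩ := hx' y
    refine ⟨r + r', ?_⟩
    rw [mul_add, map_add, ← hr, ← hr']
    simp [gowForm, canonicalForm_add_left, add_div]
  zero_mem' := fun y => ⟨0, by simp [gowForm, canonicalForm]⟩
  smul_mem' := by
    intro s x hx
    induction s using MonoidAlgebra.induction_linear with
    | zero => exact fun y => ⟨0, by simp [gowForm, canonicalForm]⟩
    | add s t hs ht =>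
      intro y
      obtain ⟨r, hr⟩ := hs y
      obtain ⟨r', hr'⟩ := ht y
      refine ⟨r + r', ?_⟩
      rw [mul_add, map_add, ← hr, ← hr', add_smul]
      simp [gowForm, canonicalForm_add_left, add_div]
    | single g a =>
      intro y
      obtain ⟨r, hr⟩ := hx (MonoidAlgebra.single g⁻¹ (1 : R) • y)
      refine ⟨a * r, ?_⟩
      have e : (ℓ : R) ^ c * (a * r) = a * ((ℓ : R) ^ c * r) := by ring
      rw [e, map_mul, ← hr]
      simp [gowForm, canonicalForm_single_mul, mul_div_assoc]

/-- `L(c) = (I(c) + ℓ I) / ℓ I`. -/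
def filtration (ℓ c : ℕ) : Submodule (GroupAlg n F (ResField R ℓ)) (reduction n F R ℓ) :=
  reduceSubmodule n F R ℓ (latticeFiltration n F R ℓ c)

end Lattice

/-! ### The submodules `L'(P)` -/

section Eigenvectors

variable {n : ℕ} {F : Type*} [Field F] [Fintype F] [DecidableEq F] {R : Type*} [CommRing R]

open Classical in
/-- `E_lam = ∑_{u ∈ U} lam(u) u s`, where `s` is the generator `steinbergElement` of `I`. -/
def eigenvector (lam : unitriangular n F →* Rˣ) : lattice n F R :=
  (∑ u : unitriangular n F, MonoidAlgebra.single (u : GL (Fin n) F) (lam u : R)) •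
    ⟨steinbergElement n F R, Submodule.subset_span rfl⟩

variable (R) in
/-- `I'(P)`, the `RG`-submodule of `I` generated by the elements `E_lam` with `P(lam) = P`.
These elements are permuted transitively by the diagonal subgroup of `G`, so that `I'(P)` is
generated by any single one of them. -/
def latticePart (P : Subgroup (GL (Fin n) F)) : Submodule (GroupAlg n F R) (lattice n F R) :=
  Submodule.span (GroupAlg n F R)
    {x | ∃ lam : unitriangular n F →* Rˣ, parabolicOfChar lam = P ∧ x = eigenvector lam}

variable (R) in
/-- `L'(P) = (I'(P) + ℓ I) / ℓ I`. -/
def part (ℓ : ℕ) (P : Subgroup (GL (Fin n) F)) :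
    Submodule (GroupAlg n F (ResField R ℓ)) (reduction n F R ℓ) :=
  reduceSubmodule n F R ℓ (latticePart R P)

end Eigenvectors

/-! ### The radical series of a module -/

/-- The radical series of a module: `rad⁰(M) = M`, and `rad^{i+1}(M) = rad(rad^i(M))` is the
intersection of the maximal submodules of `rad^i(M)`. -/
def radicalSeries (A M : Type*) [Ring A] [AddCommGroup M] [Module A M] : ℕ → Submodule A M
  | 0 => ⊤
  | i + 1 => (Module.jacobson A (radicalSeries A M i)).map (radicalSeries A M i).subtype

end

end SteinbergLattice

set_option linter.unusedSectionVars false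
set_option linter.unusedSimpArgs false

/-! Write s for the generator of I. The elements u s, u in U, form an R-basis of I, so I is free of
rank one over RU and each linear character of U contributes one line, spanned by some E_λ. The order
of U is a unit in R, so the sums over U that cut out these lines survive reduction modulo ℓ.

The eigenvectors control the submodules of L. Any nonzero module for GL_n(q) over a ring in which q
is invertible and which has a nontrivial additive character of F contains an eigenvector of U
(`exists_unitriangular_eigenvector`, by working through the columns from the last to the first).
Hence N' ≤ N in L as soon as every E_λ in N' lies in N (`le_of_redVec`). They control the form too:
f(E_λ, y) is [G : P(λ)] times the coefficient of y along E_{λ⁻¹} (`canonicalBilin_eigenvector`). So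
E_λ lies in L(c) exactly when c ≤ ν_ℓ([G : P(λ)]), and taking orthogonals at level i yields, for any
N, a submodule of L(i) that contains precisely those E_λ of valuation i that N omits, along with all
those of larger valuation (`exists_complement`). In this sense each layer L(i)/L(i+1) is semisimple,
which gives rad L(i) ≤ L(i+1).

For the reverse inclusion, L(c) has to be generated by the E_λ of valuation exactly c. Let λ have
type l, the list of block sizes of P(λ). Applying the permutation that exchanges two neighbouring
blocks and projecting onto a line shows that E_λ is a multiple, under RG, of an eigenvector with
these blocks exchanged, or merged into one (`eigenLE_of_blockSwap`, `HasType.eigenLE_swapSeq`); in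
the same way a block can be split inside the submodule generated by E_λ. By the duality above, a
split that preserves the valuation is reversible (`redVec_mem_of_eigenLE`).

The valuation of the index is V(n) - ∑ V(b) over the blocks b, where V(m) is the valuation of the
q-factorial of m. If d = 1, then V(m) = ⌊m/e⌋ + ν_ℓ(⌊m/e⌋!). A block other than 1 and e ℓ^i splits
without loss (`valuation_split`), and if all blocks are of this kind and the valuation is positive,
then e blocks 1 or ℓ blocks e ℓ^i can be merged, which lowers the valuation by exactly one
(`valuation_merge`). Induction brings every E_λ of L(c) into the submodule generated by the E_μ
whose types belong to 𝒫*(c) (`redVec_mem_of_good`). This is the description of L(c), and with it the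
equality rad L(i) = L(i+1). -/

namespace SteinbergLattice

open Matrix

noncomputable section

/-! ### Permutation matrices, transvections, diagonal matrices, and generators of GL_n(F). -/

section GroupLemmas

variable {n : ℕ} {F : Type*} [Field F]

theorem perm_apply_inv (σ : Equiv.Perm (Fin n)) (i : Fin n) : σ (σ⁻¹ i) = i :=
  σ.apply_symm_apply i

theorem perm_inv_apply (σ : Equiv.Perm (Fin n)) (i : Fin n) : σ⁻¹ (σ i) = i :=
  σ.symm_apply_apply i

theorem mem_blockSubgroup {α : Type*} [LinearOrder α] {b : Fin n → α} {g : GL (Fin n) F} :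
    g ∈ blockSubgroup b ↔ ∀ i j, b j < b i → g.val i j = 0 :=
  ⟨fun h _ _ hij => h hij, fun h i j hij => h i j hij⟩

theorem mem_borel {g : GL (Fin n) F} : g ∈ borel n F ↔ ∀ i j, j < i → g.val i j = 0 :=
  mem_blockSubgroup

theorem mem_unitriangular {g : GL (Fin n) F} :
    g ∈ unitriangular n F ↔ (∀ i j, j < i → g.val i j = 0) ∧ ∀ i, g.val i i = 1 := by
  rw [← mem_borel]; rfl

theorem unitriangular_le_borel : unitriangular n F ≤ borel n F := fun _ h => h.1

theorem permGL_apply (σ : Equiv.Perm (Fin n)) (i j : Fin n) :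
    (permGL σ : GL (Fin n) F).val i j = if i = σ j then 1 else 0 := rfl

theorem mul_permGL_apply (g : GL (Fin n) F) (σ : Equiv.Perm (Fin n)) (i j : Fin n) :
    (g * permGL σ).val i j = g.val i (σ j) := by
  rw [Units.val_mul, Matrix.mul_apply, Finset.sum_eq_single (σ j)]
  · simp [permGL_apply]
  · intro k _ hk; simp [permGL_apply, hk]
  · simp

theorem permGL_mul_apply (g : GL (Fin n) F) (σ : Equiv.Perm (Fin n)) (i j : Fin n) :
    (permGL σ * g).val i j = g.val (σ⁻¹ i) j := by
  rw [Units.val_mul, Matrix.mul_apply, Finset.sum_eq_single (σ⁻¹ i)]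
  · simp [permGL_apply]
  · intro k _ hk
    have : i ≠ σ k := fun h => hk (by simp [h])
    simp [permGL_apply, this]
  · simp

theorem permGL_mul (σ τ : Equiv.Perm (Fin n)) :
    (permGL (σ * τ) : GL (Fin n) F) = permGL σ * permGL τ := by
  ext i j; rw [mul_permGL_apply]; rfl

theorem permGL_one : (permGL 1 : GL (Fin n) F) = 1 := by
  ext i j; by_cases h : i = j <;> simp [permGL_apply, h]

theorem permGL_inv (σ : Equiv.Perm (Fin n)) :
    (permGL σ⁻¹ : GL (Fin n) F) = (permGL σ)⁻¹ := by
  rw [eq_inv_iff_mul_eq_one, ← permGL_mul, inv_mul_cancel, permGL_one]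

theorem permGL_conj_apply (g : GL (Fin n) F) (σ : Equiv.Perm (Fin n)) (i j : Fin n) :
    (permGL σ * g * (permGL σ)⁻¹).val i j = g.val (σ⁻¹ i) (σ⁻¹ j) := by
  rw [← permGL_inv, mul_permGL_apply, permGL_mul_apply]

theorem permGL_conj_apply' (g : GL (Fin n) F) (σ : Equiv.Perm (Fin n)) (i j : Fin n) :
    ((permGL σ)⁻¹ * g * permGL σ).val i j = g.val (σ i) (σ j) := by
  rw [← permGL_inv, mul_permGL_apply, permGL_mul_apply, inv_inv]

/-- The transvection `1 + t E^{i,j}` as an element of the general linear group. -/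
def transvectionGL (i j : Fin n) (h : i ≠ j) (t : F) : GL (Fin n) F where
  val := transvection i j t
  inv := transvection i j (-t)
  val_inv := by rw [transvection_mul_transvection_same _ _ h]; simp
  inv_val := by rw [transvection_mul_transvection_same _ _ h]; simp

theorem transvectionGL_apply (i j : Fin n) (h : i ≠ j) (t : F) (a b : Fin n) :
    (transvectionGL i j h t).val a b =
      (if a = b then 1 else 0) + if i = a ∧ j = b then t else 0 := by
  simp [transvectionGL, transvection, Matrix.one_apply, Matrix.single_apply]

theorem transvectionGL_mul (i j : Fin n) (h : i ≠ j) (s t : F) :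
    transvectionGL i j h s * transvectionGL i j h t = transvectionGL i j h (s + t) := by
  ext : 1
  exact transvection_mul_transvection_same _ _ h s t

theorem transvectionGL_zero (i j : Fin n) (h : i ≠ j) :
    transvectionGL i j h (0 : F) = 1 := by
  ext : 1
  exact transvection_zero _ _

theorem transvectionGL_inv (i j : Fin n) (h : i ≠ j) (t : F) :
    (transvectionGL i j h t)⁻¹ = transvectionGL i j h (-t) := by
  rw [inv_eq_iff_mul_eq_one, transvectionGL_mul, add_neg_cancel, transvectionGL_zero]

theorem transvectionGL_mul_apply (i j : Fin n) (h : i ≠ j) (t : F) (g : GL (Fin n) F)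
    (a b : Fin n) :
    (transvectionGL i j h t * g).val a b = g.val a b + if a = i then t * g.val j b else 0 := by
  rw [Units.val_mul]
  change (transvection i j t * g.val) a b = _
  split_ifs with h1
  · subst h1; rw [transvection_mul_apply_same]
  · rw [transvection_mul_apply_of_ne _ _ _ _ h1, add_zero]

theorem mul_transvectionGL_apply (i j : Fin n) (h : i ≠ j) (t : F) (g : GL (Fin n) F)
    (a b : Fin n) :
    (g * transvectionGL i j h t).val a b = g.val a b + if b = j then t * g.val a i else 0 := by
  rw [Units.val_mul]
  change (g.val * transvection i j t) a b = _
  split_ifs with h1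
  · subst h1; rw [mul_transvection_apply_same]
  · rw [mul_transvection_apply_of_ne _ _ _ _ h1, add_zero]

theorem permGL_conj_transvectionGL (σ : Equiv.Perm (Fin n)) (i j : Fin n) (h : i ≠ j) (t : F) :
    permGL σ * transvectionGL i j h t * (permGL σ)⁻¹ =
      transvectionGL (σ i) (σ j) (σ.injective.ne h) t := by
  ext a b
  rw [permGL_conj_apply, transvectionGL_apply, transvectionGL_apply]
  simp only [Equiv.Perm.eq_inv_iff_eq, perm_apply_inv]

theorem transvectionGL_mem_unitriangular {i j : Fin n} (h : i < j) (t : F) :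
    transvectionGL i j h.ne t ∈ unitriangular n F := by
  rw [mem_unitriangular]
  constructor
  · intro a b hab
    rw [transvectionGL_apply, if_neg hab.ne', if_neg, add_zero]
    rintro ⟨rfl, rfl⟩; exact lt_asymm h hab
  · intro a
    rw [transvectionGL_apply, if_pos rfl, if_neg, add_zero]
    rintro ⟨rfl, h2⟩; exact h.ne' h2

/-- The diagonal element of `GL_n(F)` with prescribed units on the diagonal. -/
def diagGL (d : Fin n → Fˣ) : GL (Fin n) F where
  val := diagonal fun i => (d i : F)
  inv := diagonal fun i => ((d i)⁻¹ : Fˣ)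
  val_inv := by simp [diagonal_mul_diagonal]
  inv_val := by simp [diagonal_mul_diagonal]

theorem diagGL_apply (d : Fin n → Fˣ) (i j : Fin n) :
    (diagGL d).val i j = if i = j then (d i : F) else 0 := by
  simp [diagGL, diagonal_apply]

theorem diagGL_mem_borel (d : Fin n → Fˣ) : diagGL d ∈ borel n F := by
  rw [mem_borel]; intro i j h; rw [diagGL_apply, if_neg h.ne']

theorem diagGL_inv (d : Fin n → Fˣ) : (diagGL d)⁻¹ = diagGL d⁻¹ := by
  rw [inv_eq_iff_mul_eq_one]
  ext i j
  by_cases h : i = j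
  · subst h; simp [diagGL]
  · simp [diagGL, h]

theorem diagGL_mul_apply (d : Fin n → Fˣ) (g : GL (Fin n) F) (i j : Fin n) :
    (diagGL d * g).val i j = d i * g.val i j := by
  rw [Units.val_mul]; simp [diagGL]

theorem mul_diagGL_apply (d : Fin n → Fˣ) (g : GL (Fin n) F) (i j : Fin n) :
    (g * diagGL d).val i j = g.val i j * d j := by
  rw [Units.val_mul]; simp [diagGL]

theorem permGL_conj_diagGL (σ : Equiv.Perm (Fin n)) (d : Fin n → Fˣ) :
    (permGL σ)⁻¹ * diagGL d * permGL σ = diagGL (d ∘ σ) := by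
  ext a b
  rw [permGL_conj_apply', diagGL_apply, diagGL_apply]
  simp

theorem mclosure_adjacent_swaps :
    Submonoid.closure {τ : Equiv.Perm (Fin n) | ∃ i j : Fin n, (i : ℕ) + 1 = j ∧
      τ = Equiv.swap i j} = ⊤ := by
  rcases n with _ | n
  · rw [eq_top_iff]; intro x _; rw [Subsingleton.elim x 1]; exact one_mem _
  · rw [eq_top_iff, ← Equiv.Perm.mclosure_swap_castSucc_succ, Submonoid.closure_le]
    rintro _ ⟨i, rfl⟩
    exact Submonoid.subset_closure ⟨i.castSucc, i.succ, by simp, rfl⟩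

/-- A submonoid that contains the diagonal matrices, the upper transvections and the adjacent
transpositions is everything. -/
theorem submonoid_eq_top (S : Submonoid (GL (Fin n) F)) (hd : ∀ d, diagGL d ∈ S)
    (hu : ∀ (i j : Fin n) (h : i < j) (t : F), transvectionGL i j h.ne t ∈ S)
    (hs : ∀ i j : Fin n, (i : ℕ) + 1 = j → permGL (Equiv.swap i j) ∈ S) : S = ⊤ := by
  have hperm : ∀ σ : Equiv.Perm (Fin n), permGL σ ∈ S := by
    intro σ
    have : σ ∈ Submonoid.closure {τ : Equiv.Perm (Fin n) | ∃ i j : Fin n, (i : ℕ) + 1 = j ∧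
      τ = Equiv.swap i j} := by rw [mclosure_adjacent_swaps]; trivial
    induction this using Submonoid.closure_induction with
    | mem x hx => obtain ⟨i, j, h, rfl⟩ := hx; exact hs i j h
    | one => rw [permGL_one]; exact one_mem _
    | mul x y _ _ hx hy => rw [permGL_mul]; exact mul_mem hx hy
  have htv : ∀ (i j : Fin n) (h : i ≠ j) (t : F), transvectionGL i j h t ∈ S := by
    intro i j h t
    rcases lt_or_gt_of_ne h with h1 | h1
    · exact hu i j h1 t
    -- Lower transvections are conjugates of upper ones under permutation matrices.
    · have := permGL_conj_transvectionGL (Equiv.swap i j) j i h.symm t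
      simp only [Equiv.swap_apply_left, Equiv.swap_apply_right] at this
      rw [← this, ← permGL_inv]
      exact mul_mem (mul_mem (hperm _) (hu j i h1 t)) (hperm _)
  rw [eq_top_iff]
  intro g _
  have key : ∀ M : Matrix (Fin n) (Fin n) F, M.det ≠ 0 → ∃ h ∈ S, h.val = M := by
    intro M hM
    refine diagonal_transvection_induction_of_det_ne_zero (fun M => ∃ h ∈ S, h.val = M) M hM
      (fun D hD => ?_) (fun t => ⟨transvectionGL t.i t.j t.hij t.c, htv _ _ _ _, rfl⟩) ?_
    · rw [det_diagonal] at hD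
      exact ⟨diagGL fun i => Units.mk0 (D i) ((Finset.prod_ne_zero_iff.1 hD) i
        (Finset.mem_univ i)), hd _, by simp [diagGL]⟩
    · rintro _ _ - - ⟨a, ha, rfl⟩ ⟨b, hb, rfl⟩
      exact ⟨a * b, mul_mem ha hb, rfl⟩
  obtain ⟨h, hh, e⟩ := key g.val (g.isUnit.map Matrix.detMonoidHom).ne_zero
  rwa [← Units.ext e]

end GroupLemmas

/-! ### The Bruhat decomposition. -/

section Bruhat

variable {n : ℕ} {F : Type*} [Field F]

/-- Induction on permutations by removing descents. -/
theorem perm_descent_induction {P : Equiv.Perm (Fin n) → Prop}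
    (h : ∀ σ, (∀ i j : Fin n, (i : ℕ) + 1 = j → σ j < σ i → P (σ * Equiv.swap i j)) → P σ)
    (σ : Equiv.Perm (Fin n)) : P σ := by
  by_contra hσ
  -- Removing a descent strictly increases this sum, so a counterexample that maximizes it is
  -- refuted by the hypothesis.
  let f : Equiv.Perm (Fin n) → ℤ := fun τ => ∑ k : Fin n, (k : ℤ) * (τ k : ℤ)
  obtain ⟨τ, hτ, hmax⟩ := Set.exists_max_image {τ | ¬ P τ} f (Set.toFinite _) ⟨σ, hσ⟩
  refine hτ (h τ fun i j hij hlt => ?_)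
  by_contra hP
  have h1 := hmax _ hP
  have h2 : f (τ * Equiv.swap i j) - f τ = ((j : ℤ) - i) * ((τ i : ℤ) - τ j) := by
    simp only [f, ← Finset.sum_sub_distrib]
    have hne : i ≠ j := by rintro rfl; simp at hij
    rw [Finset.sum_eq_add i j hne]
    · simp; ring
    · rintro k - ⟨hki, hkj⟩
      simp [Equiv.swap_apply_of_ne_of_ne hki hkj]
    · simp
    · simp
  have h3 : (0 : ℤ) < ((j : ℤ) - i) * ((τ i : ℤ) - τ j) := by
    apply mul_pos
    · rw [← hij]; push_cast; linarith
    · have : (τ j : ℕ) < τ i := hlt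
      have : ((τ j : ℕ) : ℤ) < (τ i : ℕ) := by exact_mod_cast this
      linarith
  linarith

theorem perm_le_id_eq_one (σ : Equiv.Perm (Fin n)) (h : ∀ i, σ i ≤ i) : σ = 1 := by
  have h1 : ∑ i, (σ i).val = ∑ i : Fin n, i.val :=
    Equiv.sum_comp σ (fun i : Fin n => i.val)
  have h2 := (Finset.sum_eq_sum_iff_of_le (f := fun i => (σ i).val) (g := fun i : Fin n => i.val)
    (fun i _ => Fin.le_def.1 (h i))).1 h1
  ext i
  exact h2 i (Finset.mem_univ i)

theorem perm_eq_one_of_monotone (σ : Equiv.Perm (Fin n))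
    (h : ∀ i j : Fin n, (i : ℕ) + 1 = j → σ i < σ j) : σ = 1 := by
  have h1 : StrictMono σ := by
    rcases n with _ | n
    · intro i; exact i.elim0
    · exact Fin.strictMono_iff_lt_succ.2 fun i => h _ _ (by simp)
  have h2 : ∀ i, i ≤ σ i := fun i => h1.le_apply
  have h3 : σ⁻¹ = 1 := perm_le_id_eq_one _ fun i => by simpa using h2 (σ⁻¹ i)
  simpa using h3

/-- The identity in GL_2 that places a nontrivial lower unipotent matrix in the big Bruhat cell. It
is the only relation needed when a simple reflection acts on `U σ B` or on the Steinberg lattice. -/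
theorem permGL_swap_mul_transvectionGL {i j : Fin n} (h : i ≠ j) {t : F} (ht : t ≠ 0) :
    ∃ d, permGL (Equiv.swap i j) * transvectionGL i j h t =
      transvectionGL i j h t⁻¹ * permGL (Equiv.swap i j) * diagGL d *
        transvectionGL i j h t⁻¹ * permGL (Equiv.swap i j) := by
  refine ⟨fun k => if k = i then Units.mk0 t ht else if k = j then -(Units.mk0 t ht)⁻¹ else 1, ?_⟩
  have hs : (permGL (Equiv.swap i j) : GL (Fin n) F) * permGL (Equiv.swap i j) = 1 := by
    rw [← permGL_mul, Equiv.swap_mul_self, permGL_one]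
  ext a b
  simp only [mul_permGL_apply, mul_transvectionGL_apply, mul_diagGL_apply, permGL_apply,
    transvectionGL_mul_apply, Equiv.swap_apply_left, permGL_mul_apply,
    transvectionGL_apply, Equiv.swap_inv]
  by_cases hai : a = i
  · subst hai
    by_cases hba : b = a
    · subst hba; simp [h, h.symm, ht]
    · by_cases hbj : b = j
      · subst hbj; simp [h, h.symm, ht]
      · simp [h, h.symm, hba, hbj, Equiv.swap_apply_of_ne_of_ne hba hbj, Ne.symm hba,
          Ne.symm hbj]
  · by_cases haj : a = j
    · subst haj
      by_cases hba : b = a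
      · subst hba; simp [h, h.symm, ht]
      · by_cases hbi : b = i
        · subst hbi; simp [h, h.symm, inv_mul_cancel₀ ht]
        · simp [h, h.symm, hba, hbi, Equiv.swap_apply_of_ne_of_ne hbi hba, Ne.symm hba,
            Ne.symm hbi]
    · by_cases hbj : b = j
      · subst hbj; simp [h, h.symm, hai, haj, Equiv.swap_apply_of_ne_of_ne hai haj, Ne.symm hai]
      · by_cases hbi : b = i
        · subst hbi
          simp [h, h.symm, hai, haj, Equiv.swap_apply_of_ne_of_ne hai haj, Ne.symm hai]
        · simp [hai, haj, Equiv.swap_apply_of_ne_of_ne hai haj,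
            Equiv.swap_apply_of_ne_of_ne hbi hbj, Ne.symm hai, hbi, hbj]

theorem adjacent_swap_lt {i j : Fin n} (hij : (i : ℕ) + 1 = j) {a b : Fin n} (hab : b < a)
    (h : ¬ (a = j ∧ b = i)) : Equiv.swap i j b < Equiv.swap i j a := by
  simp only [Equiv.swap_apply_def, Fin.ext_iff] at h ⊢
  simp only [Fin.lt_def] at hab
  split_ifs <;> simp only [Fin.lt_def] <;> omega

theorem swap_conj_mem_unitriangular {i j : Fin n} (hij : (i : ℕ) + 1 = j) {u : GL (Fin n) F}
    (hu : u ∈ unitriangular n F) (h0 : u.val i j = 0) :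
    permGL (Equiv.swap i j) * u * (permGL (Equiv.swap i j))⁻¹ ∈ unitriangular n F := by
  rw [mem_unitriangular] at hu ⊢
  constructor
  · intro a b hab
    rw [permGL_conj_apply, Equiv.swap_inv]
    by_cases h : a = j ∧ b = i
    · rw [h.1, h.2, Equiv.swap_apply_left, Equiv.swap_apply_right, h0]
    · exact hu.1 _ _ (adjacent_swap_lt hij hab h)
  · intro a
    rw [permGL_conj_apply, hu.2]

theorem diagGL_conj_mem_unitriangular (d : Fin n → Fˣ) {u : GL (Fin n) F}
    (hu : u ∈ unitriangular n F) : diagGL d * u * (diagGL d)⁻¹ ∈ unitriangular n F := by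
  rw [mem_unitriangular] at hu ⊢
  constructor
  · intro a b hab
    rw [diagGL_inv, mul_diagGL_apply, diagGL_mul_apply, hu.1 a b hab]; simp
  · intro a
    rw [diagGL_inv, mul_diagGL_apply, diagGL_mul_apply, hu.2]; simp

theorem exists_eq_mul_transvectionGL {i j : Fin n} (hij : i < j) {u : GL (Fin n) F}
    (hu : u ∈ unitriangular n F) :
    ∃ u' ∈ unitriangular n F, u'.val i j = 0 ∧ u = u' * transvectionGL i j hij.ne (u.val i j) := by
  refine ⟨u * transvectionGL i j hij.ne (-u.val i j),
    mul_mem hu (transvectionGL_mem_unitriangular hij _), ?_, ?_⟩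
  · rw [mul_transvectionGL_apply, if_pos rfl, (mem_unitriangular.1 hu).2]; ring
  · rw [mul_assoc, transvectionGL_mul, neg_add_cancel, transvectionGL_zero, mul_one]

theorem transvectionGL_mul_permGL (σ : Equiv.Perm (Fin n)) {i j : Fin n} (h : i ≠ j) (t : F) :
    transvectionGL i j h t * permGL σ =
      permGL σ * transvectionGL (σ⁻¹ i) (σ⁻¹ j) (σ⁻¹.injective.ne h) t := by
  have := permGL_conj_transvectionGL σ (σ⁻¹ i) (σ⁻¹ j) (σ⁻¹.injective.ne h) t
  simp only [perm_apply_inv] at this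
  rw [← this]; group

theorem diagGL_mul_permGL (σ : Equiv.Perm (Fin n)) (d : Fin n → Fˣ) :
    diagGL d * permGL σ = permGL σ * diagGL (d ∘ σ) := by
  rw [← permGL_conj_diagGL]; group

/-- Every invertible matrix lies in some `U σ B`. -/
theorem exists_bruhat (g : GL (Fin n) F) :
    ∃ u ∈ unitriangular n F, ∃ σ, ∃ b ∈ borel n F, g = u * permGL σ * b := by
  let Y : Set (GL (Fin n) F) :=
    {g | ∃ u ∈ unitriangular n F, ∃ σ, ∃ b ∈ borel n F, g = u * permGL σ * b}
  -- The elements whose left multiplication preserves the union of the `U σ B` form a submonoid, so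
  -- it is enough to treat generators.
  let S : Submonoid (GL (Fin n) F) :=
    { carrier := {g | ∀ y ∈ Y, g * y ∈ Y}
      one_mem' := fun y hy => by simpa using hy
      mul_mem' := fun {a b} ha hb y hy => by rw [mul_assoc]; exact ha _ (hb _ hy) }
  have hS : S = ⊤ := by
    apply submonoid_eq_top
    · rintro d _ ⟨u, hu, σ, b, hb, rfl⟩
      refine ⟨_, diagGL_conj_mem_unitriangular d hu, σ, diagGL (d ∘ σ) * b,
        mul_mem (diagGL_mem_borel _) hb, ?_⟩
      have := diagGL_mul_permGL σ d
      calc _ = diagGL d * u * (diagGL d)⁻¹ * (diagGL d * permGL σ) * b := by group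
        _ = _ := by rw [this]; group
    · rintro i j h t _ ⟨u, hu, σ, b, hb, rfl⟩
      exact ⟨_, mul_mem (transvectionGL_mem_unitriangular h t) hu, σ, b, hb, by group⟩
    · rintro i j hij _ ⟨u, hu, σ, b, hb, rfl⟩
      have hlt : i < j := by rw [Fin.lt_def]; omega
      obtain ⟨u', hu', h0, e⟩ := exists_eq_mul_transvectionGL hlt hu
      set t := u.val i j
      have hmem := swap_conj_mem_unitriangular hij hu' h0
      set s := Equiv.swap i j
      suffices permGL s * transvectionGL i j hlt.ne t * permGL σ * b ∈ Y by
        obtain ⟨v, hv, τ, c, hc, e'⟩ := this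
        refine ⟨_, mul_mem hmem hv, τ, c, hc, ?_⟩
        calc _ = permGL s * u' * (permGL s)⁻¹ *
              (permGL s * transvectionGL i j hlt.ne t * permGL σ * b) := by rw [e]; group
          _ = _ := by rw [e']; group
      -- If σ⁻¹ i < σ⁻¹ j, the transvection moves past σ into B. Otherwise the rank one relation is
      -- applied; its right-hand transvection moves past s σ instead, because s exchanges i and j.
      rcases lt_or_gt_of_ne (σ⁻¹.injective.ne hlt.ne) with hl | hl
      · refine ⟨1, one_mem _, s * σ, _,
          mul_mem (unitriangular_le_borel (transvectionGL_mem_unitriangular hl t)) hb, ?_⟩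
        rw [mul_assoc (permGL s), transvectionGL_mul_permGL, permGL_mul]; group
      · by_cases ht : t = 0
        · exact ⟨1, one_mem _, s * σ, b, hb, by
            rw [ht, transvectionGL_zero, permGL_mul]; group⟩
        · obtain ⟨d, hd⟩ := permGL_swap_mul_transvectionGL hlt.ne ht
          have hl' : (s * σ)⁻¹ i < (s * σ)⁻¹ j := by simpa [s] using hl
          refine ⟨_, transvectionGL_mem_unitriangular hlt t⁻¹, σ, _, mul_mem (mul_mem
            (diagGL_mem_borel (d ∘ (s * σ : Equiv.Perm (Fin n))))
            (unitriangular_le_borel (transvectionGL_mem_unitriangular hl' t⁻¹))) hb, ?_⟩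
          rw [hd]
          have hss : permGL s * permGL (s * σ) = (permGL σ : GL (Fin n) F) := by
            rw [← permGL_mul, ← mul_assoc, Equiv.swap_mul_self, one_mul]
          have h1 := transvectionGL_mul_permGL (s * σ) hlt.ne t⁻¹
          have h2 := diagGL_mul_permGL (s * σ) d
          rw [permGL_mul s] at h1 h2
          rw [← hss, permGL_mul s]
          set X := transvectionGL i j hlt.ne t⁻¹
          set Z := transvectionGL ((s * σ)⁻¹ i) ((s * σ)⁻¹ j) ((s * σ)⁻¹.injective.ne hlt.ne) t⁻¹
          calc X * permGL s * diagGL d * X * permGL s * (permGL s * (permGL s * permGL σ)) * b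
              = X * permGL s * diagGL d * X * (permGL s * permGL s) * permGL s * permGL σ * b := by
                simp only [mul_assoc]
            _ = X * permGL s * diagGL d * (X * (permGL s * permGL σ)) * b := by
                rw [← permGL_mul, Equiv.swap_mul_self, permGL_one]; simp only [mul_assoc, one_mul]
            _ = X * permGL s * (diagGL d * (permGL s * permGL σ)) * Z * b := by
                rw [h1]; simp only [mul_assoc]
            _ = _ := by rw [h2]; simp only [mul_assoc]
  have hg : g ∈ S := by rw [hS]; trivial
  have h1 : g * 1 ∈ Y := hg 1 ⟨1, one_mem _, 1, 1, one_mem _, by simp [permGL_one]⟩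
  rwa [mul_one] at h1

end Bruhat

/-! ### The factorization of U attached to a permutation. -/

section Decomposition

variable {n : ℕ} (F : Type*) [Field F]

/-- `U ∩ σ B σ⁻¹`. -/
def posPart (σ : Equiv.Perm (Fin n)) : Subgroup (GL (Fin n) F) :=
  unitriangular n F ⊓ blockSubgroup fun i => σ⁻¹ i

/-- `U ∩ σ B⁻ σ⁻¹`, where `B⁻` is the group of lower triangular matrices. -/
def negPart (σ : Equiv.Perm (Fin n)) : Subgroup (GL (Fin n) F) :=
  unitriangular n F ⊓ blockSubgroup fun i => OrderDual.toDual (σ⁻¹ i)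

variable {F}

theorem mem_posPart {σ : Equiv.Perm (Fin n)} {g : GL (Fin n) F} : g ∈ posPart F σ ↔
    g ∈ unitriangular n F ∧ ∀ i j, σ⁻¹ j < σ⁻¹ i → g.val i j = 0 := by
  rw [posPart, Subgroup.mem_inf, mem_blockSubgroup]

theorem mem_negPart {σ : Equiv.Perm (Fin n)} {g : GL (Fin n) F} : g ∈ negPart F σ ↔
    g ∈ unitriangular n F ∧ ∀ i j, σ⁻¹ i < σ⁻¹ j → g.val i j = 0 := by
  rw [negPart, Subgroup.mem_inf, mem_blockSubgroup]; rfl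

theorem posPart_le (σ : Equiv.Perm (Fin n)) : posPart F σ ≤ unitriangular n F := inf_le_left

theorem negPart_le (σ : Equiv.Perm (Fin n)) : negPart F σ ≤ unitriangular n F := inf_le_left

/-- An upper unitriangular matrix as an element of the general linear group. -/
def ofUnitriangular (M : Fin n → Fin n → F) (h : ∀ i j, j < i → M i j = 0)
    (h1 : ∀ i, M i i = 1) : GL (Fin n) F :=
  Matrix.GeneralLinearGroup.mkOfDetNeZero (Matrix.of M) (by
    rw [Matrix.det_of_isUpperTriangular (show (Matrix.of M).BlockTriangular id from fun i j hij => h i j hij)]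
    simp [h1])

theorem ofUnitriangular_apply (M : Fin n → Fin n → F) (h : ∀ i j, j < i → M i j = 0)
    (h1 : ∀ i, M i i = 1) (i j : Fin n) : (ofUnitriangular M h h1).val i j = M i j := rfl

theorem ofUnitriangular_mem (M : Fin n → Fin n → F) (h : ∀ i j, j < i → M i j = 0)
    (h1 : ∀ i, M i i = 1) : ofUnitriangular M h h1 ∈ unitriangular n F :=
  mem_unitriangular.2 ⟨h, h1⟩

open Classical in
-- The entries at the admissible positions above the diagonal are free parameters. The function `b`
-- need not be monotone, so that the count covers `posPart` and `negPart`.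
theorem card_unitriangular_inf_blockSubgroup [Fintype F] {α : Type*} [LinearOrder α]
    (b : Fin n → α) :
    Nat.card (unitriangular n F ⊓ blockSubgroup b : Subgroup (GL (Fin n) F)) =
      Fintype.card F ^ (Finset.univ.filter fun p : Fin n × Fin n =>
        p.1 < p.2 ∧ ¬ b p.2 < b p.1).card := by
  have e : (unitriangular n F ⊓ blockSubgroup b : Subgroup (GL (Fin n) F)) ≃
      ({p : Fin n × Fin n // p.1 < p.2 ∧ ¬ b p.2 < b p.1} → F) :=
    { toFun := fun g p => g.1.val p.1.1 p.1.2
      invFun := fun f => ⟨ofUnitriangular (fun i j => if h : i < j ∧ ¬ b j < b i then f ⟨(i, j), h⟩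
          else if i = j then 1 else 0)
          (fun i j h => by
            rw [dif_neg (fun h' => lt_asymm h h'.1), if_neg h.ne'])
          (fun i => by
            rw [dif_neg (fun h' => lt_irrefl _ h'.1), if_pos rfl]), by
          refine ⟨ofUnitriangular_mem _ _ _, mem_blockSubgroup.2 fun i j h => ?_⟩
          rw [ofUnitriangular_apply, dif_neg (fun h' => h'.2 h), if_neg]
          rintro rfl; exact lt_irrefl _ h⟩
      left_inv := by
        rintro ⟨g, hg, hb⟩
        replace hg := mem_unitriangular.1 hg
        replace hb := mem_blockSubgroup.1 hb
        ext i j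
        simp only [ofUnitriangular_apply]
        split_ifs with h1 h2
        · rfl
        · subst h2; exact (hg.2 _).symm
        · by_cases h3 : i < j
          · rw [hb]; by_contra h4; exact h1 ⟨h3, h4⟩
          · rw [hg.1]; exact lt_of_le_of_ne (not_lt.1 h3) (Ne.symm h2)
      right_inv := by
        intro f
        ext ⟨p, hp⟩
        simp only [ofUnitriangular_apply]
        rw [dif_pos hp] }
  rw [Nat.card_congr e, Nat.card_eq_fintype_card, Fintype.card_fun, Fintype.card_subtype]

theorem card_unitriangular [Fintype F] : Nat.card (unitriangular n F) =
    Fintype.card F ^ (Finset.univ.filter fun p : Fin n × Fin n => p.1 < p.2).card := by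
  classical
  have h := card_unitriangular_inf_blockSubgroup (F := F) (fun i : Fin n => i)
  have h1 : (unitriangular n F ⊓ blockSubgroup fun i : Fin n => i) = unitriangular n F :=
    inf_eq_left.2 unitriangular_le_borel
  rw [h1] at h
  rw [h]
  congr 2
  ext p
  simp only [Finset.mem_filter, Finset.mem_univ, true_and, and_iff_left_iff_imp]
  exact fun h => h.asymm

theorem card_posPart [Fintype F] (σ : Equiv.Perm (Fin n)) : Nat.card (posPart F σ) =
    Fintype.card F ^ (Finset.univ.filter fun p : Fin n × Fin n =>
      p.1 < p.2 ∧ ¬ σ⁻¹ p.2 < σ⁻¹ p.1).card := by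
  classical
  rw [posPart, card_unitriangular_inf_blockSubgroup (F := F) (fun i : Fin n => σ⁻¹ i)]

theorem card_negPart [Fintype F] (σ : Equiv.Perm (Fin n)) : Nat.card (negPart F σ) =
    Fintype.card F ^ (Finset.univ.filter fun p : Fin n × Fin n =>
      p.1 < p.2 ∧ σ⁻¹ p.2 < σ⁻¹ p.1).card := by
  classical
  have := card_unitriangular_inf_blockSubgroup (F := F)
    (fun i : Fin n => OrderDual.toDual (σ⁻¹ i))
  rw [negPart, this]
  congr 2
  ext p
  simp only [Finset.mem_filter, Finset.mem_univ, true_and, OrderDual.toDual_lt_toDual, not_lt]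
  refine and_congr_right fun h => ⟨fun h' => lt_of_le_of_ne h' (σ⁻¹.injective.ne h.ne'), le_of_lt⟩

theorem posPart_inf_negPart (σ : Equiv.Perm (Fin n)) {g : GL (Fin n) F}
    (h1 : g ∈ posPart F σ) (h2 : g ∈ negPart F σ) : g = 1 := by
  rw [mem_posPart, mem_unitriangular] at h1
  rw [mem_negPart] at h2
  ext i j
  rcases lt_trichotomy i j with h | rfl | h
  · rw [Units.val_one, Matrix.one_apply_ne h.ne]
    rcases lt_or_gt_of_ne (σ⁻¹.injective.ne h.ne) with h3 | h3
    · exact h2.2 i j h3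
    · exact h1.2 i j h3
  · rw [h1.1.2, Units.val_one, Matrix.one_apply_eq]
  · rw [h1.1.1 i j h, Units.val_one, Matrix.one_apply_ne h.ne']

/-- The two factors meet trivially, which gives injectivity; their orders multiply to the order of
U, since each pair i < j is either an inversion of σ⁻¹ or not. -/
theorem negPart_mul_posPart_bijective [Fintype F] (σ : Equiv.Perm (Fin n)) :
    Function.Bijective (fun p : negPart F σ × posPart F σ =>
      (⟨p.1 * p.2, mul_mem (negPart_le σ p.1.2) (posPart_le σ p.2.2)⟩ : unitriangular n F)) := by
  classical
  apply Function.Injective.bijective_of_nat_card_le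
  · rintro ⟨⟨a, ha⟩, b, hb⟩ ⟨⟨c, hc⟩, d, hd⟩ h
    simp only [Subtype.mk.injEq] at h
    have h1 : c⁻¹ * a = d * b⁻¹ := by
      rw [inv_mul_eq_iff_eq_mul, ← mul_assoc, ← h]; group
    have h2 := posPart_inf_negPart σ (h1 ▸ mul_mem hd (inv_mem hb) : c⁻¹ * a ∈ posPart F σ)
      (mul_mem (inv_mem hc) ha)
    have h3 : a = c := (inv_mul_eq_one.1 h2).symm
    rw [h2, eq_comm, mul_inv_eq_one] at h1
    simp [h3, h1]
  · rw [Nat.card_prod, card_negPart, card_posPart, card_unitriangular, ← pow_add]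
    apply Nat.pow_le_pow_right Fintype.card_pos
    rw [← Finset.card_filter_add_card_filter_not (s := Finset.univ.filter
      fun p : Fin n × Fin n => p.1 < p.2) (fun p => σ⁻¹ p.2 < σ⁻¹ p.1), Finset.filter_filter,
      Finset.filter_filter]

theorem exists_negPart_mul_posPart [Fintype F] (σ : Equiv.Perm (Fin n)) {u : GL (Fin n) F}
    (hu : u ∈ unitriangular n F) : ∃ v ∈ negPart F σ, ∃ w ∈ posPart F σ, u = v * w := by
  obtain ⟨⟨v, w⟩, h⟩ := (negPart_mul_posPart_bijective σ).2 ⟨u, hu⟩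
  exact ⟨v, v.2, w, w.2, (congrArg Subtype.val h).symm⟩

theorem posPart_conj_mem_unitriangular {σ : Equiv.Perm (Fin n)} {g : GL (Fin n) F}
    (hg : g ∈ posPart F σ) : (permGL σ)⁻¹ * g * permGL σ ∈ unitriangular n F := by
  rw [mem_posPart, mem_unitriangular] at hg
  rw [mem_unitriangular]
  refine ⟨fun i j h => ?_, fun i => ?_⟩
  · rw [permGL_conj_apply', hg.2]
    simpa [perm_inv_apply] using h
  · rw [permGL_conj_apply', hg.1.2]

end Decomposition

/-! ### The index of a block triangular group as a sum over permutations. -/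

section Index

variable {n : ℕ} {F : Type*} [Field F]

theorem borel_le_blockSubgroup {α : Type*} [LinearOrder α] {b : Fin n → α} (hb : Monotone b) :
    borel n F ≤ blockSubgroup b := fun _ hg => mem_blockSubgroup.2 fun i j h =>
  mem_borel.1 hg i j (lt_of_not_ge fun h' => not_lt_of_ge (hb h') h)

/-- The permutations that are increasing on the fibres of a monotone function `b`. -/
def increasingOn (b : Fin n → ℕ) : Set (Equiv.Perm (Fin n)) :=
  {σ | ∀ i j : Fin n, (i : ℕ) + 1 = j → b i = b j → σ i < σ j}

theorem mem_increasingOn {b : Fin n → ℕ} {σ : Equiv.Perm (Fin n)} : σ ∈ increasingOn b ↔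
    ∀ i j : Fin n, (i : ℕ) + 1 = j → b i = b j → σ i < σ j := Iff.rfl

theorem lt_of_mem_increasingOn {b : Fin n → ℕ} (hb : Monotone b) {σ : Equiv.Perm (Fin n)}
    (hσ : σ ∈ increasingOn b) {i j : Fin n} (hij : i < j) (h : b i = b j) : σ i < σ j := by
  obtain ⟨k, hk⟩ : ∃ k, (i : ℕ) + k + 1 = j := ⟨j - i - 1, by rw [Fin.lt_def] at hij; omega⟩
  induction k generalizing j with
  | zero => exact hσ i j hk h
  | succ k ih =>
    let m : Fin n := ⟨i + k + 1, by omega⟩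
    have him : i < m := by rw [Fin.lt_def]; simp only [m]; omega
    have hmj : m < j := by rw [Fin.lt_def]; simp only [m]; omega
    have hm : b i = b m := le_antisymm (hb him.le) (h ▸ hb hmj.le)
    exact (ih him hm rfl).trans (hσ m j (by simp only [m]; omega) (hm ▸ h))

/-- A nonzero term of the Leibniz expansion of the determinant supplies a permutation π.
Triangularity of x forces σ π ≤ τ pointwise, hence σ π = τ, and block triangularity makes π preserve
the blocks; two permutations that increase on the blocks can only differ by π = 1. -/
theorem eq_of_conj_mem_blockSubgroup {b : Fin n → ℕ} (hb : Monotone b) {σ τ : Equiv.Perm (Fin n)}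
    (hσ : σ ∈ increasingOn b) (hτ : τ ∈ increasingOn b) {x : GL (Fin n) F}
    (hx : x ∈ unitriangular n F) (h : (permGL σ)⁻¹ * x * permGL τ ∈ blockSubgroup b) : σ = τ := by
  rw [mem_blockSubgroup] at h
  set p := (permGL σ)⁻¹ * x * permGL τ with hp
  have hpe : ∀ i j, p.val i j = x.val (σ i) (τ j) := by
    intro i j
    rw [hp, mul_permGL_apply, ← permGL_inv, permGL_mul_apply, inv_inv]
  have hdet : p.val.det ≠ 0 := (p.isUnit.map Matrix.detMonoidHom).ne_zero
  rw [Matrix.det_apply] at hdet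
  obtain ⟨π, -, hπ⟩ := Finset.exists_ne_zero_of_sum_ne_zero hdet
  have hπ' : ∀ i, p.val (π i) i ≠ 0 := by
    intro i hi
    refine hπ ?_
    have : ∏ i, p.val (π i) i = 0 := Finset.prod_eq_zero (Finset.mem_univ i) hi
    rw [this, smul_zero]
  have h1 : ∀ i, σ (π i) ≤ τ i := fun i => by
    by_contra h'
    exact hπ' i (by rw [hpe, (mem_unitriangular.1 hx).1 _ _ (not_le.1 h')])
  have h2 : σ * π * τ⁻¹ = 1 := perm_le_id_eq_one _ fun i => by
    have := h1 (τ⁻¹ i)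
    rwa [perm_apply_inv] at this
  have h3 : τ = σ * π := (mul_inv_eq_one.1 h2).symm
  have h4 : ∀ i, b (π i) ≤ b i := fun i => by
    by_contra h'
    exact hπ' i (h _ _ (not_le.1 h'))
  have h5 : ∀ i, b (π i) = b i := by
    have := (Finset.sum_eq_sum_iff_of_le (fun i (_ : i ∈ Finset.univ) => h4 i)).1
      (Equiv.sum_comp π b)
    exact fun i => this i (Finset.mem_univ i)
  have h6 : π = 1 := by
    apply perm_eq_one_of_monotone
    intro i j hij
    have hlt : i < j := by rw [Fin.lt_def]; omega
    rcases (hb hlt.le).lt_or_eq with h7 | h7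
    · by_contra h8
      have := hb (not_lt.1 h8)
      rw [h5, h5] at this
      exact not_lt_of_ge this h7
    · by_contra h8
      have h9 : π j < π i := lt_of_le_of_ne (not_lt.1 h8) (π.injective.ne hlt.ne')
      have h10 := lt_of_mem_increasingOn hb hσ h9 (by rw [h5, h5, h7])
      have h11 := lt_of_mem_increasingOn hb hτ hlt h7
      rw [h3] at h11
      exact lt_asymm h10 h11
  rw [h3, h6, mul_one]

theorem permGL_mem_blockSubgroup {b : Fin n → ℕ} {π : Equiv.Perm (Fin n)}
    (h : ∀ i, b (π i) = b i) : (permGL π : GL (Fin n) F) ∈ blockSubgroup b := by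
  rw [mem_blockSubgroup]
  intro i j hij
  rw [permGL_apply, if_neg]
  rintro rfl
  rw [h] at hij; exact lt_irrefl _ hij

/-- Sorting inside the blocks: every coset of the block-preserving permutations has a representative
that is increasing on each block. -/
theorem exists_increasingOn (b : Fin n → ℕ) (τ : Equiv.Perm (Fin n)) :
    ∃ σ ∈ increasingOn b, ∃ π : Equiv.Perm (Fin n), (∀ i, b (π i) = b i) ∧ τ = σ * π := by
  induction τ using perm_descent_induction with
  | h τ ih =>
  by_cases hτ : τ ∈ increasingOn b
  · exact ⟨τ, hτ, 1, fun _ => rfl, (mul_one _).symm⟩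
  · simp only [increasingOn, Set.mem_ofPred_eq, not_forall] at hτ
    obtain ⟨i, j, hij, hbij, hlt⟩ := hτ
    have hne : i ≠ j := by rintro rfl; simp at hij
    obtain ⟨σ, hσ, π, hπ, e⟩ := ih i j hij (lt_of_le_of_ne (not_lt.1 hlt) (τ.injective.ne hne.symm))
    refine ⟨σ, hσ, π * Equiv.swap i j, fun k => ?_, ?_⟩
    · rw [Equiv.Perm.mul_apply, hπ, Equiv.swap_apply_def]
      split_ifs with h1 h2
      · rw [h1, hbij]
      · rw [h2, hbij]
      · rfl
    · rw [← mul_assoc, ← e, mul_assoc, Equiv.swap_mul_self, mul_one]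

open Classical in
-- The Schubert cells of G/P: each coset is v σ P for exactly one σ that increases on the blocks and
-- one v in `negPart F σ`.
theorem index_blockSubgroup_eq_sum [Fintype F] {b : Fin n → ℕ} (hb : Monotone b) :
    (blockSubgroup b : Subgroup (GL (Fin n) F)).index =
      ∑ σ : Equiv.Perm (Fin n) with σ ∈ increasingOn b, Nat.card (negPart F σ) := by
  let P : Subgroup (GL (Fin n) F) := blockSubgroup b
  let f : (Σ σ : {σ : Equiv.Perm (Fin n) // σ ∈ increasingOn b}, negPart F σ.1) →
      GL (Fin n) F ⧸ P := fun x => QuotientGroup.mk (x.2.1 * permGL x.1.1)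
  have hf : Function.Bijective f := by
    constructor
    · rintro ⟨⟨σ, hσ⟩, v, hv⟩ ⟨⟨τ, hτ⟩, w, hw⟩ h
      have h1 : (v * permGL σ)⁻¹ * (w * permGL τ) ∈ P := QuotientGroup.eq.1 h
      have h2 : (permGL σ)⁻¹ * (v⁻¹ * w) * permGL τ ∈ P := by
        convert h1 using 1; group
      obtain rfl := eq_of_conj_mem_blockSubgroup hb hσ hτ
        (mul_mem (inv_mem (negPart_le _ hv)) (negPart_le _ hw)) h2
      have h3 : v⁻¹ * w ∈ negPart F σ := mul_mem (inv_mem hv) hw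
      have h4 : v⁻¹ * w ∈ posPart F σ := by
        refine mem_posPart.2 ⟨negPart_le _ h3, fun i j hij => ?_⟩
        rcases (hb hij.le).lt_or_eq with h5 | h5
        · have := mem_blockSubgroup.1 h2 (σ⁻¹ i) (σ⁻¹ j) h5
          rwa [permGL_conj_apply', perm_apply_inv, perm_apply_inv] at this
        · have := lt_of_mem_increasingOn hb hσ hij h5
          rw [perm_apply_inv, perm_apply_inv] at this
          exact (mem_unitriangular.1 (negPart_le _ h3)).1 _ _ this
      have h5 := inv_mul_eq_one.1 (posPart_inf_negPart σ h4 h3)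
      subst h5
      rfl
    · intro y
      obtain ⟨g, rfl⟩ := QuotientGroup.mk_surjective y
      obtain ⟨u, hu, τ, β, hβ, rfl⟩ := exists_bruhat g
      obtain ⟨σ, hσ, π, hπ, rfl⟩ := exists_increasingOn b τ
      obtain ⟨v, hv, w, hw, rfl⟩ := exists_negPart_mul_posPart σ hu
      refine ⟨⟨⟨σ, hσ⟩, v, hv⟩, QuotientGroup.eq.2 ?_⟩
      have h1 : (v * permGL σ)⁻¹ * (v * w * permGL (σ * π) * β) =
          ((permGL σ)⁻¹ * w * permGL σ) * permGL π * β := by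
        rw [permGL_mul]; group
      change (v * permGL σ)⁻¹ * (v * w * permGL (σ * π) * β) ∈ P
      rw [h1]
      exact mul_mem (mul_mem (borel_le_blockSubgroup hb (unitriangular_le_borel
        (posPart_conj_mem_unitriangular hw))) (permGL_mem_blockSubgroup hπ))
        (borel_le_blockSubgroup hb hβ)
  rw [Subgroup.index, ← Nat.card_congr (Equiv.ofBijective f hf), Nat.card_sigma,
    ← Finset.sum_subtype_eq_sum_filter]
  · simp

open Classical in
-- Substituting τ = (w₀ σ)⁻¹, with w₀ the order reversal, turns inversions into non-inversions and
-- increasing into decreasing. This is the shape in which the index emerges from the bilinear form.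
theorem index_blockSubgroup_eq_sum_posPart [Fintype F] {b : Fin n → ℕ} (hb : Monotone b) :
    (blockSubgroup b : Subgroup (GL (Fin n) F)).index =
      ∑ τ : Equiv.Perm (Fin n) with
        ∀ i j : Fin n, (i : ℕ) + 1 = j → b i = b j → τ⁻¹ j < τ⁻¹ i, Nat.card (posPart F τ) := by
  rw [index_blockSubgroup_eq_sum hb]
  let e : Equiv.Perm (Fin n) ≃ Equiv.Perm (Fin n) :=
    (Equiv.mulLeft (Fin.revPerm : Equiv.Perm (Fin n))).trans (Equiv.inv _)
  refine Finset.sum_equiv e ?_ ?_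
  · intro σ
    have h : (e σ)⁻¹ = Fin.revPerm * σ := by simp [e]
    simp only [Finset.mem_filter, Finset.mem_univ, true_and, h, mem_increasingOn,
      Equiv.Perm.mul_apply, Fin.revPerm_apply, Fin.rev_lt_rev]
  · intro σ _
    rw [card_negPart, card_posPart]
    congr 1
    refine Finset.card_equiv
      ((Equiv.prodComm _ _).trans (Equiv.prodCongr (σ⁻¹ : Equiv.Perm (Fin n)) (σ⁻¹ : Equiv.Perm (Fin n)))) ?_
    rintro ⟨i, j⟩
    have h : (e σ)⁻¹ = Fin.revPerm * σ := by simp [e]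
    simp only [Finset.mem_filter, Finset.mem_univ, true_and, h, Equiv.Perm.mul_apply,
      Fin.revPerm_apply, Fin.rev_lt_rev, Equiv.trans_apply, Equiv.prodComm_apply,
      Equiv.prodCongr_apply, Prod.map, Prod.swap, perm_apply_inv, not_lt]
    constructor
    · exact fun h => ⟨h.2, h.1.le⟩
    · exact fun h => ⟨lt_of_le_of_ne h.2 (fun h' => lt_irrefl _ (h' ▸ h.1)), h.1⟩

theorem eq_of_conj_mem_borel {σ τ : Equiv.Perm (Fin n)} {x : GL (Fin n) F}
    (hx : x ∈ unitriangular n F) (h : (permGL σ)⁻¹ * x * permGL τ ∈ borel n F) : σ = τ := by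
  have hinc : ∀ π : Equiv.Perm (Fin n), π ∈ increasingOn (fun i : Fin n => i.val) := by
    intro π i j hij hb; simp only at hb; omega
  exact eq_of_conj_mem_blockSubgroup (fun _ _ h => h) (hinc σ) (hinc τ) hx
    (mem_blockSubgroup.2 fun i j hij => mem_borel.1 h i j hij)

theorem conj_mem_borel_iff {σ : Equiv.Perm (Fin n)} {x : GL (Fin n) F}
    (hx : x ∈ unitriangular n F) :
    (permGL σ)⁻¹ * x * permGL σ ∈ borel n F ↔ x ∈ posPart F σ := by
  rw [mem_posPart, mem_borel]
  simp only [permGL_conj_apply', hx, true_and]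
  constructor
  · intro h i j hij
    simpa [perm_apply_inv] using h _ _ hij
  · intro h i j hij
    exact h _ _ (by rwa [perm_inv_apply, perm_inv_apply])

end Index

/-! ### The basis of the Steinberg lattice indexed by U. -/

section Steinberg

variable {n : ℕ} {F : Type*} [Field F] [Fintype F] [DecidableEq F] {R : Type*} [CommRing R]

/-- The image of a group element in the group algebra. -/
def gs (R : Type*) [CommRing R] (g : GL (Fin n) F) : GroupAlg n F R := MonoidAlgebra.of R _ g

theorem gs_eq (g : GL (Fin n) F) : gs R g = MonoidAlgebra.single g 1 := rfl

theorem gs_mul (g h : GL (Fin n) F) : gs R (g * h) = gs R g * gs R h := map_mul _ _ _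

theorem gs_one : gs R (1 : GL (Fin n) F) = 1 := map_one _

theorem coeff_gs_mul (g h : GL (Fin n) F) (x : GroupAlg n F R) :
    (gs R g * x).coeff h = x.coeff (g⁻¹ * h) := by
  rw [gs_eq, MonoidAlgebra.coeff_single_mul_apply, one_mul]

open Classical in
theorem coeff_hat (S : Set (GL (Fin n) F)) (g : GL (Fin n) F) :
    (hat n F R S).coeff g = if g ∈ S then 1 else 0 := by
  rw [hat, MonoidAlgebra.coeff_sum, Finset.sum_apply']
  simp only [MonoidAlgebra.coeff_single, Finsupp.single_apply]
  rw [Finset.sum_ite_eq']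
  simp

theorem gs_mul_hat_borel {b : GL (Fin n) F} (hb : b ∈ borel n F) :
    gs R b * hat n F R (borel n F) = hat n F R (borel n F) := by
  classical
  ext g
  rw [coeff_gs_mul, coeff_hat, coeff_hat]
  simp only [SetLike.mem_coe, Subgroup.mul_mem_cancel_left _ (inv_mem hb)]

theorem steinbergElement_eq : steinbergElement n F R =
    ∑ σ : Equiv.Perm (Fin n), ((Equiv.Perm.sign σ : ℤ) : R) •
      (gs R (permGL σ) * hat n F R (borel n F)) := by
  refine Finset.sum_congr rfl fun σ _ => ?_
  rw [gs_eq, ← smul_mul_assoc, MonoidAlgebra.smul_single, smul_eq_mul, mul_one]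

theorem steinbergElement_mem_lattice : steinbergElement n F R ∈ lattice n F R :=
  Submodule.subset_span rfl

theorem gs_permGL_mul_steinbergElement (τ : Equiv.Perm (Fin n)) :
    gs R (permGL τ) * steinbergElement n F R =
      ((Equiv.Perm.sign τ : ℤ) : R) • steinbergElement n F R := by
  rw [steinbergElement_eq, Finset.mul_sum, Finset.smul_sum, ← Equiv.sum_comp (Equiv.mulLeft τ)
    (fun σ => ((Equiv.Perm.sign τ : ℤ) : R) • ((Equiv.Perm.sign σ : ℤ) : R) •
      (gs R (permGL σ) * hat n F R (borel n F)))]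
  refine Finset.sum_congr rfl fun σ _ => ?_
  rw [mul_smul_comm, ← mul_assoc, ← gs_mul, ← permGL_mul, Equiv.coe_mulLeft, Equiv.Perm.sign_mul,
    smul_smul]
  congr 1
  push_cast
  rw [← mul_assoc, ← Int.cast_mul, ← Units.val_mul, Int.units_mul_self]
  simp

theorem gs_diagGL_mul_steinbergElement (d : Fin n → Fˣ) :
    gs R (diagGL d) * steinbergElement n F R = steinbergElement n F R := by
  rw [steinbergElement_eq, Finset.mul_sum]
  refine Finset.sum_congr rfl fun σ _ => ?_
  rw [mul_smul_comm, ← mul_assoc, ← gs_mul, diagGL_mul_permGL, gs_mul, mul_assoc,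
    gs_mul_hat_borel (diagGL_mem_borel _)]

/-- The permutations are paired by σ ↦ (i j) σ, with opposite signs. The half with σ⁻¹ i < σ⁻¹ j is
kept for y, because there the transvections move past σ and are absorbed by B. -/
theorem exists_steinbergElement_eq_sub {i j : Fin n} (h : i ≠ j) :
    ∃ y : GroupAlg n F R, steinbergElement n F R = y - gs R (permGL (Equiv.swap i j)) * y ∧
      (∀ d, gs R (diagGL d) * y = y) ∧ ∀ t, gs R (transvectionGL i j h t) * y = y := by
  classical
  let A : Finset (Equiv.Perm (Fin n)) := Finset.univ.filter fun σ => σ⁻¹ i < σ⁻¹ j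
  refine ⟨∑ σ ∈ A, ((Equiv.Perm.sign σ : ℤ) : R) •
      (gs R (permGL σ) * hat n F R (borel n F)), ?_, ?_, ?_⟩
  · rw [steinbergElement_eq, ← Finset.sum_add_sum_compl A, sub_eq_add_neg]
    congr 1
    rw [Finset.mul_sum, ← Finset.sum_neg_distrib]
    symm
    refine Finset.sum_equiv (Equiv.mulLeft (Equiv.swap i j)) ?_ ?_
    · intro σ
      simp only [A, Finset.mem_filter, Finset.mem_univ, true_and, Finset.mem_compl,
        Equiv.coe_mulLeft, _root_.mul_inv_rev, Equiv.Perm.mul_apply, Equiv.swap_inv,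
        Equiv.swap_apply_left, Equiv.swap_apply_right, not_lt]
      exact ⟨le_of_lt, fun h' => lt_of_le_of_ne h' (σ⁻¹.injective.ne h)⟩
    · intro σ _
      rw [mul_smul_comm, ← mul_assoc, ← gs_mul, ← permGL_mul, Equiv.coe_mulLeft,
        Equiv.Perm.sign_mul, Equiv.Perm.sign_swap h]
      simp
  · intro d
    rw [Finset.mul_sum]
    refine Finset.sum_congr rfl fun σ _ => ?_
    rw [mul_smul_comm, ← mul_assoc, ← gs_mul, diagGL_mul_permGL, gs_mul, mul_assoc,
      gs_mul_hat_borel (diagGL_mem_borel _)]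
  · intro t
    rw [Finset.mul_sum]
    refine Finset.sum_congr rfl fun σ hσ => ?_
    rw [mul_smul_comm, ← mul_assoc, ← gs_mul, transvectionGL_mul_permGL, gs_mul, mul_assoc,
      gs_mul_hat_borel (unitriangular_le_borel
        (transvectionGL_mem_unitriangular (Finset.mem_filter.1 hσ).2 t))]

/-- With the generator written as y - s y, both sides equal s y - x(t⁻¹) s y by the rank one
relation. This rewrites the action of s in terms of U alone. -/
theorem gs_swap_mul_transvectionGL_mul_steinbergElement {i j : Fin n} (h : i ≠ j) {t : F}
    (ht : t ≠ 0) :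
    gs R (permGL (Equiv.swap i j) * transvectionGL i j h t) * steinbergElement n F R =
      gs R (transvectionGL i j h t⁻¹) * steinbergElement n F R - steinbergElement n F R := by
  obtain ⟨y, hy, hd, hx⟩ := exists_steinbergElement_eq_sub (F := F) (R := R) h
  obtain ⟨d, e⟩ := permGL_swap_mul_transvectionGL h ht
  have hs : permGL (Equiv.swap i j) * permGL (Equiv.swap i j) = (1 : GL (Fin n) F) := by
    rw [← permGL_mul, Equiv.swap_mul_self, permGL_one]
  have h1 : gs R (permGL (Equiv.swap i j) * transvectionGL i j h t) *
      (gs R (permGL (Equiv.swap i j)) * y) =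
      gs R (transvectionGL i j h t⁻¹) * (gs R (permGL (Equiv.swap i j)) * y) := by
    rw [e]
    simp only [← mul_assoc, ← gs_mul]
    rw [mul_assoc _ (permGL (Equiv.swap i j)) (permGL (Equiv.swap i j)), hs, mul_one]
    simp only [gs_mul, mul_assoc]
    rw [hx, hd]
  rw [hy, mul_sub, mul_sub, h1, gs_mul, mul_assoc, hx, hx]
  abel

open Classical in
-- The element x σ lies in τ B only for τ = σ, so a single term of the generator contributes.
theorem coeff_steinbergElement {x : GL (Fin n) F} (hx : x ∈ unitriangular n F)
    (σ : Equiv.Perm (Fin n)) : (steinbergElement n F R).coeff (x * permGL σ) =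
      if x ∈ posPart F σ then ((Equiv.Perm.sign σ : ℤ) : R) else 0 := by
  rw [steinbergElement_eq, MonoidAlgebra.coeff_sum, Finset.sum_apply', Finset.sum_eq_single σ]
  · rw [MonoidAlgebra.coeff_smul_apply, coeff_gs_mul, coeff_hat, SetLike.mem_coe, ← mul_assoc,
      conj_mem_borel_iff hx]
    simp
  · intro τ _ hτ
    rw [MonoidAlgebra.coeff_smul_apply, coeff_gs_mul, coeff_hat, if_neg, smul_zero]
    intro h
    rw [SetLike.mem_coe, ← mul_assoc] at h
    exact hτ (eq_of_conj_mem_borel hx h)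
  · simp

variable (R) in
/-- The coefficient of `x ∈ I` at the generator, with respect to the basis `u ↦ u s` of `I`. -/
def leadCoeff : GroupAlg n F R →ₗ[R] R where
  toFun x := ((Equiv.Perm.sign (Fin.revPerm : Equiv.Perm (Fin n)) : ℤ) : R) *
    x.coeff (permGL Fin.revPerm)
  map_add' x y := by simp [mul_add]
  map_smul' a x := by simp [mul_left_comm]

theorem leadCoeff_apply (x : GroupAlg n F R) : leadCoeff R x =
    ((Equiv.Perm.sign (Fin.revPerm : Equiv.Perm (Fin n)) : ℤ) : R) *
      x.coeff (permGL Fin.revPerm) := rfl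

theorem posPart_revPerm : posPart F (Fin.revPerm : Equiv.Perm (Fin n)) = ⊥ := by
  rw [eq_bot_iff]
  intro g hg
  refine Subgroup.mem_bot.2 (posPart_inf_negPart Fin.revPerm hg (mem_negPart.2
    ⟨posPart_le _ hg, fun i j hij => ?_⟩))
  have h : (Fin.revPerm : Equiv.Perm (Fin n))⁻¹ = Fin.revPerm := by ext; simp
  rw [h, Fin.revPerm_apply, Fin.revPerm_apply, Fin.rev_lt_rev] at hij
  exact (mem_unitriangular.1 (posPart_le _ hg)).1 i j hij

theorem sign_mul_self (σ : Equiv.Perm (Fin n)) :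
    ((Equiv.Perm.sign σ : ℤ) : R) * ((Equiv.Perm.sign σ : ℤ) : R) = 1 := by
  rw [← Int.cast_mul, ← Units.val_mul, Int.units_mul_self]; simp

open Classical in
-- For the order reversal w₀ the group `posPart` is trivial, so reading the coefficient at w₀
-- isolates u = 1. In particular the elements u s are linearly independent.
theorem leadCoeff_gs_mul {u : GL (Fin n) F} (hu : u ∈ unitriangular n F) :
    leadCoeff R (gs R u * steinbergElement n F R) = if u = 1 then 1 else 0 := by
  rw [leadCoeff_apply, coeff_gs_mul, coeff_steinbergElement (inv_mem hu), posPart_revPerm]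
  simp only [inv_mem_iff, Subgroup.mem_bot]
  split_ifs
  · exact sign_mul_self _
  · rw [mul_zero]

variable (n F R) in
/-- The `R`-span of the elements `u s`. -/
def unipotentSpan : Submodule R (GroupAlg n F R) :=
  Submodule.span R (Set.range fun u : unitriangular n F => gs R u.1 * steinbergElement n F R)

theorem gs_mul_mem_unipotentSpan {u : GL (Fin n) F} (hu : u ∈ unitriangular n F) :
    gs R u * steinbergElement n F R ∈ unipotentSpan n F R :=
  Submodule.subset_span ⟨⟨u, hu⟩, rfl⟩

theorem steinbergElement_mem_unipotentSpan :
    steinbergElement n F R ∈ unipotentSpan n F R := by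
  have := gs_mul_mem_unipotentSpan (R := R) (one_mem (unitriangular n F))
  rwa [gs_one, one_mul] at this

theorem gs_mul_mem {V : Submodule R (GroupAlg n F R)} {g : GL (Fin n) F}
    (h : ∀ u ∈ unitriangular n F, gs R g * (gs R u * steinbergElement n F R) ∈ V)
    {x : GroupAlg n F R} (hx : x ∈ unipotentSpan n F R) : gs R g * x ∈ V := by
  induction hx using Submodule.span_induction with
  | mem x hx => obtain ⟨u, rfl⟩ := hx; exact h u u.2
  | zero => rw [mul_zero]; exact zero_mem _
  | add x y _ _ hx hy => rw [mul_add]; exact add_mem hx hy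
  | smul a x _ hx => rw [mul_smul_comm]; exact Submodule.smul_mem _ _ hx

/-- Stability is checked on generators of G. Only the simple reflections need an argument: after
splitting off the entry (i, i+1), the rest of u is conjugated into U and the rank one relation
handles the entry. -/
theorem gs_mul_mem_unipotentSpan_of_mem (g : GL (Fin n) F) {x : GroupAlg n F R}
    (hx : x ∈ unipotentSpan n F R) : gs R g * x ∈ unipotentSpan n F R := by
  let S : Submonoid (GL (Fin n) F) :=
    { carrier := {g | ∀ x ∈ unipotentSpan n F R, gs R g * x ∈ unipotentSpan n F R}
      one_mem' := fun x hx => by rwa [gs_one, one_mul]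
      mul_mem' := fun {a b} ha hb y hy => by rw [gs_mul, mul_assoc]; exact ha _ (hb _ hy) }
  have hU : ∀ u ∈ unitriangular n F, u ∈ S := by
    intro u hu x hx
    refine gs_mul_mem (fun v hv => ?_) hx
    rw [← mul_assoc, ← gs_mul]
    exact gs_mul_mem_unipotentSpan (mul_mem hu hv)
  have hS : S = ⊤ := by
    apply submonoid_eq_top
    · intro d x hx
      refine gs_mul_mem (fun v hv => ?_) hx
      have h1 : diagGL d * v = (diagGL d * v * (diagGL d)⁻¹) * diagGL d := by group
      rw [← mul_assoc, ← gs_mul, h1, gs_mul, mul_assoc, gs_diagGL_mul_steinbergElement]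
      exact gs_mul_mem_unipotentSpan (diagGL_conj_mem_unitriangular d hv)
    · exact fun i j h t => hU _ (transvectionGL_mem_unitriangular h t)
    · intro i j hij x hx
      refine gs_mul_mem (fun v hv => ?_) hx
      have hlt : i < j := by rw [Fin.lt_def]; omega
      obtain ⟨u', hu', h0, e⟩ := exists_eq_mul_transvectionGL hlt hv
      have hmem := swap_conj_mem_unitriangular hij hu' h0
      have h1 : permGL (Equiv.swap i j) * v = (permGL (Equiv.swap i j) * u' *
          (permGL (Equiv.swap i j))⁻¹) *
          (permGL (Equiv.swap i j) * transvectionGL i j hlt.ne (v.val i j)) := by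
        conv_lhs => rw [e]
        group
      rw [← mul_assoc, ← gs_mul, h1, gs_mul, mul_assoc]
      refine hU _ hmem _ ?_
      by_cases ht : v.val i j = 0
      · rw [ht, transvectionGL_zero, mul_one, gs_permGL_mul_steinbergElement]
        refine Submodule.smul_mem _ _ ?_
        exact steinbergElement_mem_unipotentSpan
      · rw [gs_swap_mul_transvectionGL_mul_steinbergElement hlt.ne ht]
        refine sub_mem (gs_mul_mem_unipotentSpan (transvectionGL_mem_unitriangular hlt _)) ?_
        exact steinbergElement_mem_unipotentSpan
  have hg : g ∈ S := by rw [hS]; trivial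
  exact hg x hx

theorem mem_lattice_iff {x : GroupAlg n F R} : x ∈ lattice n F R ↔ x ∈ unipotentSpan n F R := by
  constructor
  · intro hx
    induction hx using Submodule.span_induction with
    | mem x hx =>
      rw [Set.mem_singleton_iff.1 hx]
      exact steinbergElement_mem_unipotentSpan
    | zero => exact zero_mem _
    | add x y _ _ hx hy => exact add_mem hx hy
    | smul a x _ hx =>
      rw [smul_eq_mul]
      induction a using MonoidAlgebra.induction_linear with
      | zero => rw [zero_mul]; exact zero_mem _
      | add s t hs ht => rw [add_mul]; exact add_mem hs ht
      | single g r =>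
        have : MonoidAlgebra.single g r = r • gs R g := by
          rw [gs_eq, MonoidAlgebra.smul_single, smul_eq_mul, mul_one]
        rw [this, smul_mul_assoc]
        exact Submodule.smul_mem _ _ (gs_mul_mem_unipotentSpan_of_mem g hx)
  · intro hx
    induction hx using Submodule.span_induction with
    | mem x hx =>
      obtain ⟨u, rfl⟩ := hx
      exact (lattice n F R).smul_mem (gs R u.1) (Submodule.subset_span rfl)
    | zero => exact zero_mem _
    | add x y _ _ hx hy => exact add_mem hx hy
    | smul a x _ hx =>
      have : a • x = (MonoidAlgebra.single (1 : GL (Fin n) F) a : GroupAlg n F R) • x := by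
        rw [smul_eq_mul, ← mul_one a, ← smul_eq_mul, ← MonoidAlgebra.smul_single, smul_mul_assoc,
          ← MonoidAlgebra.one_def, one_mul, smul_eq_mul, mul_one]
      rw [this]
      exact (lattice n F R).smul_mem _ hx

end Steinberg

/-! ### Sums of leading coefficients over the groups U ∩ σ B⁻ σ⁻¹. -/

section Averaging

variable {n : ℕ} {F : Type*} [Field F] [Fintype F] [DecidableEq F] {R : Type*} [CommRing R]

theorem transvectionGL_mul_mul_eq_one_iff {i j : Fin n} (hlt : i < j) {w : GL (Fin n) F}
    (hw : w ∈ unitriangular n F) (h0 : w.val i j = 0) (c t : F) :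
    transvectionGL i j hlt.ne t * w * transvectionGL i j hlt.ne c = 1 ↔ w = 1 ∧ t = -c := by
  constructor
  · intro h
    have h1 : t = -c := by
      have := congrArg (fun g : GL (Fin n) F => g.val i j) h
      rw [mem_unitriangular] at hw
      simp only [mul_transvectionGL_apply, transvectionGL_mul_apply, if_true, h0, hw.2,
        hw.1 j i hlt, Units.val_one, Matrix.one_apply_ne hlt.ne] at this
      linear_combination this
    refine ⟨?_, h1⟩
    rw [h1, ← transvectionGL_inv] at h
    rw [mul_assoc, inv_mul_eq_one] at h
    exact (mul_eq_right.1 h.symm)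
  · rintro ⟨rfl, rfl⟩
    rw [mul_one, transvectionGL_mul, neg_add_cancel, transvectionGL_zero]

/-- It suffices to take x = u s. If u has a nonzero entry at (i, j), the two terms of the rank one
relation have equal sums and cancel; if that entry is zero, the swap only contributes its sign. -/
theorem sum_leadCoeff_transvectionGL_mul_swap {i j : Fin n} (hij : (i : ℕ) + 1 = j)
    (hlt : i < j) {x : GroupAlg n F R} (hx : x ∈ unipotentSpan n F R) :
    ∑ t, leadCoeff R (gs R (transvectionGL i j hlt.ne t * permGL (Equiv.swap i j)) * x) =
      -leadCoeff R x := by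
  classical
  induction hx using Submodule.span_induction with
  | zero => simp
  | add x y _ _ hx hy => simp only [mul_add, map_add, Finset.sum_add_distrib, hx, hy, neg_add]
  | smul a x _ hx => simp only [mul_smul_comm, map_smul, ← Finset.smul_sum, hx, smul_neg]
  | mem x hx =>
    obtain ⟨⟨u, hu⟩, rfl⟩ := hx
    obtain ⟨u', hu', h0, e⟩ := exists_eq_mul_transvectionGL hlt hu
    set r := u.val i j
    set s := Equiv.swap i j with hs
    have hw := swap_conj_mem_unitriangular hij hu' h0
    set w := permGL s * u' * (permGL s)⁻¹ with hwdef
    have hw0 : w.val i j = 0 := by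
      rw [hwdef, permGL_conj_apply, hs, Equiv.swap_inv, Equiv.swap_apply_left,
        Equiv.swap_apply_right]
      exact (mem_unitriangular.1 hu').1 _ _ hlt
    have hw1 : w = 1 ↔ u' = 1 := by rw [hwdef, conj_eq_one_iff]
    -- Exactly one t, namely -c, can make the product trivial, so the sum does not depend on c.
    have hsum : ∀ c : F, ∑ t, leadCoeff R (gs R (transvectionGL i j hlt.ne t * w) *
        (gs R (transvectionGL i j hlt.ne c) * steinbergElement n F R)) =
        if u' = 1 then 1 else 0 := by
      intro c
      simp only [← mul_assoc, ← gs_mul]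
      have h1 : ∀ t, transvectionGL i j hlt.ne t * w * transvectionGL i j hlt.ne c ∈
          unitriangular n F := fun t => mul_mem (mul_mem (transvectionGL_mem_unitriangular hlt _) hw)
            (transvectionGL_mem_unitriangular hlt _)
      simp only [leadCoeff_gs_mul (h1 _), transvectionGL_mul_mul_eq_one_iff hlt hw hw0, hw1]
      by_cases hu1 : u' = 1 <;> simp [hu1]
    have hkey : ∀ t, gs R (transvectionGL i j hlt.ne t * permGL s) *
        (gs R u * steinbergElement n F R) = gs R (transvectionGL i j hlt.ne t * w) *
          (gs R (permGL s * transvectionGL i j hlt.ne r) * steinbergElement n F R) := by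
      intro t
      have : transvectionGL i j hlt.ne t * permGL s * u =
          (transvectionGL i j hlt.ne t * w) * (permGL s * transvectionGL i j hlt.ne r) := by
        rw [e, hwdef]; group
      rw [← mul_assoc, ← gs_mul, this, gs_mul, mul_assoc]
    simp only [hkey]
    rw [leadCoeff_gs_mul hu]
    by_cases hr : r = 0
    · simp only [hr, transvectionGL_zero, mul_one, gs_permGL_mul_steinbergElement, hs,
        Equiv.Perm.sign_swap hlt.ne, mul_smul_comm, map_smul]
      rw [← Finset.smul_sum]
      have h2 := hsum 0
      simp only [transvectionGL_zero, gs_one, one_mul] at h2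
      rw [h2, e, hr, transvectionGL_zero, mul_one]
      split_ifs <;> simp
    · simp only [gs_swap_mul_transvectionGL_mul_steinbergElement hlt.ne hr, hs, mul_sub, map_sub,
        Finset.sum_sub_distrib, hsum]
      have h2 := hsum 0
      simp only [transvectionGL_zero, gs_one, one_mul] at h2
      rw [h2, sub_self, if_neg, neg_zero]
      rintro rfl
      exact hr (by simp [r, Matrix.one_apply_ne hlt.ne])

theorem swap_conj_mul_mem_negPart {i j : Fin n} (hij : (i : ℕ) + 1 = j) (hlt : i < j)
    {σ : Equiv.Perm (Fin n)} (hσ : σ⁻¹ j < σ⁻¹ i) (t : F) {v : GL (Fin n) F}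
    (hv : v ∈ negPart F (Equiv.swap i j * σ)) :
    transvectionGL i j hlt.ne t * (permGL (Equiv.swap i j) * v * (permGL (Equiv.swap i j))⁻¹) ∈
      negPart F σ := by
  have hswap : ∀ k, (Equiv.swap i j * σ)⁻¹ k = σ⁻¹ (Equiv.swap i j k) := fun k => by
    rw [_root_.mul_inv_rev, Equiv.swap_inv, Equiv.Perm.mul_apply]
  rw [mem_negPart] at hv
  apply mul_mem
  · rw [mem_negPart]
    refine ⟨transvectionGL_mem_unitriangular hlt t, fun a b hab => ?_⟩
    rw [transvectionGL_apply, if_neg, if_neg, add_zero]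
    · rintro ⟨rfl, rfl⟩; exact lt_asymm hσ hab
    · rintro rfl; exact lt_irrefl _ hab
  · rw [mem_negPart]
    refine ⟨swap_conj_mem_unitriangular hij hv.1 (hv.2 i j ?_), fun a b hab => ?_⟩
    · rwa [hswap, hswap, Equiv.swap_apply_left, Equiv.swap_apply_right]
    · rw [permGL_conj_apply, Equiv.swap_inv]
      apply hv.2
      rwa [hswap, hswap, Equiv.swap_apply_self, Equiv.swap_apply_self]

/-- Factorization along a simple reflection that shortens σ: t is read off from the entry (i, j),
and the remaining factor has zero entry there, so the swap conjugates it into U. It drives the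
induction in `sum_leadCoeff_negPart`. -/
theorem swap_conj_mul_bijective {i j : Fin n} (hij : (i : ℕ) + 1 = j) (hlt : i < j)
    {σ : Equiv.Perm (Fin n)} (hσ : σ⁻¹ j < σ⁻¹ i) :
    Function.Bijective (fun p : F × negPart F (Equiv.swap i j * σ) =>
      (⟨_, swap_conj_mul_mem_negPart hij hlt hσ p.1 p.2.2⟩ : negPart F σ)) := by
  have hswap : ∀ k, (Equiv.swap i j * σ)⁻¹ k = σ⁻¹ (Equiv.swap i j k) := fun k => by
    rw [_root_.mul_inv_rev, Equiv.swap_inv, Equiv.Perm.mul_apply]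
  constructor
  · rintro ⟨t, v, hv⟩ ⟨r, w, hw⟩ h
    simp only [Subtype.mk.injEq] at h
    have hent : ∀ (t : F) (v : GL (Fin n) F) (_ : v ∈ negPart F (Equiv.swap i j * σ)),
        (transvectionGL i j hlt.ne t * (permGL (Equiv.swap i j) * v *
          (permGL (Equiv.swap i j))⁻¹)).val i j = t := by
      intro t v hv
      have hv1 := mem_unitriangular.1 (negPart_le _ hv)
      rw [transvectionGL_mul_apply, if_pos rfl, permGL_conj_apply, permGL_conj_apply,
        Equiv.swap_inv, Equiv.swap_apply_left, Equiv.swap_apply_right, hv1.1 j i hlt, hv1.2]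
      ring
    have h1 : t = r := by rw [← hent t v hv, h, hent r w hw]
    subst h1
    have h2 : v = w := by simpa using h
    subst h2
    rfl
  · rintro ⟨y, hy⟩
    have hy1 := mem_negPart.1 hy
    have hy2 := mem_unitriangular.1 hy1.1
    let t := y.val i j
    let z := transvectionGL i j hlt.ne (-t) * y
    have hz : z ∈ unitriangular n F := mul_mem (transvectionGL_mem_unitriangular hlt _) hy1.1
    have hz0 : z.val i j = 0 := by
      simp only [z, t]
      rw [transvectionGL_mul_apply, if_pos rfl, hy2.2]; ring
    have hzn : z ∈ negPart F σ := by
      refine mul_mem (mem_negPart.2 ⟨transvectionGL_mem_unitriangular hlt _, fun a b hab => ?_⟩) hy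
      rw [transvectionGL_apply, if_neg, if_neg, add_zero]
      · rintro ⟨rfl, rfl⟩; exact lt_asymm hσ hab
      · rintro rfl; exact lt_irrefl _ hab
    have hinv : (permGL (Equiv.swap i j) : GL (Fin n) F)⁻¹ = permGL (Equiv.swap i j) := by
      rw [← permGL_inv, Equiv.swap_inv]
    have hmem : permGL (Equiv.swap i j) * z * (permGL (Equiv.swap i j))⁻¹ ∈
        negPart F (Equiv.swap i j * σ) := by
      refine mem_negPart.2 ⟨swap_conj_mem_unitriangular hij hz hz0, fun a b hab => ?_⟩
      rw [permGL_conj_apply, Equiv.swap_inv]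
      rw [hswap, hswap] at hab
      exact (mem_negPart.1 hzn).2 _ _ hab
    refine ⟨⟨t, ⟨_, hmem⟩⟩, Subtype.ext ?_⟩
    have h1 : transvectionGL i j hlt.ne t * z = y := by
      simp only [z]
      rw [← mul_assoc, transvectionGL_mul, add_neg_cancel, transvectionGL_zero, one_mul]
    change transvectionGL i j hlt.ne t * (permGL (Equiv.swap i j) * (permGL (Equiv.swap i j) * z *
      (permGL (Equiv.swap i j))⁻¹) * (permGL (Equiv.swap i j))⁻¹) = y
    conv_rhs => rw [← h1]
    congr 1
    have h2 : (permGL (Equiv.swap i j) : GL (Fin n) F) * permGL (Equiv.swap i j) = 1 := by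
      rw [← permGL_mul, Equiv.swap_mul_self, permGL_one]
    rw [hinv]
    calc _ = (permGL (Equiv.swap i j) * permGL (Equiv.swap i j)) * z *
          (permGL (Equiv.swap i j) * permGL (Equiv.swap i j)) := by simp only [mul_assoc]
      _ = z := by rw [h2, one_mul, mul_one]

open Classical in
-- Induction on the length of σ; each simple reflection contributes the sign -1 by the rank one
-- case. This number is what makes the projection of σ E_λ a unit multiple of an eigenvector when q
-- is invertible.
theorem sum_leadCoeff_negPart (σ : Equiv.Perm (Fin n)) {x : GroupAlg n F R}
    (hx : x ∈ lattice n F R) :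
    ∑ v : negPart F σ, leadCoeff R (gs R (v.1 * permGL σ) * x) =
      ((Equiv.Perm.sign σ : ℤ) : R) * leadCoeff R x := by
  rw [mem_lattice_iff] at hx
  -- Simple reflections are to be removed on the left of σ, that is, on the right of τ = σ⁻¹, where
  -- descents are visible.
  obtain ⟨τ, rfl⟩ : ∃ τ, σ = τ⁻¹ := ⟨σ⁻¹, by simp⟩
  induction τ using perm_descent_induction with
  | h τ ih =>
  by_cases hτ : ∀ i j : Fin n, (i : ℕ) + 1 = j → τ i < τ j
  · rw [perm_eq_one_of_monotone τ hτ]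
    have hone : ∀ v : negPart F (1⁻¹ : Equiv.Perm (Fin n)), v = 1 := by
      rintro ⟨v, hv⟩
      ext1
      refine posPart_inf_negPart _ (mem_posPart.2 ⟨negPart_le _ hv, fun i j hij => ?_⟩) hv
      exact (mem_unitriangular.1 (negPart_le _ hv)).1 i j (by simpa using hij)
    rw [Finset.sum_eq_single 1 (fun v _ hv => absurd (hone v) hv) (by simp)]
    simp [permGL_one, gs_one]
  · push Not at hτ
    obtain ⟨i, j, hij, hle⟩ := hτ
    have hlt : i < j := by rw [Fin.lt_def]; omega
    have hd : τ j < τ i := lt_of_le_of_ne hle (τ.injective.ne hlt.ne')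
    have ih' := ih i j hij hd
    have hσ : (τ⁻¹)⁻¹ j < (τ⁻¹)⁻¹ i := by rwa [inv_inv]
    rw [← (swap_conj_mul_bijective (F := F) hij hlt hσ).sum_comp, Fintype.sum_prod_type,
      Finset.sum_comm]
    have hinv : (τ * Equiv.swap i j)⁻¹ = Equiv.swap i j * τ⁻¹ := by
      rw [_root_.mul_inv_rev, Equiv.swap_inv]
    rw [hinv] at ih'
    have hterm : ∀ v : negPart F (Equiv.swap i j * τ⁻¹),
        ∑ t, leadCoeff R (gs R (transvectionGL i j hlt.ne t * (permGL (Equiv.swap i j) * v.1 *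
          (permGL (Equiv.swap i j))⁻¹) * permGL τ⁻¹) * x) =
        -leadCoeff R (gs R (v.1 * permGL (Equiv.swap i j * τ⁻¹)) * x) := by
      intro v
      rw [← sum_leadCoeff_transvectionGL_mul_swap hij hlt
        (gs_mul_mem_unipotentSpan_of_mem (v.1 * permGL (Equiv.swap i j * τ⁻¹)) hx)]
      refine Finset.sum_congr rfl fun t _ => ?_
      rw [← mul_assoc (gs R _), ← gs_mul, ← permGL_inv, Equiv.swap_inv, permGL_mul]
      simp only [mul_assoc]
    simp only [hterm]
    rw [Finset.sum_neg_distrib, ih', Equiv.Perm.sign_mul, Equiv.Perm.sign_swap hlt.ne]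
    simp

end Averaging

/-! ### Projections onto the eigenspaces of linear characters of U. -/

section Eigen

variable {n : ℕ} {F : Type*} [Field F] [Fintype F] [DecidableEq F] {R : Type*} [CommRing R]

theorem gs_mul_mem_lattice (g : GL (Fin n) F) {x : GroupAlg n F R} (hx : x ∈ lattice n F R) :
    gs R g * x ∈ lattice n F R :=
  (lattice n F R).smul_mem (gs R g) hx

open Classical in
/-- The unnormalized projection `x ↦ ∑_u lam(u) u x` onto the eigenspace of `lam⁻¹`. -/
def eigenProj (lam : unitriangular n F →* Rˣ) : GroupAlg n F R →ₗ[R] GroupAlg n F R where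
  toFun x := ∑ u : unitriangular n F, (lam u : R) • (gs R u.1 * x)
  map_add' x y := by simp only [mul_add, smul_add, Finset.sum_add_distrib]
  map_smul' a x := by
    simp only [mul_smul_comm, RingHom.id_apply, Finset.smul_sum]
    exact Finset.sum_congr rfl fun u _ => smul_comm _ _ _

open Classical in
theorem eigenProj_apply (lam : unitriangular n F →* Rˣ) (x : GroupAlg n F R) :
    eigenProj lam x = ∑ u : unitriangular n F, (lam u : R) • (gs R u.1 * x) := rfl

theorem coe_eigenvector (lam : unitriangular n F →* Rˣ) :
    (eigenvector lam : GroupAlg n F R) = eigenProj lam (steinbergElement n F R) := by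
  rw [eigenvector, Submodule.coe_smul, smul_eq_mul, Finset.sum_mul, eigenProj_apply]
  refine Finset.sum_congr rfl fun u _ => ?_
  rw [gs_eq, ← smul_mul_assoc, MonoidAlgebra.smul_single, smul_eq_mul, mul_one]

open Classical in
theorem eigenProj_gs_mul (lam : unitriangular n F →* Rˣ) (v : unitriangular n F)
    (x : GroupAlg n F R) :
    eigenProj lam (gs R v.1 * x) = ((lam v)⁻¹ : Rˣ) • eigenProj lam x := by
  rw [eigenProj_apply, eigenProj_apply, Finset.smul_sum, ← Equiv.sum_comp (Equiv.mulRight v)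
    (fun u => ((lam v)⁻¹ : Rˣ) • (lam u : R) • (gs R u.1 * x))]
  refine Finset.sum_congr rfl fun u _ => ?_
  rw [Equiv.coe_mulRight, map_mul, Units.smul_def, smul_smul, Subgroup.coe_mul, gs_mul, mul_assoc,
    mul_comm (lam u), Units.val_mul, Units.inv_mul_cancel_left]

open Classical in
theorem gs_mul_eigenProj (lam : unitriangular n F →* Rˣ) (v : unitriangular n F)
    (x : GroupAlg n F R) :
    gs R v.1 * eigenProj lam x = ((lam v)⁻¹ : Rˣ) • eigenProj lam x := by
  rw [eigenProj_apply, Finset.mul_sum, Finset.smul_sum, ← Equiv.sum_comp (Equiv.mulLeft v)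
    (fun u => ((lam v)⁻¹ : Rˣ) • (lam u : R) • (gs R u.1 * x))]
  refine Finset.sum_congr rfl fun u _ => ?_
  simp [Units.smul_def, smul_smul, ← mul_assoc, gs_mul]

theorem leadCoeff_eigenvector (lam : unitriangular n F →* Rˣ) :
    leadCoeff R (eigenvector lam : GroupAlg n F R) = 1 := by
  classical
  rw [coe_eigenvector, eigenProj_apply, map_sum]
  simp only [map_smul, leadCoeff_gs_mul (SetLike.coe_mem _)]
  rw [Finset.sum_eq_single 1]
  · simp
  · intro u _ hu
    have h : (u : GL (Fin n) F) ≠ 1 := fun h => hu (Subtype.ext h)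
    rw [if_neg h, smul_zero]
  · simp

/-- Multiplicity one: the projection of a basis element u s is a scalar multiple of E_λ, and E_λ has
leading coefficient 1, so the scalar can be read off. -/
theorem eigenProj_eq_smul (lam : unitriangular n F →* Rˣ) {x : GroupAlg n F R}
    (hx : x ∈ lattice n F R) : eigenProj lam x =
      leadCoeff R (eigenProj lam x) • (eigenvector lam : GroupAlg n F R) := by
  rw [mem_lattice_iff] at hx
  induction hx using Submodule.span_induction with
  | mem x hx =>
    obtain ⟨u, rfl⟩ := hx
    simp only [eigenProj_gs_mul, ← coe_eigenvector, Units.smul_def, map_smul,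
      leadCoeff_eigenvector, smul_eq_mul, mul_one]
  | zero => simp
  | add x y _ _ hx hy =>
    conv_lhs => rw [map_add, hx, hy]
    rw [map_add, map_add, add_smul]
  | smul a x _ hx =>
    conv_lhs => rw [map_smul, hx]
    rw [map_smul, map_smul, smul_smul, smul_eq_mul]

theorem gs_mul_eigenvector (lam : unitriangular n F →* Rˣ) (v : unitriangular n F) :
    gs R v.1 * (eigenvector lam : GroupAlg n F R) =
      ((lam v)⁻¹ : Rˣ) • (eigenvector lam : GroupAlg n F R) := by
  rw [coe_eigenvector, gs_mul_eigenProj]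

/-- If `mu` is trivial on `U ∩ σ B⁻ σ⁻¹` and agrees with `lam ^ σ` on `U ∩ σ B σ⁻¹`, then `E_mu`
is obtained from `E_lam`, up to a power of `q`. -/
theorem eigenProj_permGL_mul_eigenvector (lam mu : unitriangular n F →* Rˣ)
    (σ : Equiv.Perm (Fin n)) (h1 : ∀ u : unitriangular n F, u.1 ∈ negPart F σ → mu u = 1)
    (h2 : ∀ u v : unitriangular n F, u.1 ∈ posPart F σ →
      v.1 = (permGL σ)⁻¹ * u.1 * permGL σ → mu u = lam v) :
    eigenProj mu (gs R (permGL σ) * (eigenvector lam : GroupAlg n F R)) =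
      (Nat.card (posPart F σ) * ((Equiv.Perm.sign σ : ℤ) : R)) •
        (eigenvector mu : GroupAlg n F R) := by
  classical
  rw [eigenProj_eq_smul mu (gs_mul_mem_lattice _ (eigenvector lam).2)]
  congr 1
  rw [eigenProj_apply, ← (negPart_mul_posPart_bijective (F := F) σ).sum_comp,
    Fintype.sum_prod_type, map_sum]
  -- The factor w moves past σ into U, where E_λ is an eigenvector; its eigenvalue cancels the
  -- weight given by mu. The sum over w thus only produces the order of `posPart F σ`.
  have hterm : ∀ (v : negPart F σ) (w : posPart F σ),
      (mu ⟨v.1 * w.1, mul_mem (negPart_le σ v.2) (posPart_le σ w.2)⟩ : R) •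
        (gs R (v.1 * w.1) * (gs R (permGL σ) * (eigenvector lam : GroupAlg n F R))) =
      gs R (v.1 * permGL σ) * (eigenvector lam : GroupAlg n F R) := by
    intro v w
    obtain ⟨z, hz⟩ : ∃ z : unitriangular n F, z.1 = (permGL σ)⁻¹ * w.1 * permGL σ :=
      ⟨⟨_, posPart_conj_mem_unitriangular w.2⟩, rfl⟩
    have e1 : mu ⟨v.1 * w.1, mul_mem (negPart_le σ v.2) (posPart_le σ w.2)⟩ = lam z := by
      rw [← h2 ⟨w.1, posPart_le σ w.2⟩ _ w.2 hz, ← one_mul (mu ⟨w.1, posPart_le σ w.2⟩),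
        ← h1 ⟨v.1, negPart_le σ v.2⟩ v.2, ← map_mul]
      rfl
    have e2 : v.1 * w.1 * permGL σ = v.1 * permGL σ * z.1 := by rw [hz]; group
    rw [e1, ← mul_assoc, ← gs_mul, e2, gs_mul, mul_assoc, gs_mul_eigenvector lam z,
      Units.smul_def, mul_smul_comm, smul_smul, Units.mul_inv, one_smul]
  simp only [hterm, Finset.sum_const, Finset.card_univ, map_nsmul]
  rw [← Finset.smul_sum, sum_leadCoeff_negPart σ (eigenvector lam).2, leadCoeff_eigenvector,
    mul_one, nsmul_eq_mul, Nat.card_eq_fintype_card]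

end Eigen

/-! ### Linear characters of U and their restrictions to the simple root subgroups. -/

section Characters

variable {n : ℕ} {F : Type*} [Field F]

/-- The upper unitriangular matrices that differ from the identity only in the column `k`. -/
def columnGL (k : Fin n) (c : Fin n → F) : GL (Fin n) F :=
  ofUnitriangular (fun i j => (if i = j then 1 else 0) + if j = k ∧ i < k then c i else 0)
    (fun i j h => by
      rw [if_neg h.ne', if_neg, add_zero]
      rintro ⟨rfl, h'⟩; exact lt_asymm h h')
    (fun i => by
      rw [if_pos rfl, if_neg, add_zero]
      rintro ⟨rfl, h'⟩; exact lt_irrefl _ h')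

theorem columnGL_apply (k : Fin n) (c : Fin n → F) (i j : Fin n) :
    (columnGL k c).val i j = (if i = j then 1 else 0) + if j = k ∧ i < k then c i else 0 := rfl

theorem columnGL_mem (k : Fin n) (c : Fin n → F) : columnGL k c ∈ unitriangular n F :=
  ofUnitriangular_mem _ _ _

theorem columnGL_mul_apply (k : Fin n) (c : Fin n → F) (g : GL (Fin n) F) (i j : Fin n) :
    (columnGL k c * g).val i j = g.val i j + if i < k then c i * g.val k j else 0 := by
  rw [Units.val_mul, Matrix.mul_apply]
  simp only [columnGL_apply, add_mul, Finset.sum_add_distrib, ite_mul, one_mul, zero_mul,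
    Finset.sum_ite_eq, Finset.mem_univ, if_true]
  congr 1
  rw [Finset.sum_eq_single k]
  · simp
  · intro m _ hm; rw [if_neg (fun h => hm h.1)]
  · simp

theorem mul_columnGL_apply (k : Fin n) (c : Fin n → F) (g : GL (Fin n) F) (i j : Fin n) :
    (g * columnGL k c).val i j = g.val i j +
      if j = k then ∑ m, (if m < k then g.val i m * c m else 0) else 0 := by
  rw [Units.val_mul, Matrix.mul_apply]
  simp only [columnGL_apply, mul_add, Finset.sum_add_distrib, mul_ite, mul_one, mul_zero,
    Finset.sum_ite_eq', Finset.mem_univ, if_true]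
  congr 1
  split_ifs with h
  · simp [h]
  · simp [h]

theorem columnGL_add (k : Fin n) (c d : Fin n → F) :
    columnGL k (c + d) = columnGL k c * columnGL k d := by
  ext i j
  rw [columnGL_mul_apply, columnGL_apply, columnGL_apply, columnGL_apply]
  by_cases h : i < k <;> by_cases h2 : j = k
  · subst h2; simp [h]; ring
  · simp [h, h2, Ne.symm h2]
  · simp [h]
  · simp [h]

theorem columnGL_zero (k : Fin n) : columnGL k (0 : Fin n → F) = 1 := by
  ext i j
  by_cases h : i = j <;> simp [columnGL_apply, h]

theorem columnGL_single {k i : Fin n} (h : i < k) (t : F) :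
    columnGL k (Pi.single i t) = transvectionGL i k h.ne t := by
  ext a b
  rw [columnGL_apply, transvectionGL_apply]
  congr 1
  by_cases h1 : a = i
  · subst h1; simp [h, eq_comm]
  · simp [h1, Ne.symm h1]

theorem columnGL_single_of_not_lt {k i : Fin n} (h : ¬ i < k) (t : F) :
    columnGL k (Pi.single i t) = 1 := by
  rw [← columnGL_zero k]
  ext a b
  rw [columnGL_apply, columnGL_apply]
  congr 1
  by_cases h1 : a = i
  · subst h1; simp [h]
  · simp [h1]

theorem unitriangular_le_of_columnGL {H : Subgroup (GL (Fin n) F)}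
    (h : ∀ k c, columnGL k c ∈ H) : unitriangular n F ≤ H := by
  have key : ∀ m : ℕ, ∀ u ∈ unitriangular n F,
      (∀ i j : Fin n, m ≤ (j : ℕ) → u.val i j = if i = j then 1 else 0) → u ∈ H := by
    intro m
    induction m with
    | zero =>
      intro u _ hu1
      have : u = 1 := by
        ext i j; rw [hu1 i j (Nat.zero_le _)]
        by_cases hij : i = j <;> simp [hij]
      rw [this]; exact one_mem _
    | succ m ih =>
      intro u hu hu1
      by_cases hm : m < n
      · let k : Fin n := ⟨m, hm⟩
        have hu2 := mem_unitriangular.1 hu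
        -- Columns beyond k are already trivial; left multiplication by this element clears column k
        -- and leaves them unchanged.
        suffices columnGL k (-(fun i => u.val i k)) * u ∈ H from
          (Subgroup.mul_mem_cancel_left _ (h _ _)).1 this
        refine ih _ (mul_mem (columnGL_mem _ _) hu) fun i j hj => ?_
        rw [columnGL_mul_apply]
        rcases hj.eq_or_lt with h1 | h1
        · have hjk : j = k := Fin.ext h1.symm
          rw [hjk, hu2.2]
          by_cases hi : i < k
          · simp [hi, hi.ne]
          · rw [if_neg hi, add_zero]
            by_cases hij : i = k
            · rw [hij, hu2.2, if_pos rfl]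
            · rw [if_neg hij]
              exact hu2.1 _ _ (lt_of_le_of_ne (not_lt.1 hi) (Ne.symm hij))
        · have hkj : k ≠ j := by rintro rfl; simp [k] at h1
          rw [hu1 i j h1, hu1 k j h1, if_neg hkj]
          simp
      · refine ih u hu fun i j hj => ?_
        exact absurd j.2 (by omega)
  intro u hu
  exact key n u hu fun i j hj => absurd j.2 (by omega)

theorem unitriangular_le_of_transvectionGL {H : Subgroup (GL (Fin n) F)}
    (h : ∀ (i j : Fin n) (hij : i < j) (t : F), transvectionGL i j hij.ne t ∈ H) :
    unitriangular n F ≤ H := by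
  apply unitriangular_le_of_columnGL
  intro k c
  let A : AddSubmonoid (Fin n → F) :=
    { carrier := {c | columnGL k c ∈ H}
      zero_mem' := by rw [Set.mem_ofPred_eq, columnGL_zero]; exact one_mem _
      add_mem' := fun {a b} ha hb => by
        rw [Set.mem_ofPred_eq, columnGL_add]; exact mul_mem ha hb }
  have : ∑ i, Pi.single i (c i) ∈ A := sum_mem fun i _ => by
    change columnGL k (Pi.single i (c i)) ∈ H
    by_cases hik : i < k
    · rw [columnGL_single hik]; exact h i k hik _
    · rw [columnGL_single_of_not_lt hik]; exact one_mem _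
  rwa [Finset.univ_sum_single] at this

/-- The entry `(i, i+1)` of a matrix, and `0` for the last row. -/
def superdiag (g : GL (Fin n) F) (i : Fin n) : F :=
  if h : (i : ℕ) + 1 < n then g.val i ⟨i + 1, h⟩ else 0

theorem superdiag_eq (g : GL (Fin n) F) {i j : Fin n} (h : (i : ℕ) + 1 = j) :
    superdiag g i = g.val i j := by
  have h1 : (i : ℕ) + 1 < n := h ▸ j.2
  rw [superdiag, dif_pos h1, show (⟨i + 1, h1⟩ : Fin n) = j from Fin.ext h]

theorem superdiag_one (i : Fin n) : superdiag (1 : GL (Fin n) F) i = 0 := by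
  rw [superdiag]
  split_ifs with h
  · rw [Units.val_one, Matrix.one_apply_ne]
    intro h1
    simpa using congrArg Fin.val h1
  · rfl

/-- In the entry (i, i+1) of a product of unitriangular matrices only the terms of index i and i+1
survive. The last row, where `superdiag` is 0 by convention, needs no exception. -/
theorem superdiag_mul {u v : GL (Fin n) F} (hu : u ∈ unitriangular n F)
    (hv : v ∈ unitriangular n F) (i : Fin n) :
    superdiag (u * v) i = superdiag u i + superdiag v i := by
  rw [mem_unitriangular] at hu hv
  by_cases h : (i : ℕ) + 1 < n
  · let j : Fin n := ⟨i + 1, h⟩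
    have hij : (i : ℕ) + 1 = j := rfl
    rw [superdiag_eq _ hij, superdiag_eq _ hij, superdiag_eq _ hij, Units.val_mul,
      Matrix.mul_apply]
    have hne : i ≠ j := by intro h; have := congrArg Fin.val h; omega
    rw [Finset.sum_eq_add i j hne, hu.2, hv.2]
    · ring
    · rintro k - ⟨h1, h2⟩
      rcases lt_or_ge k i with h3 | h3
      · rw [hu.1 _ _ h3, zero_mul]
      · have h4 : j < k := by
          rw [Fin.lt_def]; rw [Fin.le_def] at h3
          have := Fin.val_ne_of_ne h1; have := Fin.val_ne_of_ne h2
          omega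
        rw [hv.1 _ _ h4, mul_zero]
    · simp
    · simp
  · simp [superdiag, h]

variable {A : Type*} [CommGroup A]

/-- The linear character of `U` with prescribed restrictions to the simple root subgroups. -/
def superdiagChar (χ : ℕ → AddChar F A) : unitriangular n F →* A where
  toFun u := ∏ i : Fin n, χ i (superdiag u.1 i)
  map_one' := by simp [superdiag_one]
  map_mul' u v := by
    simp only [Subgroup.coe_mul, superdiag_mul u.2 v.2, AddChar.map_add_eq_mul,
      Finset.prod_mul_distrib]

theorem superdiagChar_apply (χ : ℕ → AddChar F A) (u : unitriangular n F) :
    superdiagChar χ u = ∏ i : Fin n, χ i (superdiag u.1 i) := rfl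

theorem superdiagChar_inv (χ : ℕ → AddChar F A) :
    (superdiagChar χ : unitriangular n F →* A)⁻¹ = superdiagChar χ⁻¹ := by
  ext u
  rw [MonoidHom.inv_apply, superdiagChar_apply, superdiagChar_apply, ← Finset.prod_inv_distrib]
  refine Finset.prod_congr rfl fun i _ => ?_
  rw [Pi.inv_apply, AddChar.inv_apply, AddChar.map_neg_eq_inv]

theorem superdiag_transvectionGL {i j : Fin n} (h : (i : ℕ) + 1 = j) (hne : i ≠ j) (t : F)
    (k : Fin n) : superdiag (transvectionGL i j hne t) k = if k = i then t else 0 := by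
  split_ifs with hk
  · subst hk; rw [superdiag_eq _ h, transvectionGL_apply]; simp [hne]
  · by_cases hk2 : (k : ℕ) + 1 < n
    · rw [superdiag, dif_pos hk2, transvectionGL_apply, if_neg, if_neg, add_zero]
      · rintro ⟨rfl, -⟩; exact hk rfl
      · intro h'; have := congrArg Fin.val h'; simp at this
    · rw [superdiag, dif_neg hk2]

theorem superdiagChar_transvectionGL (χ : ℕ → AddChar F A) {i j : Fin n} (h : (i : ℕ) + 1 = j)
    (hne : i ≠ j) (t : F) (hm : transvectionGL i j hne t ∈ unitriangular n F) :
    superdiagChar χ ⟨_, hm⟩ = χ i t := by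
  rw [superdiagChar_apply, Finset.prod_eq_single i]
  · simp [superdiag_transvectionGL h]
  · intro k _ hk; simp [superdiag_transvectionGL h, hk]
  · simp

/-- Root subgroups of non-simple positive roots consist of commutators, hence are killed by
characters with commutative target. -/
theorem transvectionGL_commutator {i m j : Fin n} (him : i < m) (hmj : m < j) (t : F) :
    transvectionGL i m him.ne t * transvectionGL m j hmj.ne 1 =
      transvectionGL i j (him.trans hmj).ne t *
        (transvectionGL m j hmj.ne 1 * transvectionGL i m him.ne t) := by
  have h1 := him.ne; have h2 := hmj.ne; have h3 := (him.trans hmj).ne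
  ext a b
  simp only [transvectionGL_mul_apply, transvectionGL_apply]
  by_cases ha : a = i
  · subst ha
    by_cases hb : b = j
    · subst hb; simp [h1, h2, h3, h1.symm, h2.symm, h3.symm]
    · simp [h1, h2, h3, h1.symm, h2.symm, h3.symm, hb, Ne.symm hb]
  · by_cases hm : a = m
    · subst hm; simp [ha, Ne.symm ha, h1, h2, h3, h1.symm, h2.symm, h3.symm]
    · simp [ha, Ne.symm ha, hm, Ne.symm hm, h1, h2, h3, h1.symm, h2.symm, h3.symm]

/-- Every linear character of `U` is determined by its restrictions to the simple root
subgroups. -/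
theorem exists_eq_superdiagChar (lam : unitriangular n F →* A) :
    ∃ χ : ℕ → AddChar F A, lam = superdiagChar χ := by
  have hlt : ∀ k (h : k + 1 < n), (⟨k, by omega⟩ : Fin n) < ⟨k + 1, h⟩ := fun k h => by
    simp [Fin.lt_def]
  -- Only the positions k with k + 1 < n are meaningful; elsewhere the value is irrelevant and set
  -- to 1.
  let χ : ℕ → AddChar F A := fun k =>
    if h : k + 1 < n then
      { toFun := fun t => lam ⟨transvectionGL (⟨k, by omega⟩ : Fin n) ⟨k + 1, h⟩
          (hlt k h).ne t, transvectionGL_mem_unitriangular (hlt k h) t⟩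
        map_zero_eq_one' := by
          rw [← map_one lam]
          exact congrArg lam (Subtype.ext (transvectionGL_zero _ _ (hlt k h).ne))
        map_add_eq_mul' := fun s t => by
          rw [← map_mul]
          exact congrArg lam (Subtype.ext (transvectionGL_mul _ _ (hlt k h).ne s t).symm) }
    else 1
  refine ⟨χ, ?_⟩
  let H : Subgroup (GL (Fin n) F) :=
    (MonoidHom.eqLocus lam (superdiagChar χ)).map (unitriangular n F).subtype
  have hH : unitriangular n F ≤ H := by
    apply unitriangular_le_of_transvectionGL
    intro i j hij t
    refine ⟨⟨_, transvectionGL_mem_unitriangular hij t⟩, ?_, rfl⟩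
    change lam _ = superdiagChar χ _
    by_cases h : (i : ℕ) + 1 = j
    · rw [superdiagChar_transvectionGL χ h]
      have h1 : (i : ℕ) + 1 < n := h ▸ j.2
      simp only [χ]
      rw [dif_pos h1]
      change _ = lam _
      congr 1
      ext1
      have : j = ⟨i + 1, h1⟩ := Fin.ext h.symm
      subst this
      rfl
    · have hlt' : (i : ℕ) + 1 < j := by rw [Fin.lt_def] at hij; omega
      let m : Fin n := ⟨i + 1, by omega⟩
      have him : i < m := by rw [Fin.lt_def]; simp [m]
      have hmj : m < j := by rw [Fin.lt_def]; exact hlt'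
      have key : ∀ μ : unitriangular n F →* A,
          μ ⟨_, transvectionGL_mem_unitriangular hij t⟩ = 1 := by
        intro μ
        have h2 : (⟨_, transvectionGL_mem_unitriangular him t⟩ : unitriangular n F) *
            ⟨_, transvectionGL_mem_unitriangular hmj 1⟩ =
            ⟨_, transvectionGL_mem_unitriangular hij t⟩ *
            (⟨_, transvectionGL_mem_unitriangular hmj 1⟩ *
              ⟨_, transvectionGL_mem_unitriangular him t⟩) :=
          Subtype.ext (transvectionGL_commutator him hmj t)
        have h3 := congrArg μ h2
        rw [map_mul, map_mul, map_mul, mul_comm (μ ⟨_, transvectionGL_mem_unitriangular him t⟩)]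
          at h3
        exact mul_eq_right.1 h3.symm
      rw [key, key]
  ext u
  obtain ⟨v, hv, e⟩ := hH u.2
  rw [← Subtype.ext (a1 := v) (a2 := u) e]
  exact hv

theorem exists_transvectionGL_iff (χ : ℕ → AddChar F A) {i j : Fin n} (h : (i : ℕ) + 1 = j) :
    (∃ (a : F) (u : unitriangular n F), ((u : GL (Fin n) F) : Matrix (Fin n) (Fin n) F) =
      Matrix.transvection i j a ∧ superdiagChar χ u ≠ 1) ↔ χ i ≠ 1 := by
  have hlt : i < j := by rw [Fin.lt_def]; omega
  rw [AddChar.ne_one_iff]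
  constructor
  · rintro ⟨a, u, hu, h1⟩
    refine ⟨a, ?_⟩
    rwa [← superdiagChar_transvectionGL χ h hlt.ne a (transvectionGL_mem_unitriangular hlt a),
      show (⟨_, transvectionGL_mem_unitriangular hlt a⟩ : unitriangular n F) = u from
        Subtype.ext (Units.ext hu.symm)]
  · rintro ⟨a, ha⟩
    exact ⟨a, ⟨_, transvectionGL_mem_unitriangular hlt a⟩, rfl, by
      rwa [superdiagChar_transvectionGL χ h]⟩

end Characters

/-! ### Block exchanges and the resulting inclusions between the submodules generated by
eigenvectors. -/

section Moves

variable {n : ℕ} {F : Type*} [Field F]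

section Superdiag

variable {A : Type*} [CommGroup A]

theorem superdiagChar_eq_one_of_mem_negPart {χ' : ℕ → AddChar F A} {σ : Equiv.Perm (Fin n)}
    (h3 : ∀ i m : Fin n, (i : ℕ) + 1 = m → ((σ⁻¹ m : Fin n) : ℕ) ≠ σ⁻¹ i + 1 → χ' i = 1)
    (u : unitriangular n F) (hu : u.1 ∈ negPart F σ) : superdiagChar χ' u = 1 := by
  rw [superdiagChar_apply]
  refine Finset.prod_eq_one fun i _ => ?_
  by_cases hi : (i : ℕ) + 1 < n
  · let m : Fin n := ⟨i + 1, hi⟩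
    have him : (i : ℕ) + 1 = m := rfl
    by_cases h : ((σ⁻¹ m : Fin n) : ℕ) = σ⁻¹ i + 1
    · rw [superdiag_eq _ him, (mem_negPart.1 hu).2 i m (by rw [Fin.lt_def]; omega),
        AddChar.map_zero_eq_one]
    · rw [h3 i m him h, AddChar.one_apply]
  · rw [superdiag, dif_neg hi, AddChar.map_zero_eq_one]

/-- Conjugation by σ carries simple roots to arbitrary roots: those sent to simple roots must match
(`h1`), those sent to other positive roots must be trivial (`h2`), and simple roots of the target
not coming from simple roots must be trivial (`h3`). Simple roots sent to negative roots are
unconstrained, because the matching entry of u is zero. -/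
theorem superdiagChar_conj {χ χ' : ℕ → AddChar F A} {σ : Equiv.Perm (Fin n)}
    (h1 : ∀ j k : Fin n, (j : ℕ) + 1 = k → ((σ k : Fin n) : ℕ) = σ j + 1 → χ' (σ j) = χ j)
    (h2 : ∀ j k : Fin n, (j : ℕ) + 1 = k → σ j < σ k → ((σ k : Fin n) : ℕ) ≠ σ j + 1 → χ j = 1)
    (h3 : ∀ i m : Fin n, (i : ℕ) + 1 = m → ((σ⁻¹ m : Fin n) : ℕ) ≠ σ⁻¹ i + 1 → χ' i = 1)
    (u v : unitriangular n F) (hu : u.1 ∈ posPart F σ)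
    (hv : v.1 = (permGL σ)⁻¹ * u.1 * permGL σ) : superdiagChar χ' u = superdiagChar χ v := by
  rw [superdiagChar_apply, superdiagChar_apply, ← Equiv.prod_comp σ]
  refine Finset.prod_congr rfl fun j _ => ?_
  have hleft : (∀ m : Fin n, ((σ j : Fin n) : ℕ) + 1 = m → ((σ⁻¹ m : Fin n) : ℕ) ≠ j + 1) →
      χ' (σ j) (superdiag u.1 (σ j)) = 1 := by
    intro h
    by_cases hj : ((σ j : Fin n) : ℕ) + 1 < n
    · rw [h3 (σ j) ⟨_, hj⟩ rfl (by rw [perm_inv_apply]; exact h _ rfl), AddChar.one_apply]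
    · rw [superdiag, dif_neg hj, AddChar.map_zero_eq_one]
  by_cases hj : (j : ℕ) + 1 < n
  · let k : Fin n := ⟨j + 1, hj⟩
    have hjk : (j : ℕ) + 1 = k := rfl
    have e : superdiag v.1 j = u.1.val (σ j) (σ k) := by
      rw [superdiag_eq _ hjk, hv, permGL_conj_apply']
    by_cases h : ((σ k : Fin n) : ℕ) = σ j + 1
    · rw [e, superdiag_eq _ h.symm, h1 j k hjk h]
    · rw [hleft, e]
      · rcases lt_trichotomy (σ j) (σ k) with h4 | h4 | h4
        · rw [h2 j k hjk h4 h, AddChar.one_apply]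
        · have := σ.injective h4
          rw [Fin.ext_iff] at this; omega
        · rw [(mem_unitriangular.1 (posPart_le σ hu)).1 _ _ h4, AddChar.map_zero_eq_one]
      · intro m hm hm'
        have : m = σ k := by
          rw [← perm_apply_inv σ m]; congr 1; exact Fin.ext hm'
        rw [this] at hm
        exact h hm.symm
  · rw [hleft, superdiag, dif_neg hj, AddChar.map_zero_eq_one]
    intro m _ hm
    have := (σ⁻¹ m).2
    omega

end Superdiag

/-- The permutation that exchanges the intervals `[x, x + b)` and `[x + b, x + b + a)`. -/
def blockSwap (n x a b : ℕ) (h : x + a + b ≤ n) : Equiv.Perm (Fin n) where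
  toFun i := ⟨if x ≤ i ∧ i < x + b then i + a else if x + b ≤ i ∧ i < x + b + a then i - b else i,
    by split_ifs <;> omega⟩
  invFun i := ⟨if x ≤ i ∧ i < x + a then i + b else if x + a ≤ i ∧ i < x + a + b then i - a else i,
    by split_ifs <;> omega⟩
  left_inv i := by
    ext
    simp only
    split_ifs <;> omega
  right_inv i := by
    ext
    simp only
    split_ifs <;> omega

theorem blockSwap_apply {x a b : ℕ} (h : x + a + b ≤ n) (i : Fin n) :
    (blockSwap n x a b h i : ℕ) = if x ≤ (i : ℕ) ∧ (i : ℕ) < x + b then (i : ℕ) + a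
      else if x + b ≤ (i : ℕ) ∧ (i : ℕ) < x + b + a then (i : ℕ) - b else i := rfl

theorem blockSwap_inv_apply {x a b : ℕ} (h : x + a + b ≤ n) (i : Fin n) :
    ((blockSwap n x a b h)⁻¹ i : ℕ) = if x ≤ (i : ℕ) ∧ (i : ℕ) < x + a then (i : ℕ) + b
      else if x + a ≤ (i : ℕ) ∧ (i : ℕ) < x + a + b then (i : ℕ) - a else i := rfl

variable [Fintype F] [DecidableEq F] {R : Type*} [CommRing R]

/-- The scalar in `eigenProj_permGL_mul_eigenvector` is a power of q times a sign, hence a unit, and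
can be divided out. -/
theorem eigenvector_mem_of_permGL (hq : IsUnit (Fintype.card F : R))
    {lam mu : unitriangular n F →* Rˣ} (σ : Equiv.Perm (Fin n))
    (h1 : ∀ u : unitriangular n F, u.1 ∈ negPart F σ → mu u = 1)
    (h2 : ∀ u v : unitriangular n F, u.1 ∈ posPart F σ →
      v.1 = (permGL σ)⁻¹ * u.1 * permGL σ → mu u = lam v)
    {N : Submodule (GroupAlg n F R) (lattice n F R)} (hN : eigenvector lam ∈ N) :
    eigenvector mu ∈ N := by
  classical
  have hu : IsUnit ((Nat.card (posPart F σ) : R) * ((Equiv.Perm.sign σ : ℤ) : R)) := by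
    refine IsUnit.mul ?_ ?_
    · rw [card_posPart]; push_cast; exact hq.pow _
    · rcases Int.units_eq_one_or (Equiv.Perm.sign σ) with h | h <;> simp [h]
  obtain ⟨c, hc⟩ := hu
  have e : (c : R) • eigenvector mu ∈ N := by
    have : (c : R) • eigenvector mu =
        (∑ u : unitriangular n F, (mu u : R) • (gs R u.1 * gs R (permGL σ))) • eigenvector lam := by
      refine Subtype.ext ?_
      rw [Submodule.coe_smul_of_tower, Submodule.coe_smul, hc,
        ← eigenProj_permGL_mul_eigenvector lam mu σ h1 h2, eigenProj_apply, smul_eq_mul,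
        Finset.sum_mul]
      exact Finset.sum_congr (by congr!) fun u _ => by rw [smul_mul_assoc, mul_assoc]
    rw [this]
    exact N.smul_mem _ hN
  have e2 := N.smul_of_tower_mem (↑c⁻¹ : R) e
  rwa [smul_smul, Units.inv_mul, one_smul] at e2

/-- The submodule generated by `E_χ'` is contained in the one generated by `E_χ`. -/
def EigenLE (n : ℕ) (χ' χ : ℕ → AddChar F Rˣ) : Prop :=
  ∀ N : Submodule (GroupAlg n F R) (lattice n F R),
    eigenvector (superdiagChar χ) ∈ N → eigenvector (superdiagChar χ') ∈ N

/-- The exchange sends the simple root between the blocks of χ, at j + 1 = x + b, to a negative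
root. Hence χ is unconstrained there, and this freedom is what permits both merging and splitting.
-/
theorem eigenLE_of_blockSwap (hq : IsUnit (Fintype.card F : R)) {x a b : ℕ} (ha : 0 < a)
    (hb : 0 < b) (h : x + a + b ≤ n) {χ χ' : ℕ → AddChar F Rˣ}
    (h0 : ∀ k, k + 1 < n → k + 1 = x ∨ k + 1 = x + a ∨ k + 1 = x + a + b → χ' k = 1)
    (h1 : ∀ j, x ≤ j → j + 1 < x + b → χ j = χ' (j + a))
    (h2 : ∀ j, x + b ≤ j → j + 1 < x + b + a → χ j = χ' (j - b))
    (h3 : ∀ j, j + 1 < n → j + 1 ≤ x ∨ x + a + b ≤ j + 1 → χ j = χ' j) :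
    EigenLE n χ' χ := by
  intro N hN
  have h3' : ∀ i m : Fin n, (i : ℕ) + 1 = m → (((blockSwap n x a b h)⁻¹ m : Fin n) : ℕ) ≠
      (blockSwap n x a b h)⁻¹ i + 1 → χ' i = 1 := by
    intro i m him hne
    have hm := m.2
    refine h0 i (by omega) ?_
    rw [blockSwap_inv_apply, blockSwap_inv_apply] at hne
    split_ifs at hne <;> omega
  refine eigenvector_mem_of_permGL hq (blockSwap n x a b h)
    (superdiagChar_eq_one_of_mem_negPart h3') (superdiagChar_conj ?_ ?_ h3') hN
  · intro j k hjk he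
    have hk := k.2
    rw [blockSwap_apply, blockSwap_apply] at he
    rw [blockSwap_apply]
    by_cases c1 : x ≤ (j : ℕ) ∧ (j : ℕ) < x + b
    · rw [if_pos c1] at he ⊢
      refine (h1 j c1.1 ?_).symm
      split_ifs at he <;> omega
    · rw [if_neg c1] at he ⊢
      by_cases c2 : x + b ≤ (j : ℕ) ∧ (j : ℕ) < x + b + a
      · rw [if_pos c2] at he ⊢
        by_cases c3 : (j : ℕ) + 1 < x + b + a
        · exact (h2 j c2.1 c3).symm
        · split_ifs at he <;> omega
      · rw [if_neg c2]
        exact (h3 j (by omega) (by omega)).symm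
  · intro j k hjk hlt hne
    have hk := k.2
    rw [Fin.lt_def, blockSwap_apply, blockSwap_apply] at hlt
    rw [blockSwap_apply, blockSwap_apply] at hne
    have : (j : ℕ) + 1 = x ∨ (j : ℕ) + 1 = x + a + b := by
      split_ifs at hlt hne <;> omega
    rw [h3 j (by omega) (by omega)]
    exact h0 j (by omega) (by omega)

end Moves

/-! ### Block sizes of a character, and the effect of exchanging, merging and splitting blocks. -/

section Types

/-- `k` is a partial sum of `l`. -/
def IsCut : List ℕ → ℕ → Prop
  | [], k => k = 0
  | a :: l, k => k = 0 ∨ (a ≤ k ∧ IsCut l (k - a))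

theorem isCut_zero (l : List ℕ) : IsCut l 0 := by
  cases l <;> simp [IsCut]

theorem isCut_sum (l : List ℕ) : IsCut l l.sum := by
  induction l with
  | nil => simp [IsCut]
  | cons a l ih => exact Or.inr ⟨by simp, by simpa using ih⟩

theorem IsCut.le_sum {l : List ℕ} {k : ℕ} (h : IsCut l k) : k ≤ l.sum := by
  induction l generalizing k with
  | nil => simpa [IsCut] using h
  | cons a l ih =>
    rcases h with h | ⟨h1, h2⟩
    · omega
    · have := ih h2; rw [List.sum_cons]; omega

theorem isCut_append {l1 l2 : List ℕ} {k : ℕ} :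
    IsCut (l1 ++ l2) k ↔ IsCut l1 k ∨ (l1.sum ≤ k ∧ IsCut l2 (k - l1.sum)) := by
  induction l1 generalizing k with
  | nil =>
    simp only [List.nil_append, List.sum_nil, Nat.sub_zero, IsCut, Nat.zero_le, true_and]
    constructor
    · exact Or.inr
    · rintro (rfl | h)
      · exact isCut_zero _
      · exact h
  | cons a l ih =>
    simp only [List.cons_append, IsCut, ih, List.sum_cons, Nat.sub_sub]
    constructor
    · rintro (h | ⟨h1, h2 | ⟨h2, h3⟩⟩)
      · exact Or.inl (Or.inl h)
      · exact Or.inl (Or.inr ⟨h1, h2⟩)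
      · exact Or.inr ⟨by omega, h3⟩
    · rintro ((h | ⟨h1, h2⟩) | ⟨h2, h3⟩)
      · exact Or.inl h
      · exact Or.inr ⟨h1, Or.inl h2⟩
      · exact Or.inr ⟨by omega, Or.inr ⟨by omega, h3⟩⟩

theorem isCut_append_of_le {l1 l2 : List ℕ} {k : ℕ} (h : k ≤ l1.sum) :
    IsCut (l1 ++ l2) k ↔ IsCut l1 k := by
  rw [isCut_append, or_iff_left_iff_imp]
  rintro ⟨h1, -⟩
  rw [le_antisymm h h1]; exact isCut_sum l1

theorem isCut_append_of_ge {l1 l2 : List ℕ} {k : ℕ} (h : l1.sum ≤ k) :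
    IsCut (l1 ++ l2) k ↔ IsCut l2 (k - l1.sum) := by
  rw [isCut_append, and_iff_right h, or_iff_right_iff_imp]
  intro h1
  rw [le_antisymm h1.le_sum h, Nat.sub_self]; exact isCut_zero l2

variable {F : Type*} [Field F] {A : Type*} [CommGroup A]

/-- The sequence `χ` is trivial exactly at the ends of the consecutive blocks of sizes `l`. -/
def HasType (n : ℕ) (l : List ℕ) (χ : ℕ → AddChar F A) : Prop :=
  ∀ k, k + 1 < n → (χ k = 1 ↔ IsCut l (k + 1))

theorem isCut_two_append {l1 l2 : List ℕ} {a b k : ℕ} (h : l1.sum < k)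
    (h2 : k < l1.sum + a + b) : IsCut (l1 ++ a :: b :: l2) k ↔ k = l1.sum + a := by
  rw [isCut_append_of_ge h.le]
  simp only [IsCut]
  constructor
  · rintro (h | ⟨h, h | ⟨h, -⟩⟩) <;> omega
  · intro h; omega

theorem isCut_one_append {l1 l2 : List ℕ} {a k : ℕ} (h : l1.sum < k)
    (h2 : k < l1.sum + a) : ¬ IsCut (l1 ++ a :: l2) k := by
  rw [isCut_append_of_ge h.le]
  simp only [IsCut]
  rintro (h | ⟨h, -⟩) <;> omega

theorem isCut_two_append_of_ge {l1 l2 : List ℕ} {a b k : ℕ} (h : l1.sum + a + b ≤ k) :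
    IsCut (l1 ++ a :: b :: l2) k ↔ IsCut l2 (k - (l1.sum + a + b)) := by
  rw [show l1 ++ a :: b :: l2 = (l1 ++ [a, b]) ++ l2 by simp, isCut_append_of_ge]
  · simp [add_assoc]
  · simpa [add_assoc] using h

theorem isCut_one_append_of_ge {l1 l2 : List ℕ} {a k : ℕ} (h : l1.sum + a ≤ k) :
    IsCut (l1 ++ a :: l2) k ↔ IsCut l2 (k - (l1.sum + a)) := by
  rw [show l1 ++ a :: l2 = (l1 ++ [a]) ++ l2 by simp, isCut_append_of_ge]
  · simp
  · simpa using h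

/-- The sequence of characters obtained from `χ` by exchanging the blocks `[x, x + a)` and
`[x + a, x + a + b)`, with the value `ρ` between the two new blocks. -/
def swapSeq (x a b : ℕ) (ρ : AddChar F A) (χ : ℕ → AddChar F A) (j : ℕ) : AddChar F A :=
  if j + 1 ≤ x then χ j else if j + 1 < x + b then χ (j + a) else if j + 1 = x + b then ρ
    else if j + 1 < x + a + b then χ (j - b) else χ j

theorem HasType.swapSeq_swap {n : ℕ} {l1 l2 : List ℕ} {a b : ℕ} (ha : 0 < a) (hb : 0 < b)
    {χ : ℕ → AddChar F A} (hn : l1.sum + a + b ≤ n)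
    (h : HasType n (l1 ++ a :: b :: l2) χ) :
    HasType n (l1 ++ b :: a :: l2) (swapSeq l1.sum a b 1 χ) := by
  intro k hk
  rw [swapSeq]
  split_ifs with c1 c2 c3 c4
  · rw [h k hk, isCut_append_of_le c1, isCut_append_of_le c1]
  · rw [h _ (by omega), isCut_two_append (by omega) (by omega),
      isCut_two_append (by omega) (by omega)]
    omega
  · rw [isCut_two_append (by omega) (by omega)]; simp [c3]
  · rw [h _ (by omega), isCut_two_append (by omega) (by omega),
      isCut_two_append (by omega) (by omega)]
    omega
  · rw [h _ (by omega), isCut_two_append_of_ge (by omega), isCut_two_append_of_ge (by omega)]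
    congr! 2; omega

theorem HasType.swapSeq_merge {n : ℕ} {l1 l2 : List ℕ} {a b : ℕ} (ha : 0 < a) (hb : 0 < b)
    {χ : ℕ → AddChar F A} (hn : l1.sum + a + b ≤ n) {ρ : AddChar F A} (hρ : ρ ≠ 1)
    (h : HasType n (l1 ++ a :: b :: l2) χ) :
    HasType n (l1 ++ (a + b) :: l2) (swapSeq l1.sum a b ρ χ) := by
  intro k hk
  rw [swapSeq]
  split_ifs with c1 c2 c3 c4
  · rw [h k hk, isCut_append_of_le c1, isCut_append_of_le c1]
  · rw [h _ (by omega), isCut_two_append (by omega) (by omega)]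
    exact iff_of_false (by omega) (isCut_one_append (by omega) (by omega))
  · exact iff_of_false hρ (isCut_one_append (by omega) (by omega))
  · rw [h _ (by omega), isCut_two_append (by omega) (by omega)]
    exact iff_of_false (by omega) (isCut_one_append (by omega) (by omega))
  · rw [h _ (by omega), isCut_two_append_of_ge (by omega), isCut_one_append_of_ge (by omega)]
    congr! 2; omega

theorem HasType.swapSeq_split {n : ℕ} {l1 l2 : List ℕ} {a b : ℕ} (ha : 0 < a) (hb : 0 < b)
    {χ : ℕ → AddChar F A} (hn : l1.sum + a + b ≤ n)
    (h : HasType n (l1 ++ (b + a) :: l2) χ) :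
    HasType n (l1 ++ a :: b :: l2) (swapSeq l1.sum b a 1 χ) := by
  intro k hk
  rw [swapSeq]
  split_ifs with c1 c2 c3 c4
  · rw [h k hk, isCut_append_of_le c1, isCut_append_of_le c1]
  · rw [h _ (by omega), isCut_two_append (by omega) (by omega)]
    exact iff_of_false (isCut_one_append (by omega) (by omega)) (by omega)
  · rw [isCut_two_append (by omega) (by omega)]; simp [c3]
  · rw [h _ (by omega), isCut_two_append (by omega) (by omega)]
    exact iff_of_false (isCut_one_append (by omega) (by omega)) (by omega)
  · rw [h _ (by omega), isCut_two_append_of_ge (by omega), isCut_one_append_of_ge (by omega)]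
    congr! 2; omega

section Reach

variable [Fintype F] [DecidableEq F] {R : Type*} [CommRing R]

/-- The value ρ sits at the unconstrained position: ρ = 1 exchanges the two blocks, and ρ ≠ 1 merges
them. -/
theorem HasType.eigenLE_swapSeq {n : ℕ} {l1 l2 : List ℕ} {a b : ℕ}
    (hq : IsUnit (Fintype.card F : R)) (ha : 0 < a) (hb : 0 < b)
    {χ : ℕ → AddChar F Rˣ} (hn : l1.sum + a + b ≤ n) (ρ : AddChar F Rˣ)
    (h : HasType n (l1 ++ a :: b :: l2) χ) : EigenLE n χ (swapSeq l1.sum a b ρ χ) := by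
  refine eigenLE_of_blockSwap hq ha hb hn ?_ ?_ ?_ ?_
  · rintro k hk (hx | hx | hx)
    · rw [h k hk, isCut_append_of_le hx.le, hx]; exact isCut_sum _
    · rw [h k hk, isCut_two_append (by omega) (by omega)]; exact hx
    · rw [h k hk, isCut_two_append_of_ge hx.ge, hx, Nat.sub_self]; exact isCut_zero _
  · intro j h1 h2
    rw [swapSeq, if_neg (by omega), if_pos h2]
  · intro j h1 h2
    rw [swapSeq, if_neg (by omega), if_neg (by omega), if_neg (by omega), if_pos (by omega)]
  · rintro j - (h1 | h1)
    · rw [swapSeq, if_pos h1]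
    · rw [swapSeq, if_neg (by omega), if_neg (by omega), if_neg (by omega), if_neg (by omega)]

/-- The unconstrained position is now in the interior of one block of χ. The final part of length a
and the initial part of length b are exchanged and separated, in the direction opposite to merging.
-/
theorem HasType.swapSeq_split_eigenLE {n : ℕ} {l1 l2 : List ℕ} {a b : ℕ}
    (hq : IsUnit (Fintype.card F : R)) (ha : 0 < a) (hb : 0 < b)
    {χ : ℕ → AddChar F Rˣ} (hn : l1.sum + a + b ≤ n)
    (h : HasType n (l1 ++ (b + a) :: l2) χ) : EigenLE n (swapSeq l1.sum b a 1 χ) χ := by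
  have h' := h.swapSeq_split ha hb hn
  refine eigenLE_of_blockSwap hq ha hb hn ?_ ?_ ?_ ?_
  · rintro k hk (hx | hx | hx)
    · rw [h' k hk, isCut_append_of_le hx.le, hx]; exact isCut_sum _
    · rw [h' k hk, isCut_two_append (by omega) (by omega)]; exact hx
    · rw [h' k hk, isCut_two_append_of_ge hx.ge, hx, Nat.sub_self]; exact isCut_zero _
  · intro j h1 h2
    rw [swapSeq, if_neg (by omega), if_neg (by omega), if_neg (by omega), if_pos (by omega),
      Nat.add_sub_cancel]
  · intro j h1 h2
    rw [swapSeq, if_neg (by omega), if_pos (by omega)]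
    congr 1; omega
  · rintro j - (h1 | h1)
    · rw [swapSeq, if_pos h1]
    · rw [swapSeq, if_neg (by omega), if_neg (by omega), if_neg (by omega), if_neg (by omega)]

end Reach

end Types

/-! ### Parabolic subgroups attached to characters and to compositions. -/

section Parabolic

variable {n : ℕ} {F : Type*} [Field F]

theorem blockSubgroup_coe {m : ℕ} (b : Fin n → Fin m) :
    (blockSubgroup b : Subgroup (GL (Fin n) F)) = blockSubgroup (fun i => (b i : ℕ)) := by
  ext g
  rw [mem_blockSubgroup, mem_blockSubgroup]
  simp only [Fin.lt_def]

theorem permGL_mem_blockSubgroup_iff {b : Fin n → ℕ} {π : Equiv.Perm (Fin n)} :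
    (permGL π : GL (Fin n) F) ∈ blockSubgroup b ↔ ∀ i, b (π i) = b i := by
  refine ⟨fun h => ?_, permGL_mem_blockSubgroup⟩
  have h4 : ∀ i, b (π i) ≤ b i := fun i => by
    by_contra h'
    have := mem_blockSubgroup.1 h (π i) i (not_le.1 h')
    rw [permGL_apply, if_pos rfl] at this
    exact one_ne_zero this
  have := (Finset.sum_eq_sum_iff_of_le (fun i (_ : i ∈ Finset.univ) => h4 i)).1
    (Equiv.sum_comp π b)
  exact fun i => this i (Finset.mem_univ i)

/-- By the Bruhat decomposition only permutation matrices matter, and a permutation that preserves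
the blocks is a product of adjacent transpositions inside them. -/
theorem parabolicOfSet_eq_blockSubgroup {b : Fin n → ℕ} (hb : Monotone b)
    {J : Set (Equiv.Perm (Fin n))} (hJ : ∀ τ, τ ∈ J ↔
      ∃ i j : Fin n, (i : ℕ) + 1 = j ∧ τ = Equiv.swap i j ∧ b i = b j) :
    parabolicOfSet F J = blockSubgroup b := by
  refine le_antisymm ((Subgroup.closure_le _).2 (Set.union_subset (borel_le_blockSubgroup hb) ?_)) ?_
  · rintro _ ⟨τ, hτ, rfl⟩
    obtain ⟨i, j, -, rfl, h⟩ := (hJ τ).1 hτ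
    refine permGL_mem_blockSubgroup fun k => ?_
    rw [Equiv.swap_apply_def]
    split_ifs with h1 h2
    · rw [h1, h]
    · rw [h2, h]
    · rfl
  · have hB : borel n F ≤ parabolicOfSet F J :=
      fun x hx => Subgroup.subset_closure (Or.inl hx)
    have hperm : ∀ σ : Equiv.Perm (Fin n), (∀ i, b (σ i) = b i) →
        permGL σ ∈ parabolicOfSet F J := by
      intro σ
      induction σ using perm_descent_induction with
      | h σ ih =>
      intro hσ
      by_cases h : ∃ i j : Fin n, (i : ℕ) + 1 = j ∧ σ j < σ i
      · obtain ⟨i, j, hij, hlt⟩ := h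
        -- A descent of a block-preserving permutation lies within one block, so removing it stays
        -- inside J.
        have hbij : b i = b j := by
          have h1 := hb (show i ≤ j by rw [Fin.le_def]; omega)
          have h2 := hb hlt.le
          rw [hσ, hσ] at h2
          exact le_antisymm h1 h2
        have e : σ = (σ * Equiv.swap i j) * Equiv.swap i j := by
          rw [mul_assoc, Equiv.swap_mul_self, mul_one]
        rw [e, permGL_mul]
        refine mul_mem (ih i j hij hlt fun k => ?_)
          (Subgroup.subset_closure (Or.inr ⟨_, (hJ _).2 ⟨i, j, hij, rfl, hbij⟩, rfl⟩))
        rw [Equiv.Perm.mul_apply, hσ, Equiv.swap_apply_def]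
        split_ifs with h1 h2
        · rw [h1, hbij]
        · rw [h2, hbij]
        · rfl
      · push Not at h
        rw [perm_eq_one_of_monotone σ fun i j hij => lt_of_le_of_ne (h i j hij)
          (σ.injective.ne (by rintro rfl; omega)), permGL_one]
        exact one_mem _
    intro g hg
    obtain ⟨u, hu, σ, β, hβ, rfl⟩ := exists_bruhat g
    refine mul_mem (mul_mem (hB (unitriangular_le_borel hu)) (hperm σ ?_)) (hB hβ)
    have hB' : borel n F ≤ blockSubgroup b := borel_le_blockSubgroup hb
    rw [Subgroup.mul_mem_cancel_right _ (hB' hβ),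
      Subgroup.mul_mem_cancel_left _ (hB' (unitriangular_le_borel hu))] at hg
    exact permGL_mem_blockSubgroup_iff.1 hg

/-- A lower transvection at (j, i) belongs to the group exactly when i and j share a block, so the
group determines the blocks. -/
theorem eq_iff_of_blockSubgroup_eq {b b' : Fin n → ℕ} (hb : Monotone b) (hb' : Monotone b')
    (h : (blockSubgroup b : Subgroup (GL (Fin n) F)) = blockSubgroup b') {i j : Fin n}
    (hij : i < j) : b i = b j ↔ b' i = b' j := by
  have key : ∀ {c : Fin n → ℕ}, Monotone c →
      ((transvectionGL j i hij.ne' (1 : F)) ∈ blockSubgroup c ↔ c i = c j) := by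
    intro c hc
    rw [mem_blockSubgroup]
    constructor
    · intro h
      by_contra hne
      have := h j i (lt_of_le_of_ne (hc hij.le) hne)
      rw [transvectionGL_apply] at this
      simp [hij.ne'] at this
    · intro h k l hkl
      rw [transvectionGL_apply, if_neg, if_neg, add_zero]
      · rintro ⟨rfl, rfl⟩; rw [h] at hkl; exact lt_irrefl _ hkl
      · rintro rfl; exact lt_irrefl _ hkl
  rw [← key hb, ← key hb', h]

variable {A : Type*} [CommGroup A]

open Classical in
/-- The number of blocks that end before the position `i`. -/
def blockIndex (χ : ℕ → AddChar F A) (i : Fin n) : ℕ :=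
  ((Finset.range i).filter fun k => χ k = 1).card

theorem blockIndex_monotone (χ : ℕ → AddChar F A) :
    Monotone (blockIndex χ : Fin n → ℕ) := fun _ _ hij =>
  Finset.card_le_card (Finset.filter_subset_filter _
    (Finset.range_subset_range.2 (Fin.le_def.1 hij)))

theorem blockIndex_eq_iff (χ : ℕ → AddChar F A) {i j : Fin n} (h : (i : ℕ) + 1 = j) :
    blockIndex χ i = blockIndex χ j ↔ χ i ≠ 1 := by
  classical
  rw [blockIndex, blockIndex, ← h, Finset.range_add_one, Finset.filter_insert]
  split_ifs with h1
  · rw [Finset.card_insert_of_notMem (by simp)]; simp [h1]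
  · simp [h1]

theorem mem_supportSet_superdiagChar (χ : ℕ → AddChar F A) (τ : Equiv.Perm (Fin n)) :
    τ ∈ supportSet (superdiagChar χ) ↔
      ∃ i j : Fin n, (i : ℕ) + 1 = j ∧ τ = Equiv.swap i j ∧ χ i ≠ 1 := by
  refine exists_congr fun i => exists_congr fun j => and_congr_right fun hij =>
    and_congr_right fun _ => ?_
  rw [exists_transvectionGL_iff χ hij]

theorem parabolicOfChar_superdiagChar (χ : ℕ → AddChar F A) :
    parabolicOfChar (superdiagChar χ : unitriangular n F →* A) = blockSubgroup (blockIndex χ) := by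
  refine parabolicOfSet_eq_blockSubgroup (blockIndex_monotone χ) fun τ => ?_
  rw [mem_supportSet_superdiagChar]
  refine exists_congr fun i => exists_congr fun j => and_congr_right fun hij => ?_
  rw [blockIndex_eq_iff χ hij]

theorem isCut_iff_exists_take {l : List ℕ} {k : ℕ} :
    IsCut l k ↔ ∃ m ≤ l.length, (l.take m).sum = k := by
  induction l generalizing k with
  | nil => simp [IsCut, eq_comm]
  | cons a l ih =>
    simp only [IsCut, ih]
    constructor
    · rintro (rfl | ⟨h, m, hm, h'⟩)
      · exact ⟨0, Nat.zero_le _, by simp⟩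
      · exact ⟨m + 1, by simpa using hm, by simp [h']; omega⟩
    · rintro ⟨m, hm, rfl⟩
      cases m with
      | zero => exact Or.inl (by simp)
      | succ m => exact Or.inr ⟨by simp, m, by simpa using hm, by simp⟩

theorem index_monotone (a : Composition n) : Monotone a.index := by
  intro i j hij
  by_contra h
  have h1 : (a.index j : ℕ) + 1 ≤ a.index i := Nat.succ_le_of_lt (Fin.lt_def.1 (not_le.1 h))
  have h2 := a.monotone_sizeUpTo h1
  have h3 := a.sizeUpTo_index_le i
  have h4 := a.lt_sizeUpTo_index_succ j
  rw [Fin.le_def] at hij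
  simp only [Fin.val_succ] at h4
  omega

theorem index_eq_iff (a : Composition n) {i j : Fin n} (h : (i : ℕ) + 1 = j) :
    a.index i = a.index j ↔ ¬ IsCut a.blocks (i + 1) := by
  have h1 := a.sizeUpTo_index_le i
  have h2 := a.lt_sizeUpTo_index_succ i
  have h3 := a.sizeUpTo_index_le j
  have h4 := a.lt_sizeUpTo_index_succ j
  simp only [Fin.val_succ] at h2 h4
  rw [isCut_iff_exists_take]
  constructor
  · rintro e ⟨m, -, hm⟩
    change a.sizeUpTo m = i + 1 at hm
    rw [e] at h1
    rcases le_or_gt m (a.index j) with h5 | h5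
    · have := a.monotone_sizeUpTo h5; omega
    · have := a.monotone_sizeUpTo (Nat.succ_le_of_lt h5)
      simp only [Nat.succ_eq_add_one] at this; omega
  · intro hc
    by_contra hne
    have h5 : a.index i < a.index j :=
      lt_of_le_of_ne (index_monotone a (by rw [Fin.le_def]; omega)) hne
    have h6 := a.monotone_sizeUpTo (Nat.succ_le_of_lt (Fin.lt_def.1 h5))
    simp only [Nat.succ_eq_add_one] at h6
    refine hc ⟨a.index i + 1, (a.index i).2, ?_⟩
    change a.sizeUpTo _ = _
    omega

theorem parabolicOfChar_eq_iff (χ : ℕ → AddChar F A) (a : Composition n) :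
    parabolicOfChar (superdiagChar χ : unitriangular n F →* A) = parabolicOfComposition F a ↔
      HasType n a.blocks χ := by
  rw [parabolicOfChar_superdiagChar, parabolicOfComposition, blockSubgroup_coe]
  have hm : Monotone fun i => (a.index i : ℕ) := fun i j h => Fin.le_def.1 (index_monotone a h)
  constructor
  · intro h k hk
    let i : Fin n := ⟨k, by omega⟩
    let j : Fin n := ⟨k + 1, hk⟩
    have hij : (i : ℕ) + 1 = j := rfl
    have h1 := eq_iff_of_blockSubgroup_eq (F := F) (blockIndex_monotone χ) hm h
      (show i < j by rw [Fin.lt_def]; omega)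
    rw [blockIndex_eq_iff χ hij] at h1
    simp only [Fin.val_inj] at h1
    rw [index_eq_iff a hij] at h1
    exact not_iff_not.1 h1
  · intro h
    rw [← parabolicOfChar_superdiagChar]
    refine parabolicOfSet_eq_blockSubgroup hm fun τ => ?_
    rw [mem_supportSet_superdiagChar]
    refine exists_congr fun i => exists_congr fun j => and_congr_right fun hij =>
      and_congr_right fun _ => ?_
    rw [Fin.val_inj, index_eq_iff a hij, ← h i (by have := j.2; omega)]

/-- A place where p holds divides the interval in two, and the two halves are treated recursively;
without such a place a single block suffices. -/
theorem exists_isCut_iff (p : ℕ → Prop) (n : ℕ) : ∃ l : List ℕ, l.sum = n ∧ (∀ a ∈ l, 0 < a) ∧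
    ∀ k, k + 1 < n → (p k ↔ IsCut l (k + 1)) := by
  induction n using Nat.strong_induction_on generalizing p with
  | _ n ih =>
  rcases Nat.eq_zero_or_pos n with rfl | hn
  · exact ⟨[], rfl, by simp, by simp⟩
  by_cases h : ∃ k, k + 1 < n ∧ p k
  · obtain ⟨k, hk, hp⟩ := h
    obtain ⟨l1, h1, h1', h1''⟩ := ih (k + 1) hk p
    obtain ⟨l2, h2, h2', h2''⟩ := ih (n - (k + 1)) (by omega) fun j => p (k + 1 + j)
    refine ⟨l1 ++ l2, by rw [List.sum_append]; omega, ?_, fun j hj => ?_⟩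
    · intro a ha
      rcases List.mem_append.1 ha with h | h
      · exact h1' a h
      · exact h2' a h
    · rcases lt_trichotomy j k with hjk | rfl | hjk
      · rw [isCut_append_of_le (by omega), h1'' j (by omega)]
      · rw [isCut_append_of_le h1.ge, ← h1]
        exact iff_of_true hp (isCut_sum _)
      · obtain ⟨m, rfl⟩ := Nat.exists_eq_add_of_le (Nat.succ_le_of_lt hjk)
        have := h2'' m (by simp only [Nat.succ_eq_add_one] at hj; omega)
        simp only [Nat.succ_eq_add_one]
        rw [isCut_append_of_ge (by omega), this, h1]
        congr! 1; omega
  · push Not at h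
    refine ⟨[n], by simp, by simpa using hn, fun k hk => iff_of_false (h k hk) ?_⟩
    simp only [IsCut]; omega

theorem exists_hasType (n : ℕ) (χ : ℕ → AddChar F A) :
    ∃ a : Composition n, HasType n a.blocks χ := by
  obtain ⟨l, h1, h2, h3⟩ := exists_isCut_iff (fun k => χ k = 1) n
  exact ⟨⟨l, fun h => h2 _ h, h1⟩, h3⟩

end Parabolic

/-! ### Values of the bilinear form on eigenvectors. -/

section Form

variable {n : ℕ} {F : Type*} [Field F] [Fintype F] [DecidableEq F] {R : Type*} [CommRing R]

theorem canonicalForm_comm (x y : GroupAlg n F R) :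
    canonicalForm n F R x y = canonicalForm n F R y x :=
  Finset.sum_congr rfl fun _ _ => mul_comm _ _

variable (n F R) in
/-- The canonical form as a bilinear map. -/
def canonicalBilin : GroupAlg n F R →ₗ[R] GroupAlg n F R →ₗ[R] R :=
  LinearMap.mk₂ R (canonicalForm n F R) (canonicalForm_add_left n F R)
    (fun a x y => canonicalForm_smul_left n F R a x y)
    (fun x y z => by
      rw [canonicalForm_comm, canonicalForm_add_left, canonicalForm_comm y,
        canonicalForm_comm z])
    (fun a x y => by
      rw [canonicalForm_comm, canonicalForm_smul_left, canonicalForm_comm y, smul_eq_mul])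

theorem canonicalBilin_apply (x y : GroupAlg n F R) :
    canonicalBilin n F R x y = canonicalForm n F R x y := rfl

theorem canonicalBilin_gs_mul (g : GL (Fin n) F) (x y : GroupAlg n F R) :
    canonicalBilin n F R (gs R g * x) y = canonicalBilin n F R x (gs R g⁻¹ * y) := by
  rw [canonicalBilin_apply, gs_eq, canonicalForm_single_mul, one_mul]; rfl

open Classical in
theorem canonicalBilin_gs_mul_hat (x : GroupAlg n F R) (g : GL (Fin n) F) :
    canonicalBilin n F R x (gs R g * hat n F R (borel n F)) =
      ∑ β : borel n F, x.coeff (g * β.1) := by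
  rw [canonicalBilin_apply, canonicalForm, ← Equiv.sum_comp (Equiv.mulLeft g)]
  simp only [Equiv.coe_mulLeft, coeff_gs_mul, inv_mul_cancel_left, coeff_hat, mul_ite, mul_one,
    mul_zero, SetLike.mem_coe]
  rw [← Finset.sum_filter]
  exact Finset.sum_subtype _ (by simp) _

theorem coeff_steinbergElement_mul_borel (g : GL (Fin n) F) {β : GL (Fin n) F}
    (hβ : β ∈ borel n F) :
    (steinbergElement n F R).coeff (g * β) = (steinbergElement n F R).coeff g := by
  classical
  simp only [steinbergElement_eq, MonoidAlgebra.coeff_sum, Finset.sum_apply',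
    MonoidAlgebra.coeff_smul_apply, coeff_gs_mul, coeff_hat, ← mul_assoc, SetLike.mem_coe,
    Subgroup.mul_mem_cancel_right _ hβ]

open Classical in
-- The generator is invariant under right multiplication by B, so pairing with σ B̂ gives |B| times
-- one coefficient. The two signs multiply to 1, which leaves a count of permutations.
theorem canonicalBilin_unipotent {u : GL (Fin n) F} (hu : u ∈ unitriangular n F) :
    canonicalBilin n F R (gs R u * steinbergElement n F R) (steinbergElement n F R) =
      Nat.card (borel n F) * ∑ σ : Equiv.Perm (Fin n), if u ∈ posPart F σ then 1 else 0 := by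
  conv_lhs => enter [2]; rw [steinbergElement_eq]
  rw [map_sum, Finset.mul_sum]
  refine Finset.sum_congr rfl fun σ _ => ?_
  rw [map_smul, canonicalBilin_gs_mul_hat]
  simp only [coeff_gs_mul, ← mul_assoc, coeff_steinbergElement_mul_borel _ (SetLike.coe_mem _)]
  rw [coeff_steinbergElement (inv_mem hu), Finset.sum_const, Finset.card_univ, nsmul_eq_mul,
    smul_eq_mul, Nat.card_eq_fintype_card]
  simp only [inv_mem_iff]
  split_ifs
  · linear_combination (Fintype.card (borel n F) : R) * sign_mul_self (R := R) σ
  · simp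

/-- The simple root subgroup at (i, i+1) lies in `posPart F σ` unless σ⁻¹ reverses i and i+1, in
which case the entry there vanishes. -/
theorem superdiagChar_eq_one_on_posPart_iff {A : Type*} [CommGroup A] (χ : ℕ → AddChar F A)
    (σ : Equiv.Perm (Fin n)) :
    (∀ u : unitriangular n F, u.1 ∈ posPart F σ → superdiagChar χ u = 1) ↔
      ∀ i j : Fin n, (i : ℕ) + 1 = j → χ i ≠ 1 → σ⁻¹ j < σ⁻¹ i := by
  constructor
  · intro h i j hij hχ
    by_contra hlt
    have hij' : i < j := by rw [Fin.lt_def]; omega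
    obtain ⟨t, ht⟩ := AddChar.ne_one_iff.1 hχ
    refine ht ?_
    rw [← superdiagChar_transvectionGL χ hij hij'.ne t (transvectionGL_mem_unitriangular hij' t)]
    refine h _ (mem_posPart.2 ⟨transvectionGL_mem_unitriangular hij' t, fun a b hab => ?_⟩)
    rw [transvectionGL_apply, if_neg, if_neg, add_zero]
    · rintro ⟨rfl, rfl⟩; exact hlt hab
    · rintro rfl; exact lt_irrefl _ hab
  · intro h u hu
    rw [superdiagChar_apply]
    refine Finset.prod_eq_one fun i _ => ?_
    by_cases hi : (i : ℕ) + 1 < n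
    · by_cases hχ : χ i = 1
      · rw [hχ, AddChar.one_apply]
      · rw [superdiag_eq (j := ⟨i + 1, hi⟩) _ rfl, (mem_posPart.1 hu).2 _ _ (h i _ rfl hχ),
          AddChar.map_zero_eq_one]
    · rw [superdiag, dif_neg hi, AddChar.map_zero_eq_one]

open Classical in
theorem sum_eq_ite_of_subgroup [IsDomain R] {G : Type*} [Group G] [Fintype G] (lam : G →* Rˣ)
    (H : Subgroup G) : (∑ u : G, if u ∈ H then (lam u : R) else 0) =
      if ∀ u ∈ H, lam u = 1 then (Nat.card H : R) else 0 := by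
  split_ifs with h
  · rw [← Finset.sum_filter, Finset.sum_congr rfl (g := fun _ => 1)]
    · rw [Finset.sum_const, nsmul_one, Nat.card_eq_fintype_card, Fintype.card_subtype]
    · intro u hu; rw [h u (by simpa using hu), Units.val_one]
  · push Not at h
    obtain ⟨v, hv, hne⟩ := h
    set S := ∑ u : G, if u ∈ H then (lam u : R) else 0 with hS
    have h1 : (lam v : R) * S = S := by
      rw [hS, Finset.mul_sum, ← Equiv.sum_comp (Equiv.mulLeft v)
        (fun u => if u ∈ H then (lam u : R) else 0)]
      refine Finset.sum_congr rfl fun u _ => ?_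
      simp only [Equiv.coe_mulLeft, Subgroup.mul_mem_cancel_left _ hv, map_mul, Units.val_mul,
        mul_ite, mul_zero]
    have h2 : ((lam v : R) - 1) * S = 0 := by rw [sub_mul, h1, one_mul, sub_self]
    rcases mul_eq_zero.1 h2 with h3 | h3
    · exact absurd (Units.ext (sub_eq_zero.1 h3)) hne
    · exact h3

/-- The index of the parabolic subgroup of the character with components `χ`. -/
def charIndex (n : ℕ) (χ : ℕ → AddChar F Rˣ) : ℕ :=
  (blockSubgroup (blockIndex χ) : Subgroup (GL (Fin n) F)).index

theorem charIndex_eq {a : Composition n} {χ : ℕ → AddChar F Rˣ} (h : HasType n a.blocks χ) :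
    charIndex n χ = (parabolicOfComposition F a).index := by
  rw [charIndex, ← parabolicOfChar_superdiagChar, (parabolicOfChar_eq_iff χ a).2 h]

theorem charIndex_ne_zero (χ : ℕ → AddChar F Rˣ) : charIndex n χ ≠ 0 := Subgroup.index_ne_zero_of_finite

/-- After interchanging the sums, the sum over u in `posPart F σ` of the character is its order or
0. The surviving σ are those that occur in `index_blockSubgroup_eq_sum_posPart`. -/
theorem canonicalBilin_eigenvector_steinbergElement [IsDomain R] (χ : ℕ → AddChar F Rˣ) :
    canonicalBilin n F R (eigenvector (superdiagChar (n := n) χ) : GroupAlg n F R)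
      (steinbergElement n F R) = Nat.card (borel n F) * charIndex n χ := by
  classical
  rw [coe_eigenvector, eigenProj_apply, map_sum, LinearMap.sum_apply]
  simp only [map_smul, LinearMap.smul_apply, canonicalBilin_unipotent (SetLike.coe_mem _)]
  rw [charIndex, index_blockSubgroup_eq_sum_posPart (blockIndex_monotone χ), Nat.cast_sum,
    Finset.mul_sum]
  simp only [smul_eq_mul, Finset.mul_sum]
  rw [Finset.sum_comm, Finset.sum_filter]
  refine Finset.sum_congr rfl fun σ _ => ?_
  have h1 : ∀ u : unitriangular n F, (superdiagChar χ u : R) *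
      ((Nat.card (borel n F) : R) * if u.1 ∈ posPart F σ then 1 else 0) =
      (Nat.card (borel n F) : R) * if u ∈ (posPart F σ).subgroupOf (unitriangular n F) then
        (superdiagChar χ u : R) else 0 := by
    intro u
    rw [Subgroup.mem_subgroupOf]
    split_ifs <;> ring
  simp only [h1]
  rw [← Finset.mul_sum, sum_eq_ite_of_subgroup,
    Nat.card_congr (Subgroup.subgroupOfEquivOfLe (posPart_le σ)).toEquiv]
  simp only [Subgroup.mem_subgroupOf]
  have h2 : (∀ i j : Fin n, (i : ℕ) + 1 = j → χ i ≠ 1 → σ⁻¹ j < σ⁻¹ i) ↔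
      ∀ i j : Fin n, (i : ℕ) + 1 = j → blockIndex χ i = blockIndex χ j → σ⁻¹ j < σ⁻¹ i :=
    forall_congr' fun i => forall_congr' fun j => forall_congr' fun hij => by
      rw [blockIndex_eq_iff χ hij]
  have h3 := (superdiagChar_eq_one_on_posPart_iff χ σ).trans h2
  by_cases h : ∀ i j : Fin n, (i : ℕ) + 1 = j → blockIndex χ i = blockIndex χ j → σ⁻¹ j < σ⁻¹ i
  · rw [if_pos (h3.2 h), if_pos h]
  · rw [if_neg (mt h3.1 h), if_neg h, mul_zero]

theorem card_unitriangular_ne_zero [CharZero R] : (Nat.card (unitriangular n F) : R) ≠ 0 :=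
  Nat.cast_ne_zero.2 Nat.card_pos.ne'

/-- The form is G-invariant, so E_λ pairs with each translate λ⁻¹(u) u y exactly as with y. -/
theorem card_smul_canonicalBilin_eigenvector (lam : unitriangular n F →* Rˣ)
    (y : GroupAlg n F R) :
    (Nat.card (unitriangular n F) : R) *
      canonicalBilin n F R (eigenvector lam : GroupAlg n F R) y =
    canonicalBilin n F R (eigenvector lam : GroupAlg n F R) (eigenProj lam⁻¹ y) := by
  classical
  rw [eigenProj_apply, map_sum]
  have h : ∀ u : unitriangular n F, canonicalBilin n F R (eigenvector lam : GroupAlg n F R)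
      ((lam⁻¹ u : R) • (gs R u.1 * y)) =
      canonicalBilin n F R (eigenvector lam : GroupAlg n F R) y := by
    intro u
    have h1 := gs_mul_eigenvector lam u⁻¹
    rw [map_smul, ← inv_inv (u : GL (Fin n) F), ← canonicalBilin_gs_mul, ← InvMemClass.coe_inv, h1,
      map_inv, inv_inv, Units.smul_def, map_smul, LinearMap.smul_apply, smul_smul,
      MonoidHom.inv_apply, Units.inv_mul, one_smul]
  simp only [h, Finset.sum_const, Finset.card_univ, nsmul_eq_mul, Nat.card_eq_fintype_card]

/-- The form pairs `E_λ` with `I` through the multiplicity of `E_{λ⁻¹}`. -/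
theorem canonicalBilin_eigenvector [IsDomain R] [CharZero R] (χ : ℕ → AddChar F Rˣ)
    {y : GroupAlg n F R} (hy : y ∈ lattice n F R) :
    canonicalBilin n F R (eigenvector (superdiagChar (n := n) χ) : GroupAlg n F R) y =
      leadCoeff R (eigenProj (superdiagChar χ⁻¹) y) * (Nat.card (borel n F) * charIndex n χ) := by
  apply mul_left_cancel₀ (card_unitriangular_ne_zero (n := n) (F := F) (R := R))
  rw [card_smul_canonicalBilin_eigenvector, superdiagChar_inv, eigenProj_eq_smul _ hy, map_smul,
    map_smul, leadCoeff_eigenvector, coe_eigenvector (superdiagChar χ⁻¹), ← superdiagChar_inv,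
    ← card_smul_canonicalBilin_eigenvector, canonicalBilin_eigenvector_steinbergElement]
  simp only [smul_eq_mul]
  ring

theorem mem_latticeFiltration [IsDomain R] [CharZero R] (ℓ c : ℕ) (x : lattice n F R) :
    x ∈ latticeFiltration n F R ℓ c ↔ ∀ y ∈ lattice n F R,
      (Nat.card (borel n F) : R) * (ℓ : R) ^ c ∣ canonicalBilin n F R (x : GroupAlg n F R) y := by
  have hB : (Nat.card (borel n F) : R) ≠ 0 := Nat.cast_ne_zero.2 Nat.card_pos.ne'
  have hB' : ((Nat.card (borel n F) : ℕ) : FractionRing R) ≠ 0 := by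
    rw [← map_natCast (algebraMap R (FractionRing R))]
    exact (map_ne_zero_iff _ (IsFractionRing.injective R (FractionRing R))).2 hB
  have key : ∀ (y : lattice n F R) (r : R),
      gowForm n F R x y = algebraMap R (FractionRing R) ((ℓ : R) ^ c * r) ↔
      canonicalBilin n F R (x : GroupAlg n F R) y =
        (Nat.card (borel n F) : R) * (ℓ : R) ^ c * r := by
    intro y r
    rw [gowForm, div_eq_iff hB', ← map_natCast (algebraMap R (FractionRing R)), ← map_mul,
      (IsFractionRing.injective R (FractionRing R)).eq_iff, canonicalBilin_apply]
    rw [mul_assoc (Nat.card (borel n F) : R), mul_comm (Nat.card (borel n F) : R)]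
  constructor
  · intro h y hy
    obtain ⟨r, hr⟩ := h ⟨y, hy⟩
    exact ⟨r, (key _ _).1 hr⟩
  · intro h y
    obtain ⟨r, hr⟩ := h y y.2
    exact ⟨r, (key _ _).2 hr⟩

theorem eigenvector_mem_latticeFiltration_iff [IsDomain R] [CharZero R] (ℓ c : ℕ)
    (χ : ℕ → AddChar F Rˣ) :
    eigenvector (superdiagChar χ) ∈ latticeFiltration n F R ℓ c ↔
      (ℓ : R) ^ c ∣ (charIndex n χ : R) := by
  have hB : (Nat.card (borel n F) : R) ≠ 0 := Nat.cast_ne_zero.2 Nat.card_pos.ne'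
  rw [mem_latticeFiltration]
  constructor
  · intro h
    have := h _ steinbergElement_mem_lattice
    rw [canonicalBilin_eigenvector_steinbergElement] at this
    exact (mul_dvd_mul_iff_left hB).1 this
  · intro h y hy
    rw [canonicalBilin_eigenvector χ hy]
    exact (mul_dvd_mul_left _ h).mul_left _

end Form

/-! ### Existence of eigenvectors of U in arbitrary modules. -/

section Mirabolic

variable {n : ℕ} {F : Type*} [Field F]

/-- Matrices in the upper left k × k block normalize the group of column k and act on it linearly,
hence on its characters by the transpose. -/
theorem mul_columnGL_eq {h : GL (Fin n) F} {k : Fin n}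
    (hrow : ∀ i j, k ≤ i → h.val i j = if i = j then 1 else 0)
    (hcol : ∀ i j, k ≤ j → h.val i j = if i = j then 1 else 0) (c : Fin n → F) :
    h * columnGL k c = columnGL k (h.val *ᵥ c) * h := by
  ext i j
  rw [mul_columnGL_apply, columnGL_mul_apply, hrow k j le_rfl]
  congr 1
  by_cases hj : j = k
  · subst hj
    rw [if_pos rfl, if_pos rfl]
    split_ifs with hi
    · rw [mul_one, Matrix.mulVec, dotProduct]
      refine Finset.sum_congr rfl fun m _ => ?_
      split_ifs with hm
      · rfl
      · rw [hcol i m (not_lt.1 hm), if_neg, zero_mul]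
        rintro rfl; exact hm hi
    · refine Finset.sum_eq_zero fun m _ => ?_
      split_ifs with hm
      · rw [hrow i m (not_lt.1 hi), if_neg, zero_mul]
        rintro rfl; exact hi hm
      · rfl
  · rw [if_neg hj, if_neg (Ne.symm hj)]; simp

theorem columnGL_neg (k : Fin n) (c : Fin n → F) : (columnGL k c)⁻¹ = columnGL k (-c) := by
  rw [inv_eq_iff_mul_eq_one, ← columnGL_add, add_neg_cancel, columnGL_zero]

theorem columnGL_congr {k : Fin n} {c d : Fin n → F} (h : ∀ i < k, c i = d i) :
    columnGL k c = columnGL k d := by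
  ext i j
  rw [columnGL_apply, columnGL_apply]
  congr 1
  split_ifs with h1
  · exact h i h1.2
  · rfl

/-- The lower unitriangular matrices that differ from the identity only in the row `k`. -/
def rowGL (k : Fin n) (r : Fin n → F) : GL (Fin n) F where
  val := (columnGL k r).valᵀ
  inv := (columnGL k r)⁻¹.valᵀ
  val_inv := by rw [← Matrix.transpose_mul, Units.inv_mul, Matrix.transpose_one]
  inv_val := by rw [← Matrix.transpose_mul, Units.mul_inv, Matrix.transpose_one]

theorem rowGL_apply (k : Fin n) (r : Fin n → F) (i j : Fin n) :
    (rowGL k r).val i j = (if i = j then 1 else 0) + if i = k ∧ j < k then r j else 0 := by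
  change (columnGL k r).val j i = _
  rw [columnGL_apply]
  simp only [eq_comm]

variable {A : Type*} [CommGroup A]

theorem superdiag_columnGL (k : Fin n) (c : Fin n → F) (i : Fin n) :
    superdiag (columnGL k c) i = if (i : ℕ) + 1 = k then c i else 0 := by
  by_cases hi : (i : ℕ) + 1 < n
  · rw [superdiag, dif_pos hi, columnGL_apply, if_neg, zero_add]
    · congr 1
      rw [Fin.ext_iff, Fin.lt_def]
      simp only [eq_iff_iff]
      omega
    · intro h; have := congrArg Fin.val h; simp at this
  · rw [superdiag, dif_neg hi, if_neg]
    have := k.2; omega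

theorem superdiagChar_columnGL {χ χ' : ℕ → AddChar F A} {k : Fin n} {c c' : Fin n → F}
    (h : ∀ i : Fin n, (i : ℕ) + 1 = k → χ i (c i) = χ' i (c' i)) :
    superdiagChar χ ⟨_, columnGL_mem k c⟩ = superdiagChar χ' ⟨_, columnGL_mem k c'⟩ := by
  rw [superdiagChar_apply, superdiagChar_apply]
  refine Finset.prod_congr rfl fun i _ => ?_
  simp only [superdiag_columnGL]
  split_ifs with hi
  · exact h i hi
  · rw [AddChar.map_zero_eq_one, AddChar.map_zero_eq_one]

variable [Fintype F] [DecidableEq F] {R : Type*} [CommRing R]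
  {V : Type*} [AddCommGroup V] [Module R V] [Module (GroupAlg n F R) V]
  [IsScalarTower R (GroupAlg n F R) V]

theorem gs_smul_smul (g h : GL (Fin n) F) (v : V) :
    gs R g • gs R h • v = gs R (g * h) • v := by
  rw [smul_smul, gs_mul]

/-- `w` is an eigenvector, with character `χ`, of the matrices that differ from the identity only
in one of the columns `k ≥ m`. -/
def ColumnEigen (m : ℕ) (χ : ℕ → AddChar F Rˣ) (w : V) : Prop :=
  ∀ (k : Fin n), m ≤ (k : ℕ) → ∀ c : Fin n → F,
    gs R (columnGL k c) • w = (superdiagChar χ ⟨_, columnGL_mem k c⟩ : R) • w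

/-- The rows from m on of h are trivial, so conjugation by h does not change the entries just above
the diagonal in the columns k > m, on which the character depends. -/
theorem ColumnEigen.gs_smul {m : ℕ} {χ : ℕ → AddChar F Rˣ} {w : V}
    (hw : ColumnEigen (n := n) (m + 1) χ w) {h : GL (Fin n) F}
    (hrow : ∀ i j : Fin n, m ≤ (i : ℕ) → h.val i j = if i = j then 1 else 0)
    (hcol : ∀ i j : Fin n, m + 1 ≤ (j : ℕ) → h.val i j = if i = j then 1 else 0) :
    ColumnEigen (n := n) (m + 1) χ (gs R h⁻¹ • w) := by
  intro k hk c
  have e : columnGL k c * h⁻¹ = h⁻¹ * columnGL k (h.val *ᵥ c) := by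
    rw [eq_inv_mul_iff_mul_eq, ← mul_assoc, mul_inv_eq_iff_eq_mul]
    exact mul_columnGL_eq (fun i j hi => hrow i j (by rw [Fin.le_def] at hi; omega))
      (fun i j hj => hcol i j (by rw [Fin.le_def] at hj; omega)) c
  rw [gs_smul_smul, e, ← gs_smul_smul, hw k hk, smul_comm]
  congr 2
  refine superdiagChar_columnGL fun i hi => ?_
  congr 1
  rw [Matrix.mulVec, dotProduct, Finset.sum_eq_single i]
  · rw [hrow i i (by omega), if_pos rfl, one_mul]
  · intro j _ hj; rw [hrow i j (by omega), if_neg hj.symm, zero_mul]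
  · simp

theorem columnGL_smul_gs_smul {ψ : AddChar F Rˣ} {k : Fin n} {d : Fin n → F} {w : V}
    (hw : ∀ c, gs R (columnGL k c) • w = (ψ (d ⬝ᵥ c) : R) • w) {h : GL (Fin n) F}
    (hrow : ∀ i j : Fin n, k ≤ i → h.val i j = if i = j then 1 else 0)
    (hcol : ∀ i j : Fin n, k ≤ j → h.val i j = if i = j then 1 else 0) (c : Fin n → F) :
    gs R (columnGL k c) • gs R h⁻¹ • w = (ψ ((d ᵥ* h.val) ⬝ᵥ c) : R) • gs R h⁻¹ • w := by
  have e : columnGL k c * h⁻¹ = h⁻¹ * columnGL k (h.val *ᵥ c) := by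
    rw [eq_inv_mul_iff_mul_eq, ← mul_assoc, mul_inv_eq_iff_eq_mul]
    exact mul_columnGL_eq hrow hcol c
  rw [gs_smul_smul, e, ← gs_smul_smul, hw, smul_comm, Matrix.dotProduct_mulVec]

theorem ColumnEigen.sum_smul {ι : Type*} {m : ℕ} {χ : ℕ → AddChar F Rˣ} (s : Finset ι)
    (a : ι → R) (w : ι → V) (hw : ∀ i, ColumnEigen (n := n) m χ (w i)) :
    ColumnEigen (n := n) m χ (∑ i ∈ s, a i • w i) := by
  intro k hk c
  rw [Finset.smul_sum, Finset.smul_sum]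
  refine Finset.sum_congr rfl fun i _ => ?_
  rw [smul_comm, hw i k hk c, smul_comm]

theorem sum_addChar_dotProduct [IsDomain R] {ψ : AddChar F Rˣ} (hψ : ψ ≠ 1) (c : Fin n → F) :
    ∑ d : Fin n → F, (ψ (d ⬝ᵥ c) : R) = if c = 0 then (Fintype.card F : R) ^ n else 0 := by
  split_ifs with hc
  · simp [hc]
  · obtain ⟨i, hi⟩ := Function.ne_iff.1 hc
    obtain ⟨t, ht⟩ := AddChar.ne_one_iff.1 hψ
    set S := ∑ d : Fin n → F, (ψ (d ⬝ᵥ c) : R) with hS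
    have h1 : (ψ t : R) * S = S := by
      rw [hS, Finset.mul_sum, ← Equiv.sum_comp (Equiv.addLeft (Pi.single i (t / c i)))
        (fun d => (ψ (d ⬝ᵥ c) : R))]
      refine Finset.sum_congr rfl fun d _ => ?_
      rw [Equiv.coe_addLeft, add_dotProduct, single_dotProduct, AddChar.map_add_eq_mul,
        Units.val_mul, div_mul_cancel₀ _ hi]
    have h2 : ((ψ t : R) - 1) * S = 0 := by rw [sub_mul, h1, one_mul, sub_self]
    rcases mul_eq_zero.1 h2 with h3 | h3
    · exact absurd (Units.ext (sub_eq_zero.1 h3)) ht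
    · exact h3

theorem exists_columnGL_eigenvector [IsDomain R] (hq : IsUnit (Fintype.card F : R))
    {ψ : AddChar F Rˣ} (hψ : ψ ≠ 1) (N : Submodule (GroupAlg n F R) V) {k : Fin n}
    {χ : ℕ → AddChar F Rˣ} {w : V} (hw : w ∈ N) (h0 : w ≠ 0)
    (hc : ColumnEigen (n := n) ((k : ℕ) + 1) χ w) :
    ∃ w' ∈ N, w' ≠ 0 ∧ ColumnEigen (n := n) ((k : ℕ) + 1) χ w' ∧ ∃ d : Fin n → F,
      ∀ c, gs R (columnGL k c) • w' = (ψ (d ⬝ᵥ c) : R) • w' := by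
  -- Fourier components of w for the column group. They sum to q^n w, which is nonzero because q is
  -- a unit, so some component does not vanish.
  let W : (Fin n → F) → V := fun d => ∑ c, (ψ (d ⬝ᵥ -c) : R) • gs R (columnGL k c) • w
  have hsum : ∑ d, W d = (Fintype.card F : R) ^ n • w := by
    simp only [W]
    rw [Finset.sum_comm]
    simp only [← Finset.sum_smul, sum_addChar_dotProduct hψ, neg_eq_zero, ite_smul, zero_smul]
    rw [Finset.sum_ite_eq', if_pos (Finset.mem_univ _), columnGL_zero, gs_one, one_smul]
  obtain ⟨d, hd⟩ : ∃ d, W d ≠ 0 := by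
    by_contra! h
    simp only [h, Finset.sum_const_zero] at hsum
    obtain ⟨c, hc⟩ := hq.pow n
    rw [← hc] at hsum
    refine h0 ?_
    rw [← one_smul R w, ← Units.inv_mul c, mul_smul, ← hsum, smul_zero]
  refine ⟨W d, ?_, hd, ?_, d, fun c => ?_⟩
  · exact sum_mem fun c _ => N.smul_of_tower_mem _ (N.smul_mem _ hw)
  · refine ColumnEigen.sum_smul _ _ _ fun c => ?_
    rw [← inv_inv (columnGL k c)]
    refine hc.gs_smul (fun i j hi => ?_) (fun i j hj => ?_)
    · rw [columnGL_neg, columnGL_apply, add_eq_left, if_neg]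
      intro h
      have := Fin.lt_def.1 h.2; omega
    · rw [columnGL_neg, columnGL_apply, add_eq_left, if_neg]
      intro h
      have := Fin.ext_iff.1 h.1; omega
  · simp only [W]
    rw [Finset.smul_sum, Finset.smul_sum, ← Equiv.sum_comp (Equiv.addLeft c)
      (fun c' => (ψ (d ⬝ᵥ c) : R) • (ψ (d ⬝ᵥ -c') : R) • gs R (columnGL k c') • w)]
    refine Finset.sum_congr rfl fun c' _ => ?_
    rw [smul_comm, gs_smul_smul, ← columnGL_add, Equiv.coe_addLeft, smul_smul, ← Units.val_mul,
      ← AddChar.map_add_eq_mul, ← dotProduct_add, neg_add, add_neg_cancel_left]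

/-- A Fourier component makes column m act through some ψ(d · c). A linear change of the first m
coordinates, which leaves the later columns' characters intact, makes d vanish below coordinate m -
1, and then only the superdiagonal entry of column m is seen. -/
theorem exists_columnEigen_of_succ [IsDomain R] (hq : IsUnit (Fintype.card F : R))
    {ψ : AddChar F Rˣ} (hψ : ψ ≠ 1) (N : Submodule (GroupAlg n F R) V) {m : ℕ}
    (h : ∃ χ : ℕ → AddChar F Rˣ, ∃ w ∈ N, w ≠ 0 ∧ ColumnEigen (n := n) (m + 1) χ w) :
    ∃ χ : ℕ → AddChar F Rˣ, ∃ w ∈ N, w ≠ 0 ∧ ColumnEigen (n := n) m χ w := by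
  obtain ⟨χ, w, hw, h0, hc⟩ := h
  by_cases hm : m < n
  swap
  · exact ⟨χ, w, hw, h0, fun k hk => absurd k.2 (by omega)⟩
  rcases Nat.eq_zero_or_pos m with rfl | hm0
  · refine ⟨χ, w, hw, h0, fun k hk c => ?_⟩
    rcases hk.eq_or_lt with hk' | hk'
    · have h1 : columnGL k c = columnGL k 0 := columnGL_congr fun i hi => by
        rw [Fin.lt_def] at hi; omega
      have h2 : superdiagChar χ ⟨_, columnGL_mem k c⟩ = 1 := by
        rw [← map_one (superdiagChar χ)]
        exact congrArg _ (Subtype.ext (h1.trans (columnGL_zero k)))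
      rw [h2, h1, columnGL_zero, gs_one, one_smul, Units.val_one, one_smul]
    · exact hc k hk' c
  let k : Fin n := ⟨m, hm⟩
  let j0 : Fin n := ⟨m - 1, by omega⟩
  have hj0 : j0 < k := by rw [Fin.lt_def]; simp only [k, j0]; omega
  have hlt : ∀ i : Fin n, i < k → i ≠ j0 → i < j0 := fun i hi hne => by
    rw [Fin.lt_def] at hi ⊢; rw [Ne, Fin.ext_iff] at hne; simp only [k, j0] at hi hne ⊢; omega
  suffices h : ∃ w' ∈ N, w' ≠ 0 ∧ ColumnEigen (n := n) (m + 1) χ w' ∧ ∃ d : Fin n → F,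
      (∀ i, i < j0 → d i = 0) ∧
      ∀ c, gs R (columnGL k c) • w' = (ψ (d ⬝ᵥ c) : R) • w' by
    obtain ⟨w', hw', h0', hc', d, hd, hdc⟩ := h
    refine ⟨Function.update χ (m - 1) (AddChar.mulShift ψ (d j0)), w', hw', h0',
      fun k' hk' c => ?_⟩
    rcases hk'.eq_or_lt with hk'' | hk''
    · obtain rfl : k = k' := Fin.ext hk''
      -- The coordinates of d from k on are arbitrary, but those of c do not affect the matrix and
      -- may be set to 0.
      have e : columnGL k c = columnGL k fun i => if i < k then c i else 0 :=
        columnGL_congr fun i hi => by rw [if_pos hi]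
      have e1 : (d ⬝ᵥ fun i => if i < k then c i else 0) = d j0 * c j0 := by
        rw [dotProduct, Finset.sum_eq_single j0]
        · rw [if_pos hj0]
        · intro i _ hi
          split_ifs with hik
          · rw [hd i (hlt i hik hi), zero_mul]
          · rw [mul_zero]
        · simp
      have e2 := hdc fun i => if i < k then c i else 0
      rw [← e, e1] at e2
      rw [e2]
      congr 2
      rw [superdiagChar_apply, Finset.prod_eq_single j0]
      · rw [superdiag_columnGL, if_pos (by simp only [k, j0]; omega)]
        simp [j0, AddChar.mulShift_apply]
      · intro i _ hi
        rw [superdiag_columnGL, if_neg, AddChar.map_zero_eq_one]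
        intro h; refine hi (Fin.ext ?_); simp only [k, j0] at h ⊢; omega
      · simp
    · rw [hc' k' hk'' c]
      congr 2
      refine superdiagChar_columnGL fun i hi => ?_
      rw [Function.update_of_ne (by omega)]
  obtain ⟨w', hw', h0', hc', d, hdc⟩ := exists_columnGL_eigenvector hq hψ N (k := k) hw h0 hc
  by_cases hd : ∀ i, i < k → d i = 0
  · exact ⟨w', hw', h0', hc', d, fun i hi => hd i (hi.trans hj0), hdc⟩
  push Not at hd
  obtain ⟨i0, hi0, hdi⟩ := hd
  have hne : ∀ (h : GL (Fin n) F) (v : V), v ≠ 0 → gs R h⁻¹ • v ≠ 0 := fun h v hv h' => by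
    apply hv
    have := congrArg (fun z => gs R h • z) h'
    simpa only [gs_smul_smul, mul_inv_cancel, gs_one, one_smul, smul_zero] using this
  -- First a nonzero coordinate of d is brought to the position j0; then the row operation `h2` uses
  -- it to eliminate the coordinates before j0.
  let h1 : GL (Fin n) F := permGL (Equiv.swap i0 j0)
  have hfix : ∀ j, k ≤ j → Equiv.swap i0 j0 j = j := fun j hj =>
    Equiv.swap_apply_of_ne_of_ne (hi0.trans_le hj).ne' (hj0.trans_le hj).ne'
  have hh1 : ∀ i j : Fin n, k ≤ j → h1.val i j = if i = j then 1 else 0 := fun i j hj => by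
    rw [permGL_apply, hfix j hj]
  have hh1' : ∀ i j : Fin n, k ≤ i → h1.val i j = if i = j then 1 else 0 := fun i j hi => by
    rw [permGL_apply]
    refine if_congr ?_ rfl rfl
    constructor
    · intro h; rw [← hfix i hi, h, Equiv.swap_apply_self]
    · rintro rfl; exact (hfix i hi).symm
  let d1 : Fin n → F := d ᵥ* h1.val
  have hd1 : d1 j0 ≠ 0 := by
    simp only [d1, h1, Matrix.vecMul, dotProduct, permGL_apply, mul_ite, mul_one, mul_zero,
      Finset.sum_ite_eq', Finset.mem_univ, if_true, Equiv.swap_apply_right]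
    exact hdi
  let h2 : GL (Fin n) F := rowGL j0 fun i => - d1 i / d1 j0
  have hh2 : ∀ i j : Fin n, k ≤ j → h2.val i j = if i = j then 1 else 0 := fun i j hj => by
    rw [rowGL_apply, add_eq_left, if_neg]
    intro h
    exact lt_asymm (h.2.trans hj0) (lt_of_le_of_ne hj (by rintro rfl; exact lt_asymm h.2 hj0))
  have hh2' : ∀ i j : Fin n, k ≤ i → h2.val i j = if i = j then 1 else 0 := fun i j hi => by
    rw [rowGL_apply, add_eq_left, if_neg]
    intro h
    rw [h.1] at hi; exact not_lt_of_ge hi hj0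
  have hle : ∀ i : Fin n, m + 1 ≤ (i : ℕ) → k ≤ i := fun i hi => by
    rw [Fin.le_def]; simp only [k]; omega
  refine ⟨gs R h2⁻¹ • gs R h1⁻¹ • w', N.smul_mem _ (N.smul_mem _ hw'), hne _ _ (hne _ _ h0'),
    (hc'.gs_smul (fun i j hi => hh1' i j hi) (fun i j hj => hh1 i j (hle j hj))).gs_smul
      (fun i j hi => hh2' i j hi) (fun i j hj => hh2 i j (hle j hj)), d1 ᵥ* h2.val, ?_,
    columnGL_smul_gs_smul (columnGL_smul_gs_smul hdc hh1' hh1) hh2' hh2⟩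
  intro i hi
  simp only [h2, Matrix.vecMul, dotProduct, rowGL_apply, mul_add, mul_ite, mul_one, mul_zero,
    Finset.sum_add_distrib, Finset.sum_ite_eq', Finset.mem_univ, if_true, hi, and_true]
  field_simp
  ring

/-- A nonzero module contains an eigenvector of the unitriangular group. -/
theorem exists_unitriangular_eigenvector [IsDomain R] (hq : IsUnit (Fintype.card F : R))
    {ψ : AddChar F Rˣ} (hψ : ψ ≠ 1) {N : Submodule (GroupAlg n F R) V} (hN : N ≠ ⊥) :
    ∃ χ : ℕ → AddChar F Rˣ, ∃ w ∈ N, w ≠ 0 ∧ ∀ u : unitriangular n F,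
      gs R u.1 • w = (superdiagChar χ u : R) • w := by
  have key : ∀ i, i ≤ n → ∃ χ : ℕ → AddChar F Rˣ, ∃ w ∈ N, w ≠ 0 ∧
      ColumnEigen (n := n) (n - i) χ w := by
    intro i
    induction i with
    | zero =>
      intro _
      obtain ⟨w, hw, h0⟩ := Submodule.exists_mem_ne_zero_of_ne_bot hN
      exact ⟨1, w, hw, h0, fun k hk => absurd k.2 (by omega)⟩
    | succ i ih =>
      intro hi
      refine exists_columnEigen_of_succ hq hψ N ?_
      rw [show n - (i + 1) + 1 = n - i by omega]
      exact ih (by omega)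
  obtain ⟨χ, w, hw, h0, hc⟩ := key n le_rfl
  rw [Nat.sub_self] at hc
  refine ⟨χ, w, hw, h0, ?_⟩
  let H : Subgroup (unitriangular n F) :=
    { carrier := {u | gs R u.1 • w = (superdiagChar χ u : R) • w}
      one_mem' := by simp [gs_one]
      mul_mem' := fun {u v} hu hv => by
        simp only [Set.mem_ofPred_eq] at hu hv ⊢
        rw [Subgroup.coe_mul, ← gs_smul_smul, hv, smul_comm, hu, smul_smul, map_mul,
          Units.val_mul, mul_comm]
      inv_mem' := fun {u} hu => by
        simp only [Set.mem_ofPred_eq] at hu ⊢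
        have h1 : gs R u⁻¹.1 • gs R u.1 • w = w := by
          rw [gs_smul_smul, InvMemClass.coe_inv, inv_mul_cancel, gs_one, one_smul]
        rw [hu, smul_comm] at h1
        rw [map_inv, ← one_smul R (gs R u⁻¹.1 • w), ← Units.inv_mul (superdiagChar χ u),
          mul_smul, h1] }
  have hH : unitriangular n F ≤ H.map (unitriangular n F).subtype :=
    unitriangular_le_of_columnGL fun k c => ⟨⟨_, columnGL_mem k c⟩, hc k (Nat.zero_le _) c, rfl⟩
  intro u
  obtain ⟨v, hv, e⟩ := hH u.2
  obtain rfl : v = u := Subtype.ext e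
  exact hv

end Mirabolic

/-! ### The coefficient ring: additive characters and ℓ-adic valuations. -/

section Setting

/-- `R` is a local domain whose maximal ideal is generated by a prime `ℓ` that does not divide
`|F|`, and `R` has a nontrivial character of the additive group of `F`. -/
structure IsModularSetting (F R : Type*) [Field F] [Fintype F] [CommRing R] [IsLocalRing R]
    (ℓ : ℕ) : Prop where
  prime : ℓ.Prime
  maximalIdeal_eq : IsLocalRing.maximalIdeal R = Ideal.span {(ℓ : R)}
  not_dvd : ¬ ℓ ∣ Fintype.card F
  exists_addChar : ∃ ψ : AddChar F Rˣ, ψ ≠ 1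

/-- The character is ζ raised to the trace to the prime field; the trace form of a finite field is
nonzero. -/
theorem exists_addChar_ne_one {p : ℕ} (hp : p.Prime) (F : Type*) [Field F] [Fintype F]
    [CharP F p] {R : Type*} [CommRing R] {ζ : R} (hζ : IsPrimitiveRoot ζ p) :
    ∃ ψ : AddChar F Rˣ, ψ ≠ 1 := by
  have : Fact p.Prime := ⟨hp⟩
  let _ : Algebra (ZMod p) F := ZMod.algebra _ _
  have hu : IsPrimitiveRoot (hζ.isUnit hp.ne_zero).unit p :=
    IsPrimitiveRoot.coe_units_iff.1 (by simpa using hζ)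
  have hz := AddChar.zmodChar_primitive_of_primitive_root p hζ
  refine ⟨(AddChar.zmodChar p hu.pow_eq_one).compAddMonoidHom
    (Algebra.trace (ZMod p) F).toAddMonoidHom, ?_⟩
  obtain ⟨a, ha⟩ : ∃ a, Algebra.trace (ZMod p) F a ≠ 0 := by
    by_contra! h
    exact Algebra.trace_ne_zero (ZMod p) F (LinearMap.ext h)
  refine AddChar.ne_one_iff.2 ⟨a, fun h => ha ?_⟩
  change (hζ.isUnit hp.ne_zero).unit ^ (Algebra.trace (ZMod p) F a).val = 1 at h
  have h1 := (hu.pow_eq_one_iff_dvd _).1 h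
  exact (ZMod.val_eq_zero _).1 (Nat.eq_zero_of_dvd_of_lt h1 (ZMod.val_lt _))

variable {F R : Type*} [Field F] [Fintype F] [CommRing R] [IsLocalRing R] {ℓ : ℕ}

namespace IsModularSetting

variable (S : IsModularSetting F R ℓ)
include S

theorem not_isUnit_iff (r : R) : ¬ IsUnit r ↔ (ℓ : R) ∣ r := by
  rw [← Ideal.mem_span_singleton, ← S.maximalIdeal_eq, IsLocalRing.mem_maximalIdeal,
    mem_nonunits_iff]

theorem isUnit_natCast {m : ℕ} (h : ¬ ℓ ∣ m) : IsUnit (m : R) := by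
  by_contra hu
  have h1 := (S.not_isUnit_iff _).1 hu
  have h2 : ¬ IsUnit (ℓ : R) := (S.not_isUnit_iff _).2 dvd_rfl
  have hc : IsCoprime (ℓ : ℤ) (m : ℤ) := Nat.isCoprime_iff_coprime.2
    ((Nat.Prime.coprime_iff_not_dvd S.prime).2 h)
  obtain ⟨a, b, e⟩ := hc
  have e' : (a : R) * ℓ + b * m = 1 := by exact_mod_cast congrArg (Int.cast : ℤ → R) e
  refine h2 (isUnit_of_dvd_one ?_)
  rw [← e']
  exact dvd_add (Dvd.intro_left _ rfl) (h1.mul_left _)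

theorem isUnit_card : IsUnit (Fintype.card F : R) := S.isUnit_natCast S.not_dvd

theorem exists_natCast_eq {m : ℕ} (hm : m ≠ 0) :
    ∃ u : R, IsUnit u ∧ (m : R) = (ℓ : R) ^ padicValNat ℓ m * u := by
  have := Fact.mk S.prime
  obtain ⟨k, hk⟩ : ℓ ^ padicValNat ℓ m ∣ m := pow_padicValNat_dvd
  refine ⟨k, S.isUnit_natCast fun h => ?_, by exact_mod_cast congrArg (Nat.cast : ℕ → R) hk⟩
  have : ℓ ^ (padicValNat ℓ m + 1) ∣ m := by
    conv_rhs => rw [hk]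
    rw [pow_succ]; exact mul_dvd_mul_left _ h
  rw [padicValNat_dvd_iff_le hm] at this
  omega

variable [IsDomain R] [CharZero R]

theorem pow_dvd_natCast_iff {m c : ℕ} (hm : m ≠ 0) :
    (ℓ : R) ^ c ∣ (m : R) ↔ c ≤ padicValNat ℓ m := by
  obtain ⟨u, hu, e⟩ := S.exists_natCast_eq hm
  rw [e, hu.dvd_mul_right, pow_dvd_pow_iff (Nat.cast_ne_zero.2 S.prime.ne_zero)
    ((S.not_isUnit_iff _).2 dvd_rfl)]

theorem pow_succ_dvd_mul_natCast_iff {m : ℕ} (hm : m ≠ 0) (r : R) :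
    (ℓ : R) ^ (padicValNat ℓ m + 1) ∣ r * (m : R) ↔ (ℓ : R) ∣ r := by
  obtain ⟨u, hu, e⟩ := S.exists_natCast_eq hm
  rw [e, mul_left_comm, pow_succ, mul_dvd_mul_iff_left
    (pow_ne_zero _ (Nat.cast_ne_zero.2 S.prime.ne_zero)), hu.dvd_mul_right]

end IsModularSetting

end Setting

/-! ### Submodules of L are governed by eigenvectors and duality. -/

section Submodules

variable {n : ℕ} {F : Type*} [Field F] [Fintype F] [DecidableEq F] {R : Type*} [CommRing R]

/-- The diagonal matrix with entries `1, -1, 1, …`. -/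
def alternatingDiag (n : ℕ) (F : Type*) [Field F] : GL (Fin n) F := diagGL fun i => (-1) ^ (i : ℕ)

/-- Conjugation by this diagonal matrix negates every superdiagonal entry, hence inverts the
character, while the generator is fixed by diagonal matrices. So the form may pair E_λ with E_{λ⁻¹}
without leaving a submodule. -/
theorem gs_alternatingDiag_mul_eigenvector (χ : ℕ → AddChar F Rˣ) :
    gs R (alternatingDiag n F) * (eigenvector (superdiagChar (n := n) χ) : GroupAlg n F R) =
      (eigenvector (superdiagChar (n := n) χ⁻¹) : GroupAlg n F R) := by
  classical
  set t := alternatingDiag n F with ht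
  let f : unitriangular n F → unitriangular n F := fun u =>
    ⟨t * u.1 * t⁻¹, diagGL_conj_mem_unitriangular _ u.2⟩
  have hinj : Function.Injective f := fun u v h => by
    have := congrArg Subtype.val h
    exact Subtype.ext (mul_left_cancel (mul_right_cancel this))
  have hbij : Function.Bijective f := Finite.injective_iff_bijective.1 hinj
  rw [coe_eigenvector, coe_eigenvector, eigenProj_apply, eigenProj_apply, Finset.mul_sum,
    ← hbij.sum_comp
      (fun u => (superdiagChar χ⁻¹ u : R) • (gs R u.1 * steinbergElement n F R))]
  refine Finset.sum_congr rfl fun u _ => ?_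
  have h1 : superdiagChar χ⁻¹ (f u) = superdiagChar χ u := by
    rw [superdiagChar_apply, superdiagChar_apply]
    refine Finset.prod_congr rfl fun i _ => ?_
    by_cases hi : (i : ℕ) + 1 < n
    · rw [superdiag, superdiag, dif_pos hi, dif_pos hi]
      simp only [f, ht, alternatingDiag, diagGL_inv, mul_diagGL_apply, diagGL_mul_apply]
      rw [Pi.inv_apply, AddChar.inv_apply]
      congr 1
      simp only [Pi.inv_apply, pow_succ]
      rcases neg_one_pow_eq_or Fˣ (i : ℕ) with h | h <;> simp [h]
    · rw [superdiag, superdiag, dif_neg hi, dif_neg hi, AddChar.map_zero_eq_one,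
        AddChar.map_zero_eq_one]
  rw [h1, mul_smul_comm]
  congr 1
  have h2 : gs R t * steinbergElement n F R = steinbergElement n F R :=
    gs_diagGL_mul_steinbergElement _
  conv_rhs => rw [← h2]
  rw [← mul_assoc, ← mul_assoc, ← gs_mul, ← gs_mul]
  simp only [f, inv_mul_cancel_right]

theorem eigenvector_inv_mem {χ : ℕ → AddChar F Rˣ}
    {M : Submodule (GroupAlg n F R) (lattice n F R)} (h : eigenvector (superdiagChar χ) ∈ M) :
    eigenvector (superdiagChar χ⁻¹) ∈ M := by
  have e : (eigenvector (superdiagChar χ⁻¹) : lattice n F R) =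
      gs R (alternatingDiag n F) • eigenvector (superdiagChar χ) :=
    Subtype.ext (gs_alternatingDiag_mul_eigenvector χ).symm
  rw [e]
  exact M.smul_mem _ h

theorem eigenvector_inv_mem_iff {χ : ℕ → AddChar F Rˣ}
    {M : Submodule (GroupAlg n F R) (lattice n F R)} :
    eigenvector (superdiagChar χ⁻¹) ∈ M ↔ eigenvector (superdiagChar χ) ∈ M :=
  ⟨fun h => by
    have h1 := eigenvector_inv_mem h
    have e : χ⁻¹⁻¹ = χ := funext fun i => inv_inv (χ i)
    rwa [e] at h1, eigenvector_inv_mem⟩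

theorem exists_coe_eq_eigenProj (lam : unitriangular n F →* Rˣ)
    {M : Submodule (GroupAlg n F R) (lattice n F R)} {y : lattice n F R} (hy : y ∈ M) :
    ∃ z ∈ M, (z : GroupAlg n F R) = eigenProj lam y := by
  classical
  refine ⟨∑ u : unitriangular n F, (lam u : R) • gs R u.1 • y,
    sum_mem fun u _ => M.smul_of_tower_mem _ (M.smul_mem _ hy), ?_⟩
  rw [eigenProj_apply, Submodule.coe_sum]
  rfl

theorem eigenvector_mem_of_isUnit {lam : unitriangular n F →* Rˣ}
    {M : Submodule (GroupAlg n F R) (lattice n F R)} {y : lattice n F R} (hy : y ∈ M)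
    (h : IsUnit (leadCoeff R (eigenProj lam (y : GroupAlg n F R)))) : eigenvector lam ∈ M := by
  obtain ⟨z, hz, e⟩ := exists_coe_eq_eigenProj lam hy
  rw [eigenProj_eq_smul lam y.2] at e
  obtain ⟨c, hc⟩ := h
  rw [← hc] at e
  have e' : eigenvector lam = (↑c⁻¹ : R) • z := by
    refine Subtype.ext ?_
    rw [Submodule.coe_smul_of_tower, e, smul_smul, Units.inv_mul, one_smul]
  rw [e']
  exact M.smul_of_tower_mem _ hz

theorem eigenProj_eigenvector (lam : unitriangular n F →* Rˣ) :
    eigenProj lam (eigenvector lam : GroupAlg n F R) =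
      (Nat.card (unitriangular n F) : R) • (eigenvector lam : GroupAlg n F R) := by
  classical
  rw [eigenProj_apply]
  simp only [gs_mul_eigenvector, Units.smul_def, smul_smul, Units.mul_inv, one_smul]
  rw [Finset.sum_const, Finset.card_univ, ← Nat.cast_smul_eq_nsmul R, Nat.card_eq_fintype_card]

theorem leadCoeff_eigenProj_eigenvector (lam : unitriangular n F →* Rˣ) :
    leadCoeff R (eigenProj lam (eigenvector lam : GroupAlg n F R)) =
      Nat.card (unitriangular n F) := by
  rw [eigenProj_eigenvector, map_smul, leadCoeff_eigenvector, smul_eq_mul, mul_one]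

/-- The preimage in `I` of a submodule of `L`. -/
def pullback {ℓ : ℕ} (N : Submodule (GroupAlg n F (ResField R ℓ)) (reduction n F R ℓ)) :
    Submodule (GroupAlg n F R) (lattice n F R) where
  carrier := {x | toReduction n F R ℓ x ∈ N}
  zero_mem' := by simp
  add_mem' := fun {x y} hx hy => by
    simp only [Set.mem_ofPred_eq, map_add] at hx hy ⊢
    exact add_mem hx hy
  smul_mem' := fun r x hx => by
    simp only [Set.mem_ofPred_eq] at hx ⊢
    rw [map_smul, ← redHom_smul]
    exact N.smul_mem _ hx

theorem mem_pullback {ℓ : ℕ} {N : Submodule (GroupAlg n F (ResField R ℓ)) (reduction n F R ℓ)}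
    {x : lattice n F R} : x ∈ pullback N ↔ toReduction n F R ℓ x ∈ N := Iff.rfl

/-- The image of an eigenvector in `L`. -/
def redVec (n : ℕ) (ℓ : ℕ) (χ : ℕ → AddChar F Rˣ) : reduction n F R ℓ :=
  toReduction n F R ℓ (eigenvector (superdiagChar χ))

theorem EigenLE.redVec_mem {χ χ' : ℕ → AddChar F Rˣ} (h : EigenLE n χ' χ) {ℓ : ℕ}
    {N : Submodule (GroupAlg n F (ResField R ℓ)) (reduction n F R ℓ)} (hN : redVec n ℓ χ ∈ N) :
    redVec n ℓ χ' ∈ N := h (pullback N) hN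

section Perp

variable [IsDomain R]

/-- The elements of `I(i)` that pair with `M` into `ℓ^(i+1) R`. -/
def perp (ℓ i : ℕ) (M : Submodule (GroupAlg n F R) (lattice n F R)) :
    Submodule (GroupAlg n F R) (lattice n F R) where
  carrier := {x | x ∈ latticeFiltration n F R ℓ i ∧ ∀ y ∈ M,
    (Nat.card (borel n F) : R) * (ℓ : R) ^ (i + 1) ∣
      canonicalBilin n F R (x : GroupAlg n F R) (y : GroupAlg n F R)}
  zero_mem' := ⟨zero_mem _, by simp⟩
  add_mem' := fun {x x'} hx hx' => ⟨add_mem hx.1 hx'.1, fun y hy => by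
    rw [Submodule.coe_add, map_add, LinearMap.add_apply]
    exact dvd_add (hx.2 y hy) (hx'.2 y hy)⟩
  smul_mem' := fun r x hx => ⟨Submodule.smul_mem _ _ hx.1, by
    induction r using MonoidAlgebra.induction_linear with
    | zero => simp
    | add s t hs ht =>
      intro y hy
      rw [add_smul, Submodule.coe_add, map_add, LinearMap.add_apply]
      exact dvd_add (hs y hy) (ht y hy)
    | single g a =>
      intro y hy
      have := hx.2 _ (M.smul_mem (MonoidAlgebra.single g⁻¹ (1 : R)) hy)
      rw [canonicalBilin_apply] at this ⊢
      rw [Submodule.coe_smul, smul_eq_mul, canonicalForm_single_mul]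
      exact this.mul_left a⟩

end Perp

variable [IsDomain R] [CharZero R] [IsLocalRing R] {ℓ : ℕ} (S : IsModularSetting F R ℓ)

include S

theorem isUnit_card_unitriangular : IsUnit (Nat.card (unitriangular n F) : R) := by
  rw [card_unitriangular]; push_cast; exact S.isUnit_card.pow _

/-- An element of M congruent to E_χ modulo ℓ has a projection whose leading coefficient is
congruent to |U|, a unit. Dividing by it recovers E_χ in M, so for eigenvectors reduction loses
nothing. -/
theorem redVec_mem_reduceSubmodule_iff {M : Submodule (GroupAlg n F R) (lattice n F R)}
    {χ : ℕ → AddChar F Rˣ} :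
    redVec n ℓ χ ∈ reduceSubmodule n F R ℓ M ↔ eigenvector (superdiagChar χ) ∈ M := by
  refine ⟨fun h => ?_, fun h => ⟨_, h, rfl⟩⟩
  obtain ⟨x, hx, e⟩ := h
  have h0 : toReduction n F R ℓ (eigenvector (superdiagChar χ) - x) = 0 := by
    rw [map_sub, e]; exact sub_self _
  obtain ⟨z, hz⟩ := (toReduction_eq_zero n F R ℓ _).1 h0
  refine eigenvector_mem_of_isUnit hx ?_
  have h1 : (x : GroupAlg n F R) = (eigenvector (superdiagChar (n := n) χ) : GroupAlg n F R) -
      (ℓ : R) • (z : GroupAlg n F R) := by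
    have := congrArg Subtype.val hz
    rw [Submodule.coe_sub, Submodule.coe_smul_of_tower] at this
    rw [Nat.cast_smul_eq_nsmul, ← this]; abel
  rw [h1, map_sub, map_sub, leadCoeff_eigenProj_eigenvector, map_smul, map_smul, smul_eq_mul]
  by_contra hu
  rw [S.not_isUnit_iff, dvd_sub_left (Dvd.intro _ rfl), ← S.not_isUnit_iff] at hu
  exact hu (isUnit_card_unitriangular S)

theorem redVec_mem_filtration_iff {c : ℕ} {χ : ℕ → AddChar F Rˣ} :
    redVec n ℓ χ ∈ filtration n F R ℓ c ↔ c ≤ padicValNat ℓ (charIndex n χ) := by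
  rw [filtration, redVec_mem_reduceSubmodule_iff S, eigenvector_mem_latticeFiltration_iff,
    S.pow_dvd_natCast_iff (charIndex_ne_zero χ)]

/-- For valuation i, the pairing of E_χ with M lies in ℓ^(i+1) exactly when no element of M has a
unit coefficient along E_{χ⁻¹}, that is, when M omits this vector. For larger valuation the
condition is automatic. -/
theorem eigenvector_mem_perp_iff {i : ℕ} {M : Submodule (GroupAlg n F R) (lattice n F R)}
    {χ : ℕ → AddChar F Rˣ} : eigenvector (superdiagChar χ) ∈ perp ℓ i M ↔
      i ≤ padicValNat ℓ (charIndex n χ) ∧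
        (padicValNat ℓ (charIndex n χ) = i → eigenvector (superdiagChar χ) ∉ M) := by
  have hB : (Nat.card (borel n F) : R) ≠ 0 := Nat.cast_ne_zero.2 Nat.card_pos.ne'
  have key : ∀ y : lattice n F R, (Nat.card (borel n F) : R) * (ℓ : R) ^ (i + 1) ∣
      canonicalBilin n F R (eigenvector (superdiagChar (n := n) χ) : GroupAlg n F R) y ↔
      (ℓ : R) ^ (i + 1) ∣ leadCoeff R (eigenProj (superdiagChar χ⁻¹) (y : GroupAlg n F R)) *
        charIndex n χ := by
    intro y
    rw [canonicalBilin_eigenvector χ y.2, mul_left_comm, mul_dvd_mul_iff_left hB]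
  change _ ∧ _ ↔ _
  rw [eigenvector_mem_latticeFiltration_iff, S.pow_dvd_natCast_iff (charIndex_ne_zero χ)]
  refine and_congr_right fun hi => ?_
  simp only [key]
  constructor
  · rintro h rfl hM
    have := h _ (eigenvector_inv_mem hM)
    rw [S.pow_succ_dvd_mul_natCast_iff (charIndex_ne_zero χ), leadCoeff_eigenProj_eigenvector,
      ← S.not_isUnit_iff] at this
    exact this (isUnit_card_unitriangular S)
  · intro h y hy
    rcases hi.eq_or_lt with rfl | hlt
    · rw [S.pow_succ_dvd_mul_natCast_iff (charIndex_ne_zero χ), ← S.not_isUnit_iff]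
      intro hu
      exact h rfl (eigenvector_inv_mem_iff.1 (eigenvector_mem_of_isUnit hy hu))
    · exact ((S.pow_dvd_natCast_iff (charIndex_ne_zero χ)).2 hlt).mul_left _

/-- A submodule of `L` has a complement between consecutive terms of the filtration. -/
theorem exists_complement (i : ℕ)
    (N : Submodule (GroupAlg n F (ResField R ℓ)) (reduction n F R ℓ)) :
    ∃ N' : Submodule (GroupAlg n F (ResField R ℓ)) (reduction n F R ℓ),
      ∀ χ : ℕ → AddChar F Rˣ, redVec n ℓ χ ∈ N' ↔ i ≤ padicValNat ℓ (charIndex n χ) ∧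
        (padicValNat ℓ (charIndex n χ) = i → redVec n ℓ χ ∉ N) :=
  ⟨reduceSubmodule n F R ℓ (perp ℓ i (pullback N)), fun χ => by
    rw [redVec_mem_reduceSubmodule_iff S, eigenvector_mem_perp_iff S, mem_pullback]; rfl⟩

/-- The submodules of `L` are determined by the eigenvectors `E_λ` that they contain. -/
theorem le_of_redVec {N N' : Submodule (GroupAlg n F (ResField R ℓ)) (reduction n F R ℓ)}
    (h : ∀ χ : ℕ → AddChar F Rˣ, redVec n ℓ χ ∈ N' → redVec n ℓ χ ∈ N) : N' ≤ N := by
  classical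
  intro v hv
  obtain ⟨x, rfl⟩ := toReduction_surjective n F R ℓ v
  by_contra hx
  let M := pullback N
  -- The image of N' in the quotient by N, taken in I, contains an eigenvector of U. Projecting a
  -- lift back to I gives a multiple of some E_χ that is not in the preimage of N.
  have hne : (pullback N').map M.mkQ ≠ ⊥ := by
    intro hbot
    have : M.mkQ x ∈ (pullback N').map M.mkQ := ⟨x, hv, rfl⟩
    rw [hbot, Submodule.mem_bot, Submodule.mkQ_apply, Submodule.Quotient.mk_eq_zero] at this
    exact hx this
  obtain ⟨ψ, hψ⟩ := S.exists_addChar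
  obtain ⟨χ, w, ⟨y, hy, rfl⟩, hw0, hw⟩ :=
    exists_unitriangular_eigenvector S.isUnit_card hψ hne
  obtain ⟨z, hz, e⟩ := exists_coe_eq_eigenProj (superdiagChar χ⁻¹) hy
  have hz' : z = ∑ u : unitriangular n F, (superdiagChar χ⁻¹ u : R) • gs R u.1 • y := by
    refine Subtype.ext ?_
    rw [e, eigenProj_apply, Submodule.coe_sum]
    rfl
  have h1 : M.mkQ z = (Nat.card (unitriangular n F) : R) • M.mkQ y := by
    have h2 : ∀ u : unitriangular n F, M.mkQ ((superdiagChar χ⁻¹ u : R) • gs R u.1 • y) =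
        M.mkQ y := by
      intro u
      change (superdiagChar χ⁻¹ u : R) • M.mkQ (gs R u.1 • y) = _
      rw [map_smul, hw u, smul_smul, ← superdiagChar_inv, MonoidHom.inv_apply, Units.inv_mul,
        one_smul]
    rw [hz', map_sum]
    simp only [h2, Finset.sum_const, Finset.card_univ]
    rw [← Nat.cast_smul_eq_nsmul R, Nat.card_eq_fintype_card]
  have h3 : z ∉ M := by
    intro hzM
    have h4 : M.mkQ z = 0 := by
      rw [Submodule.mkQ_apply]; exact (Submodule.Quotient.mk_eq_zero M).2 hzM
    obtain ⟨c, hc⟩ := isUnit_card_unitriangular (n := n) S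
    rw [h1, ← hc] at h4
    refine hw0 ?_
    rw [← one_smul R (M.mkQ y), ← Units.inv_mul c, mul_smul, h4, smul_zero]
  rw [eigenProj_eq_smul _ y.2] at e
  have e' : z = leadCoeff R (eigenProj (superdiagChar χ⁻¹) (y : GroupAlg n F R)) •
      eigenvector (superdiagChar χ⁻¹) := Subtype.ext e
  -- With a unit coefficient, the eigenvector itself lies in N', hence in N by hypothesis; otherwise
  -- ℓ divides the coefficient and the projection vanishes in L. Both contradict the choice of z.
  by_cases hu : IsUnit (leadCoeff R (eigenProj (superdiagChar χ⁻¹) (y : GroupAlg n F R)))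
  · have h4 : eigenvector (superdiagChar χ⁻¹) ∈ pullback N' := eigenvector_mem_of_isUnit hy hu
    have h5 : eigenvector (superdiagChar χ⁻¹) ∈ M := h χ⁻¹ h4
    rw [e'] at h3
    exact h3 (M.smul_of_tower_mem _ h5)
  · obtain ⟨r, hr⟩ := (S.not_isUnit_iff _).1 hu
    refine h3 ?_
    change toReduction n F R ℓ z ∈ N
    have h6 : toReduction n F R ℓ z = 0 := by
      rw [toReduction_eq_zero]
      exact ⟨r • eigenvector (superdiagChar χ⁻¹), by
        rw [e', hr, mul_smul, Nat.cast_smul_eq_nsmul]⟩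
    rw [h6]; exact zero_mem N

end Submodules

/-! ### The radicals of the terms of the filtration. -/

section Radical

theorem map_jacobson_le_of_covBy {A M : Type*} [Ring A] [AddCommGroup M] [Module A M]
    {N m : Submodule A M} (h : m ⋖ N) : (Module.jacobson A N).map N.subtype ≤ m := by
  let m' : Submodule A N := m.comap N.subtype
  have hm' : m'.map N.subtype = m := by
    rw [Submodule.map_comap_subtype, inf_eq_right]; exact h.le
  have hco : IsCoatom m' := by
    rw [← (Submodule.mapIic N).isCoatom_iff, Set.Iic.isCoatom_iff]
    rwa [Submodule.coe_mapIic_apply, hm']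
  rw [← hm']
  exact Submodule.map_mono (sInf_le hco)

theorem le_map_jacobson {A M : Type*} [Ring A] [AddCommGroup M] [Module A M]
    {N W : Submodule A M} (hW : W ≤ N) (h : ∀ m, m ⋖ N → W ≤ m) :
    W ≤ (Module.jacobson A N).map N.subtype := by
  have hW' : (W.comap N.subtype).map N.subtype = W := by
    rw [Submodule.map_comap_subtype, inf_eq_right]; exact hW
  rw [← hW']
  refine Submodule.map_mono (le_sInf fun m hm => ?_)
  have hm : IsCoatom m := hm
  rw [← (Submodule.mapIic N).isCoatom_iff, Set.Iic.isCoatom_iff, Submodule.coe_mapIic_apply] at hm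
  have h1 := h _ hm
  intro x hx
  obtain ⟨y, hy, e⟩ := h1 hx
  rwa [← Subtype.ext (a1 := y) (a2 := x) e]

variable {n : ℕ} {F : Type*} [Field F] [Fintype F] [DecidableEq F] {R : Type*} [CommRing R]
  [IsDomain R] [CharZero R] [IsLocalRing R] {ℓ : ℕ} (S : IsModularSetting F R ℓ)

include S

/-- Two eigenvectors in the same layer of the filtration generate the same submodule as soon as
one of them lies in the submodule generated by the other. -/
theorem redVec_mem_of_eigenLE {χ χ' : ℕ → AddChar F Rˣ} (h : EigenLE n χ' χ)
    (hν : padicValNat ℓ (charIndex n χ') = padicValNat ℓ (charIndex n χ))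
    {N : Submodule (GroupAlg n F (ResField R ℓ)) (reduction n F R ℓ)}
    (hN : redVec n ℓ χ' ∈ N) : redVec n ℓ χ ∈ N := by
  by_contra hχ
  -- If N omitted E_χ, its complement would contain E_χ and therefore E_χ', although N contains E_χ'
  -- in the same layer.
  obtain ⟨N', hN'⟩ := exists_complement S (padicValNat ℓ (charIndex n χ)) N
  exact ((hN' χ').1 (h.redVec_mem ((hN' χ).2 ⟨le_rfl, fun _ => hχ⟩))).2 hν hN

/-- The projections of the two summands have leading coefficients that add up to the unit |U|, and R
is local, so one of them is a unit. -/
theorem redVec_mem_sup {χ : ℕ → AddChar F Rˣ}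
    {N N' : Submodule (GroupAlg n F (ResField R ℓ)) (reduction n F R ℓ)}
    (h : redVec n ℓ χ ∈ N ⊔ N') : redVec n ℓ χ ∈ N ∨ redVec n ℓ χ ∈ N' := by
  obtain ⟨v, hv, v', hv', e⟩ := Submodule.mem_sup.1 h
  obtain ⟨x, rfl⟩ := toReduction_surjective n F R ℓ v
  obtain ⟨x', rfl⟩ := toReduction_surjective n F R ℓ v'
  have h1 : eigenvector (superdiagChar χ) ∈
      Submodule.span (GroupAlg n F R) {x + x'} := by
    rw [← redVec_mem_reduceSubmodule_iff S]
    exact ⟨x + x', Submodule.subset_span rfl, by rw [map_add]; exact e⟩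
  have h2 : eigenvector (superdiagChar χ) ∈ pullback N ⊔ pullback N' := by
    refine (Submodule.span_le.2 ?_) h1
    rintro _ rfl
    exact add_mem (Submodule.mem_sup_left hv) (Submodule.mem_sup_right hv')
  obtain ⟨y, hy, y', hy', e'⟩ := Submodule.mem_sup.1 h2
  have h3 : leadCoeff R (eigenProj (superdiagChar χ) (y : GroupAlg n F R)) +
      leadCoeff R (eigenProj (superdiagChar χ) (y' : GroupAlg n F R)) =
      Nat.card (unitriangular n F) := by
    rw [← leadCoeff_eigenProj_eigenvector (superdiagChar χ), ← e', Submodule.coe_add, map_add,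
      map_add]
  have h4 := isUnit_card_unitriangular (n := n) S
  rw [← h3] at h4
  rcases IsLocalRing.isUnit_or_isUnit_of_isUnit_add h4 with h5 | h5
  · exact Or.inl (eigenvector_mem_of_isUnit hy h5)
  · exact Or.inr (eigenvector_mem_of_isUnit hy' h5)

theorem filtration_zero : filtration n F R ℓ 0 = ⊤ :=
  top_le_iff.1 (le_of_redVec S fun _ _ => (redVec_mem_filtration_iff S).2 (Nat.zero_le _))

theorem filtration_antitone : Antitone (filtration n F R ℓ) := fun _ _ h =>
  le_of_redVec S fun _ hχ => (redVec_mem_filtration_iff S).2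
    (h.trans ((redVec_mem_filtration_iff S).1 hχ))

/-- The maximal submodule is the complement, at level i, of the submodule W generated by E_χ.
Anything strictly larger meets W in an eigenvector of this layer, which by duality forces it to
contain E_χ and so all of W. -/
theorem exists_covBy_filtration {i : ℕ} {χ : ℕ → AddChar F Rˣ}
    (hχ : padicValNat ℓ (charIndex n χ) = i) :
    ∃ m, m ⋖ filtration n F R ℓ i ∧ redVec n ℓ χ ∉ m := by
  let W : Submodule (GroupAlg n F (ResField R ℓ)) (reduction n F R ℓ) :=
    Submodule.span _ {redVec n ℓ χ}
  have hW : redVec n ℓ χ ∈ W := Submodule.subset_span rfl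
  obtain ⟨m, hm⟩ := exists_complement S i W
  have hχm : redVec n ℓ χ ∉ m := fun h => ((hm χ).1 h).2 hχ hW
  have hmle : m ≤ filtration n F R ℓ i :=
    le_of_redVec S fun μ hμ => (redVec_mem_filtration_iff S).2 ((hm μ).1 hμ).1
  refine ⟨m, ⟨lt_of_le_of_ne hmle ?_, fun t hmt hti => ?_⟩, hχm⟩
  · rintro rfl
    exact hχm ((redVec_mem_filtration_iff S).2 hχ.ge)
  · obtain ⟨μ, hμt, hμm⟩ : ∃ μ : ℕ → AddChar F Rˣ, redVec n ℓ μ ∈ t ∧ redVec n ℓ μ ∉ m := by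
      by_contra! h
      exact hmt.not_ge (le_of_redVec S h)
    have hμi : i ≤ padicValNat ℓ (charIndex n μ) := (redVec_mem_filtration_iff S).1 (hti.le hμt)
    rw [hm μ] at hμm
    simp only [hμi, true_and, not_forall, not_not] at hμm
    obtain ⟨hμ, hμW⟩ := hμm
    obtain ⟨t', ht'⟩ := exists_complement S i t
    have hχt : redVec n ℓ χ ∈ t := by
      by_contra hχt
      have h1 : redVec n ℓ χ ∈ t' := (ht' χ).2 ⟨hχ.ge, fun _ => hχt⟩
      have h2 : W ≤ t' := (Submodule.span_singleton_le_iff_mem _ _).2 h1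
      exact ((ht' μ).1 (h2 hμW)).2 hμ hμt
    refine hti.not_ge (le_of_redVec S fun κ hκ => ?_)
    by_cases hκm : redVec n ℓ κ ∈ m
    · exact hmt.le hκm
    · rw [hm κ] at hκm
      simp only [(redVec_mem_filtration_iff S).1 hκ, true_and, not_forall, not_not] at hκm
      exact (Submodule.span_singleton_le_iff_mem _ _).2 hχt hκm.2

-- The layer of valuation exactly c generates L(c). This generation property is isolated here as a
-- hypothesis; for d = 1 it follows from `filtration_le_of_starCompositions`.
variable (hT : ∀ (N : Submodule (GroupAlg n F (ResField R ℓ)) (reduction n F R ℓ)) (c : ℕ),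
  (∀ χ : ℕ → AddChar F Rˣ, padicValNat ℓ (charIndex n χ) = c → redVec n ℓ χ ∈ N) →
    filtration n F R ℓ c ≤ N)

include hT

theorem map_jacobson_filtration (i : ℕ) :
    (Module.jacobson (GroupAlg n F (ResField R ℓ)) (filtration n F R ℓ i)).map
      (filtration n F R ℓ i).subtype = filtration n F R ℓ (i + 1) := by
  refine le_antisymm (le_of_redVec S fun χ hχ => ?_)
    (le_map_jacobson (filtration_antitone S (Nat.le_succ i)) fun m hm => ?_)
  · have h1 : redVec n ℓ χ ∈ filtration n F R ℓ i := Submodule.map_subtype_le _ _ hχ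
    rw [redVec_mem_filtration_iff S] at h1 ⊢
    rcases h1.eq_or_lt with h2 | h2
    · obtain ⟨m, hm, hm'⟩ := exists_covBy_filtration S h2.symm
      exact absurd (map_jacobson_le_of_covBy hm hχ) hm'
    · exact h2
  · by_contra hle
    -- A maximal submodule m not containing L(i+1) together with it spans L(i). By `redVec_mem_sup`
    -- each E_χ of valuation i then lies in m, so `hT` gives L(i) ≤ m.
    have h1 : m ⊔ filtration n F R ℓ (i + 1) = filtration n F R ℓ i := by
      refine (hm.eq_or_eq le_sup_left
        (sup_le hm.le (filtration_antitone S (Nat.le_succ i)))).resolve_left fun h => hle ?_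
      rw [← h]; exact le_sup_right
    refine hm.lt.not_ge (hT m i fun χ hχ => ?_)
    have h2 : redVec n ℓ χ ∈ m ⊔ filtration n F R ℓ (i + 1) := by
      rw [h1, redVec_mem_filtration_iff S, hχ]
    rcases redVec_mem_sup S h2 with h3 | h3
    · exact h3
    · rw [redVec_mem_filtration_iff S] at h3; omega

theorem radicalSeries_eq_filtration (i : ℕ) :
    radicalSeries (GroupAlg n F (ResField R ℓ)) (reduction n F R ℓ) i = filtration n F R ℓ i := by
  induction i with
  | zero => rw [radicalSeries, filtration_zero S]
  | succ i ih => rw [radicalSeries, ih, map_jacobson_filtration S hT]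

theorem exists_radicalSeries :
    ∃ r : ℕ, StrictAntiOn (radicalSeries (GroupAlg n F (ResField R ℓ)) (reduction n F R ℓ))
        (Set.Iic r) ∧
      radicalSeries (GroupAlg n F (ResField R ℓ)) (reduction n F R ℓ) r = ⊥ ∧
      Set.range (filtration n F R ℓ) =
        radicalSeries (GroupAlg n F (ResField R ℓ)) (reduction n F R ℓ) '' Set.Iic r := by
  have hrad : radicalSeries (GroupAlg n F (ResField R ℓ)) (reduction n F R ℓ) =
      filtration n F R ℓ := funext (radicalSeries_eq_filtration S hT)
  have hbot : ∃ r, filtration n F R ℓ r = ⊥ := by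
    -- Every index [G : P] divides [G : B], so no eigenvector has valuation this large.
    refine ⟨padicValNat ℓ (borel n F).index + 1, le_bot_iff.1 (le_of_redVec S fun χ hχ => ?_)⟩
    rw [redVec_mem_filtration_iff S] at hχ
    have := Fact.mk S.prime
    have h1 : charIndex n χ ∣ (borel n F).index :=
      Subgroup.index_dvd_of_le (borel_le_blockSubgroup (blockIndex_monotone χ))
    have h2 := (padicValNat_dvd_iff_le (p := ℓ) (Subgroup.index_ne_zero_of_finite
      (H := borel n F))).1 (pow_padicValNat_dvd.trans h1)
    omega
  classical
  have hspec := Nat.find_spec hbot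
  have hmin : ∀ {m}, m < Nat.find hbot → filtration n F R ℓ m ≠ ⊥ := Nat.find_min hbot
  set r := Nat.find hbot
  -- Each term is the radical of its predecessor, so one repetition makes the filtration constant
  -- from there on. Repetitions can therefore only occur at zero.
  have hstab : ∀ i, filtration n F R ℓ i = filtration n F R ℓ (i + 1) → ∀ k,
      filtration n F R ℓ (i + k) = filtration n F R ℓ i := by
    intro i hi k
    induction k with
    | zero => rfl
    | succ k ih => rw [← add_assoc, ← map_jacobson_filtration S hT, ih,
        map_jacobson_filtration S hT, ← hi]
  rw [hrad]
  refine ⟨r, ?_, hspec, ?_⟩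
  · intro i hi j hj hij
    refine lt_of_le_of_lt (filtration_antitone S (Nat.succ_le_of_lt hij))
      (lt_of_le_of_ne (filtration_antitone S (Nat.le_succ i)) fun h => ?_)
    have h1 := hstab i h.symm (r - i)
    rw [Nat.add_sub_cancel' hi, hspec] at h1
    exact hmin (lt_of_lt_of_le hij hj) h1.symm
  · refine Set.Subset.antisymm ?_ (Set.image_subset_range _ _)
    rintro _ ⟨c, rfl⟩
    rcases le_total c r with h | h
    · exact ⟨c, h, rfl⟩
    · refine ⟨r, Set.mem_Iic.2 le_rfl, ?_⟩
      have := filtration_antitone (n := n) S h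
      rw [hspec] at this ⊢
      exact (le_bot_iff.1 this).symm

end Radical

/-! ### Moving eigenvectors to standard types by merging and splitting blocks. -/

section Reduction

variable {n : ℕ} {F : Type*} [Field F] [Fintype F] [DecidableEq F] {R : Type*} [CommRing R]

variable (F R) in
/-- Every `E_χ` with `χ` of type `l` lies in a submodule generated by some `E_χ'` with `χ'` of
type `l'`. -/
def Reaches (n : ℕ) (l l' : List ℕ) : Prop :=
  ∀ χ : ℕ → AddChar F Rˣ, HasType n l χ → ∃ χ', HasType n l' χ' ∧ EigenLE n χ χ'

theorem Reaches.refl (l : List ℕ) : Reaches F R n l l := fun χ h => ⟨χ, h, fun _ hN => hN⟩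

theorem Reaches.trans {l l' l'' : List ℕ} (h : Reaches F R n l l') (h' : Reaches F R n l' l'') :
    Reaches F R n l l'' := fun χ hχ => by
  obtain ⟨χ', hχ', h1⟩ := h χ hχ
  obtain ⟨χ'', hχ'', h2⟩ := h' χ' hχ'
  exact ⟨χ'', hχ'', fun N hN => h1 N (h2 N hN)⟩

theorem reaches_swap (hq : IsUnit (Fintype.card F : R)) {l1 l2 : List ℕ} {a b : ℕ} (ha : 0 < a)
    (hb : 0 < b) (hn : l1.sum + a + b ≤ n) :
    Reaches F R n (l1 ++ a :: b :: l2) (l1 ++ b :: a :: l2) := fun _ hχ =>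
  ⟨_, hχ.swapSeq_swap ha hb hn, hχ.eigenLE_swapSeq hq ha hb hn 1⟩

theorem reaches_merge (hq : IsUnit (Fintype.card F : R)) {ψ : AddChar F Rˣ} (hψ : ψ ≠ 1)
    {l1 l2 : List ℕ} {a b : ℕ} (ha : 0 < a) (hb : 0 < b) (hn : l1.sum + a + b ≤ n) :
    Reaches F R n (l1 ++ a :: b :: l2) (l1 ++ (a + b) :: l2) := fun _ hχ =>
  ⟨_, hχ.swapSeq_merge ha hb hn hψ, hχ.eigenLE_swapSeq hq ha hb hn ψ⟩

theorem reaches_of_perm (hq : IsUnit (Fintype.card F : R)) {l l' : List ℕ} (h : l.Perm l')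
    (l0 : List ℕ) (hn : (l0 ++ l).sum = n) (hpos : ∀ a ∈ l, 0 < a) :
    Reaches F R n (l0 ++ l) (l0 ++ l') := by
  induction h generalizing l0 with
  | nil => exact Reaches.refl _
  | cons x _ ih =>
    have := ih (l0 ++ [x]) (by simpa using hn) fun a ha => hpos a (List.mem_cons_of_mem _ ha)
    simpa using this
  | swap x y l =>
    refine reaches_swap hq (hpos _ (by simp)) (hpos _ (by simp)) ?_
    simp only [List.sum_append, List.sum_cons] at hn
    omega
  | trans h1 _ ih1 ih2 =>
    refine (ih1 l0 hn hpos).trans (ih2 l0 ?_ fun a ha => hpos a (h1.mem_iff.2 ha))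
    rw [← hn, List.sum_append, List.sum_append, h1.sum_eq]

theorem reaches_replicate (hq : IsUnit (Fintype.card F : R)) {ψ : AddChar F Rˣ} (hψ : ψ ≠ 1)
    {b : ℕ} (hb : 0 < b) (k : ℕ) (l1 l2 : List ℕ) (hn : l1.sum + (k + 1) * b ≤ n) :
    Reaches F R n (l1 ++ (List.replicate (k + 1) b ++ l2)) (l1 ++ ((k + 1) * b) :: l2) := by
  induction k generalizing l1 with
  | zero => simpa using Reaches.refl _
  | succ k ih =>
    have h1 := ih (l1 ++ [b]) (by simp only [List.sum_append, List.sum_singleton]; linarith)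
    have h2 : Reaches F R n (l1 ++ b :: ((k + 1) * b) :: l2) (l1 ++ (b + (k + 1) * b) :: l2) :=
      reaches_merge hq hψ hb (by positivity) (by linarith)
    rw [show b + (k + 1) * b = (k + 1 + 1) * b by ring] at h2
    refine Reaches.trans ?_ h2
    simpa [List.replicate_succ] using h1

variable [IsDomain R] [CharZero R] [IsLocalRing R] {ℓ : ℕ} (S : IsModularSetting F R ℓ)

include S

/-- The eigenvectors in `L(c)` lie in every submodule that contains those of the types that can
neither be merged nor split without changing the layer. -/
theorem redVec_mem_of_good {V : ℕ → ℕ} {good : ℕ → Prop}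
    (hV : ∀ (l : List ℕ) (χ : ℕ → AddChar F Rˣ), l.sum = n → (∀ a ∈ l, 0 < a) →
      HasType n l χ → padicValNat ℓ (charIndex n χ) + (l.map V).sum = V n)
    (hsplit : ∀ m, 0 < m → ¬ good m → ∃ x y, 0 < x ∧ 0 < y ∧ x + y = m ∧ V x + V y = V m)
    (hmerge : ∀ l : List ℕ, (∀ b ∈ l, good b) → (l.map V).sum < V l.sum →
      ∃ k b, (k + 1) ≤ l.count b ∧ V ((k + 1) * b) = (k + 1) * V b + 1)
    {N : Submodule (GroupAlg n F (ResField R ℓ)) (reduction n F R ℓ)} {c : ℕ}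
    (hN : ∀ (l : List ℕ) (χ : ℕ → AddChar F Rˣ), l.sum = n → (∀ a ∈ l, 0 < a) →
      l.Pairwise (· ≤ ·) → (∀ b ∈ l, good b) → HasType n l χ →
      padicValNat ℓ (charIndex n χ) = c → redVec n ℓ χ ∈ N) :
    ∀ (k m : ℕ) (l : List ℕ) (χ : ℕ → AddChar F Rˣ), l.sum = n → (∀ a ∈ l, 0 < a) →
      HasType n l χ → padicValNat ℓ (charIndex n χ) = c + k → l.length + m = n →
      redVec n ℓ χ ∈ N := by
  obtain ⟨ψ, hψ⟩ := S.exists_addChar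
  have hq := S.isUnit_card
  -- Here k is the excess of the valuation over c, and m = n - (number of blocks) bounds how often
  -- blocks can still be split.
  intro k
  induction k using Nat.strong_induction_on with | _ k ihk
  intro m
  induction m using Nat.strong_induction_on with | _ m ihm
  intro l χ hn hpos hχ hν hm
  by_cases hgood : ∀ b ∈ l, good b
  · rcases k with _ | k
    · have hp := List.perm_insertionSort (· ≤ ·) l
      have hr := reaches_of_perm (F := F) (R := R) hq hp.symm [] hn hpos
      obtain ⟨χ', hχ', hle⟩ := hr χ hχ
      rw [List.nil_append] at hχ'
      have hn' : (l.insertionSort (· ≤ ·)).sum = n := by rw [hp.sum_eq, hn]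
      have hpos' : ∀ a ∈ l.insertionSort (· ≤ ·), 0 < a := fun a ha => hpos a (hp.mem_iff.1 ha)
      refine hle.redVec_mem (hN _ χ' hn' hpos' (List.pairwise_insertionSort (· ≤ ·) l)
        (fun a ha => hgood a (hp.mem_iff.1 ha)) hχ' ?_)
      have h1 := hV l χ hn hpos hχ
      have h2 := hV _ χ' hn' hpos' hχ'
      rw [(hp.map V).sum_eq] at h2
      omega
    -- The valuation is positive, so some equal blocks can be merged with a gain of one in V; the
    -- excess drops to k.
    · have h1 := hV l χ hn hpos hχ
      obtain ⟨j, b, hcount, hjb⟩ := hmerge l hgood (by rw [hn]; omega)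
      obtain ⟨l2, hp⟩ := (List.replicate_sublist_iff.2 hcount).exists_perm_append
      have hb : 0 < b := hpos b (hp.mem_iff.2 (by simp))
      have hsum : (j + 1) * b + l2.sum = n := by
        rw [← hn, hp.sum_eq, List.sum_append, List.sum_replicate, smul_eq_mul]
      have hr := (reaches_of_perm (F := F) (R := R) hq hp [] hn hpos).trans
        (reaches_replicate hq hψ hb j [] l2 (by rw [List.sum_nil]; omega))
      obtain ⟨χ', hχ', hle⟩ := hr χ hχ
      rw [List.nil_append] at hχ'
      have hpos' : ∀ a ∈ ((j + 1) * b) :: l2, 0 < a := by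
        intro a ha
        rcases List.mem_cons.1 ha with rfl | ha
        · positivity
        · exact hpos a (hp.mem_iff.2 (List.mem_append_right _ ha))
      have h2 := hV _ χ' (by rw [List.sum_cons, hsum]) hpos' hχ'
      have h3 : (l.map V).sum = (j + 1) * V b + (l2.map V).sum := by
        rw [(hp.map V).sum_eq, List.map_append, List.sum_append, List.map_replicate,
          List.sum_replicate, smul_eq_mul]
      rw [List.map_cons, List.sum_cons, hjb] at h2
      have h4 := List.length_le_sum_of_one_le _ hpos'
      rw [List.sum_cons, hsum] at h4
      exact hle.redVec_mem (ihk k (Nat.lt_succ_self k) (n - (((j + 1) * b) :: l2).length) _ χ'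
        (by rw [List.sum_cons, hsum]) hpos' hχ' (by omega) (by omega))
  · push Not at hgood
    obtain ⟨b, hbl, hb⟩ := hgood
    obtain ⟨x, y, hx, hy, rfl, hxy⟩ := hsplit b (hpos b hbl) hb
    obtain ⟨l1, l2, rfl⟩ := List.append_of_mem hbl
    have hn1 : l1.sum + y + x ≤ n := by
      rw [← hn, List.sum_append, List.sum_cons]; omega
    have hχ' := hχ.swapSeq_split hy hx hn1
    have hle := hχ.swapSeq_split_eigenLE hq hy hx hn1
    have hn' : (l1 ++ y :: x :: l2).sum = n := by
      rw [← hn]; simp only [List.sum_append, List.sum_cons]; omega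
    have hpos' : ∀ a ∈ l1 ++ y :: x :: l2, 0 < a := by
      intro a ha
      simp only [List.mem_append, List.mem_cons] at ha hpos
      rcases ha with h | rfl | rfl | h
      · exact hpos a (Or.inl h)
      · exact hy
      · exact hx
      · exact hpos a (Or.inr (Or.inr h))
    have h1 := hV _ χ hn hpos hχ
    have h2 := hV _ _ hn' hpos' hχ'
    have h3 : ((l1 ++ y :: x :: l2).map V).sum = ((l1 ++ (x + y) :: l2).map V).sum := by
      simp only [List.map_append, List.map_cons, List.sum_append, List.sum_cons]; omega
    have h4 := List.length_le_sum_of_one_le _ hpos'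
    rw [hn'] at h4
    have h5 : (l1 ++ y :: x :: l2).length = (l1 ++ (x + y) :: l2).length + 1 := by
      simp only [List.length_append, List.length_cons]; omega
    -- Splitting goes in the wrong direction: the split eigenvector lies in the submodule generated
    -- by E_χ. As the valuation is unchanged, duality reverses the inclusion.
    exact redVec_mem_of_eigenLE S hle (by omega)
      (ihm (m - 1) (by omega) _ _ hn' hpos' hχ' (by omega) (by omega))

end Reduction

/-! ### Valuations of factorials and carry-free addition. -/

section Factorial

variable {ℓ : ℕ} [hℓ : Fact ℓ.Prime]

theorem padicValNat_factorial_eq_zero_of_lt {r : ℕ} (h : r < ℓ) : padicValNat ℓ r.factorial = 0 :=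
  padicValNat.eq_zero_of_not_dvd fun h' => not_lt_of_ge ((hℓ.out.dvd_factorial).1 h') h

theorem padicValNat_factorial_mul_add_eq {t r : ℕ} (h : r < ℓ) :
    padicValNat ℓ (ℓ * t + r).factorial = padicValNat ℓ t.factorial + t := by
  rw [padicValNat_factorial_mul_add _ h, padicValNat_factorial_mul]

/-- Since the coefficients are ℓ-adic digits, there are no carries; Legendre's recursion ν((ℓ t +
r)!) = ν(t!) + t strips off one digit at a time. -/
theorem padicValNat_factorial_sum {N : ℕ} {f : ℕ → ℕ} (hf : ∀ i, f i < ℓ) :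
    padicValNat ℓ (∑ i ∈ Finset.range N, f i * ℓ ^ i).factorial =
      ∑ i ∈ Finset.range N, f i * padicValNat ℓ (ℓ ^ i).factorial := by
  induction N generalizing f with
  | zero => simp
  | succ N ih =>
    rw [Finset.sum_range_succ', Finset.sum_range_succ']
    have h1 : ∑ i ∈ Finset.range N, f (i + 1) * ℓ ^ (i + 1) =
        ℓ * ∑ i ∈ Finset.range N, f (i + 1) * ℓ ^ i := by
      rw [Finset.mul_sum]; exact Finset.sum_congr rfl fun i _ => by ring
    have h2 : ∀ i, padicValNat ℓ (ℓ ^ (i + 1)).factorial =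
        padicValNat ℓ (ℓ ^ i).factorial + ℓ ^ i := fun i => by
      rw [pow_succ', padicValNat_factorial_mul]
    rw [h1, pow_zero, mul_one, padicValNat_factorial_mul_add_eq (hf 0),
      ih fun i => hf (i + 1)]
    simp only [h2, mul_add, Finset.sum_add_distrib]
    simp

theorem padicValNat_factorial_pow_succ (i : ℕ) :
    padicValNat ℓ (ℓ ^ (i + 1)).factorial = ℓ * padicValNat ℓ (ℓ ^ i).factorial + 1 := by
  induction i with
  | zero =>
    have := padicValNat_factorial_mul (p := ℓ) 1
    simpa using this
  | succ i ih =>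
    have h1 : padicValNat ℓ (ℓ ^ (i + 1 + 1)).factorial =
        padicValNat ℓ (ℓ ^ (i + 1)).factorial + ℓ ^ (i + 1) := by
      rw [pow_succ' _ (i + 1), padicValNat_factorial_mul]
    have h2 : padicValNat ℓ (ℓ ^ (i + 1)).factorial =
        padicValNat ℓ (ℓ ^ i).factorial + ℓ ^ i := by
      rw [pow_succ', padicValNat_factorial_mul]
    rw [h1]
    conv_rhs => rw [h2]
    rw [ih]; ring

/-- A number with ℓ-adic digit sum at least 2 is a sum of two positive numbers without carries, and
then the factorial valuations add. -/
theorem exists_padicValNat_factorial_add {t : ℕ} (ht : 0 < t) (hne : ∀ i, t ≠ ℓ ^ i) :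
    ∃ s s', 0 < s ∧ 0 < s' ∧ s + s' = t ∧
      padicValNat ℓ s.factorial + padicValNat ℓ s'.factorial = padicValNat ℓ t.factorial := by
  induction t using Nat.strong_induction_on with
  | _ t ih =>
  have hpos := hℓ.out.pos
  obtain ⟨t', r, hr, rfl⟩ : ∃ t' r, r < ℓ ∧ t = ℓ * t' + r :=
    ⟨t / ℓ, t % ℓ, Nat.mod_lt _ hpos, (Nat.div_add_mod t ℓ).symm⟩
  rcases Nat.eq_zero_or_pos t' with rfl | ht'
  · have h1 := hne 0
    simp only [mul_zero, zero_add, pow_zero] at ht h1 ⊢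
    refine ⟨1, r - 1, one_pos, by omega, by omega, ?_⟩
    rw [padicValNat_factorial_eq_zero_of_lt hℓ.out.one_lt,
      padicValNat_factorial_eq_zero_of_lt (show r - 1 < ℓ by omega),
      padicValNat_factorial_eq_zero_of_lt hr]
  rcases Nat.eq_zero_or_pos r with rfl | hr0
  · have hlt : t' < ℓ * t' + 0 := by
      have := Nat.mul_le_mul_right t' hℓ.out.two_le; omega
    obtain ⟨s, s', hs, hs', h1, h2⟩ := ih t' hlt ht' fun i hi => hne (i + 1) (by
      rw [hi, pow_succ']; rfl)
    refine ⟨ℓ * s, ℓ * s', by positivity, by positivity, by rw [← h1]; ring, ?_⟩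
    rw [add_zero, padicValNat_factorial_mul, padicValNat_factorial_mul, padicValNat_factorial_mul]
    omega
  · refine ⟨ℓ * t', r, by positivity, hr0, rfl, ?_⟩
    rw [padicValNat_factorial_eq_zero_of_lt hr, padicValNat_factorial_mul_add _ hr, add_zero]

end Factorial

/-! ### Splitting and merging blocks for the function V. -/

section Good

variable (e ℓ : ℕ)

/-- The block sizes `1` and `e ℓ ^ i`. -/
def GoodBlock (b : ℕ) : Prop := b = 1 ∨ ∃ i : ℕ, b = e * ℓ ^ i

variable {e ℓ} [hℓ : Fact ℓ.Prime] {V : ℕ → ℕ}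
  (hV : ∀ m, V m = m / e + padicValNat ℓ (m / e).factorial)
-- Grouping equal blocks. As e ≥ 2, the sizes 1 and e ℓ^i are pairwise distinct; the same N serves
-- every g, so that sizes and values of V can be compared.
theorem sum_map_of_goodBlock (he : 2 ≤ e) (l : List ℕ) (h : ∀ b ∈ l, GoodBlock e ℓ b) :
    ∃ N, ∀ g : ℕ → ℕ, (l.map g).sum = l.count 1 * g 1 +
      ∑ i ∈ Finset.range N, l.count (e * ℓ ^ i) * g (e * ℓ ^ i) := by
  have hinj : Function.Injective fun i : ℕ => e * ℓ ^ i := fun i j hij =>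
    Nat.pow_right_injective hℓ.out.two_le (Nat.eq_of_mul_eq_mul_left (by omega) hij)
  refine ⟨l.sum + 1, fun g => ?_⟩
  let T : Finset ℕ := insert 1 ((Finset.range (l.sum + 1)).image fun i => e * ℓ ^ i)
  have hT : l.toFinset ⊆ T := by
    intro b hb
    rw [List.mem_toFinset] at hb
    rcases h b hb with rfl | ⟨i, rfl⟩
    · exact Finset.mem_insert_self _ _
    · refine Finset.mem_insert_of_mem (Finset.mem_image.2 ⟨i, Finset.mem_range.2 ?_, rfl⟩)
      have h1 := List.single_le_sum (fun _ _ => Nat.zero_le _) _ hb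
      have h2 := Nat.lt_pow_self (n := i) hℓ.out.one_lt
      have h3 : ℓ ^ i ≤ e * ℓ ^ i := Nat.le_mul_of_pos_left _ (by omega)
      omega
  rw [Finset.sum_list_map_count, Finset.sum_subset hT, Finset.sum_insert,
    Finset.sum_image fun i _ j _ hij => hinj hij]
  · simp only [smul_eq_mul]
  · intro h1
    obtain ⟨i, -, hi⟩ := Finset.mem_image.1 h1
    have := Nat.le_mul_of_pos_right e (pow_pos hℓ.out.pos i)
    omega
  · intro b _ hb
    rw [List.mem_toFinset] at hb
    rw [List.count_eq_zero_of_not_mem hb, zero_smul]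

include hV

/-- The remainder modulo e can be split off freely, because V vanishes below e. For m = e t the
splitting is a carry-free splitting of t, available when t is not a power of ℓ. -/
theorem valuation_split (he : 2 ≤ e) {m : ℕ} (hm : 0 < m) (h : ¬ GoodBlock e ℓ m) :
    ∃ x y, 0 < x ∧ 0 < y ∧ x + y = m ∧ V x + V y = V m := by
  have h0 : ∀ r, r < e → V r = 0 := fun r hr => by rw [hV, Nat.div_eq_of_lt hr]; simp
  have h1 : m ≠ 1 := fun h1 => h (Or.inl h1)
  obtain ⟨t, r, hr, rfl⟩ : ∃ t r, r < e ∧ m = e * t + r :=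
    ⟨m / e, m % e, Nat.mod_lt _ (by omega), (Nat.div_add_mod m e).symm⟩
  rcases Nat.eq_zero_or_pos t with rfl | ht
  · simp only [mul_zero, zero_add] at hm h1 ⊢
    exact ⟨1, r - 1, one_pos, by omega, by omega, by
      rw [h0 1 (by omega), h0 (r - 1) (by omega), h0 r hr]⟩
  have hdiv : ∀ t r, r < e → (e * t + r) / e = t := fun t r hr => by
    rw [Nat.mul_add_div (by omega), Nat.div_eq_of_lt hr, add_zero]
  have hdiv' : ∀ t, e * t / e = t := fun t => Nat.mul_div_cancel_left t (by omega)
  rcases Nat.eq_zero_or_pos r with rfl | hr0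
  · obtain ⟨s, s', hs, hs', h2, h3⟩ := exists_padicValNat_factorial_add (ℓ := ℓ) ht
      fun i hi => h (Or.inr ⟨i, by rw [hi, add_zero]⟩)
    refine ⟨e * s, e * s', by positivity, by positivity, by rw [← h2]; ring, ?_⟩
    rw [hV, hV, hV, hdiv t 0 hr, hdiv', hdiv']
    omega
  · refine ⟨e * t, r, by positivity, hr0, rfl, ?_⟩
    rw [h0 r hr, hV, hV, hdiv t r hr, hdiv', add_zero]

/-- Fewer than e ones and fewer than ℓ copies of each e ℓ^i would be the mixed-radix expansion of
the total size, on which V is additive. So e ones or ℓ equal blocks e ℓ^i exist, and merging them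
raises V by one. -/
theorem valuation_merge (he : 2 ≤ e) (l : List ℕ) (h : ∀ b ∈ l, GoodBlock e ℓ b)
    (hlt : (l.map V).sum < V l.sum) :
    ∃ k b, (k + 1) ≤ l.count b ∧ V ((k + 1) * b) = (k + 1) * V b + 1 := by
  have hdiv' : ∀ t, e * t / e = t := fun t => Nat.mul_div_cancel_left t (by omega)
  have hV1 : V 1 = 0 := by rw [hV, Nat.div_eq_of_lt (by omega)]; simp
  by_cases h1 : e ≤ l.count 1
  · refine ⟨e - 1, 1, by omega, ?_⟩
    rw [hV1, Nat.sub_add_cancel (by omega), mul_one, hV, Nat.div_self (by omega)]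
    simp
  by_cases h2 : ∃ i, ℓ ≤ l.count (e * ℓ ^ i)
  · obtain ⟨i, hi⟩ := h2
    have hpos := hℓ.out.pos
    refine ⟨ℓ - 1, e * ℓ ^ i, by omega, ?_⟩
    rw [Nat.sub_add_cancel (by omega), mul_left_comm, hV, hV, hdiv', hdiv', ← pow_succ',
      padicValNat_factorial_pow_succ]
    ring
  push Not at h1 h2
  obtain ⟨N, hN⟩ := sum_map_of_goodBlock he l h
  have hsum := hN id
  rw [List.map_id] at hsum
  have e1 : ∑ i ∈ Finset.range N, l.count (e * ℓ ^ i) * id (e * ℓ ^ i) =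
      e * ∑ i ∈ Finset.range N, l.count (e * ℓ ^ i) * ℓ ^ i := by
    rw [Finset.mul_sum]
    exact Finset.sum_congr rfl fun i _ => by rw [id]; ring
  have e2 : l.sum / e = ∑ i ∈ Finset.range N, l.count (e * ℓ ^ i) * ℓ ^ i := by
    rw [hsum, e1, id, mul_one, Nat.add_mul_div_left _ _ (by omega), Nat.div_eq_of_lt h1, zero_add]
  refine absurd hlt (not_lt_of_ge ?_)
  rw [hN V, hV1, hV l.sum, e2, padicValNat_factorial_sum h2, ← Finset.sum_add_distrib, mul_zero,
    zero_add]
  refine Finset.sum_le_sum fun i _ => ?_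
  rw [hV, hdiv', mul_add]

end Good

/-! ### Valuations of q-numbers and q-factorials. -/

section QNumber

/-- The sum of the valuations of the `q`-numbers `(q ^ j - 1) / (q - 1)`, `j ≤ m`. -/
def qFactorialVal (q ℓ m : ℕ) : ℕ :=
  ∑ j ∈ Finset.range m, padicValNat ℓ (∑ i ∈ Finset.range (j + 1), q ^ i)

variable {q ℓ : ℕ} [hℓ : Fact ℓ.Prime]

theorem geomSum_add (q a b : ℕ) : ∑ i ∈ Finset.range (a + b), q ^ i =
    ∑ i ∈ Finset.range a, q ^ i + q ^ a * ∑ i ∈ Finset.range b, q ^ i := by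
  rw [Finset.sum_range_add, Finset.mul_sum]
  simp only [pow_add]

theorem geomSum_mul_pred (hq : 2 ≤ q) (j : ℕ) :
    (∑ i ∈ Finset.range j, q ^ i) * (q - 1) = q ^ j - 1 := by
  rw [Nat.geomSum_eq hq, Nat.div_mul_cancel]
  simpa using Nat.sub_dvd_pow_sub_pow q 1 j

theorem geomSum_ne_zero {j : ℕ} (hj : 0 < j) : ∑ i ∈ Finset.range j, q ^ i ≠ 0 := by
  obtain ⟨j, rfl⟩ := Nat.exists_eq_succ_of_ne_zero hj.ne'
  rw [Finset.sum_range_succ']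
  simp

theorem eNumber_spec (hq : 2 ≤ q) (hd : dNumber q ℓ = 1) :
    2 ≤ eNumber q ℓ ∧ padicValNat ℓ (∑ i ∈ Finset.range (eNumber q ℓ), q ^ i) = 1 ∧
      ∀ r, 0 < r → r < eNumber q ℓ → ¬ ℓ ∣ ∑ i ∈ Finset.range r, q ^ i := by
  have hne : {i : ℕ | 2 ≤ i ∧ ℓ ∣ (q ^ i - 1) / (q - 1)}.Nonempty := by
    -- If no such i existed, the infimum would be 0 by convention and d would be 0.
    by_contra h
    rw [Set.not_nonempty_iff_eq_empty] at h
    rw [dNumber, eNumber, h, Nat.sInf_empty] at hd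
    simp at hd
  refine ⟨(Nat.sInf_mem hne).1, by rwa [Nat.geomSum_eq hq], fun r hr hlt hdvd => ?_⟩
  rcases Nat.lt_or_ge r 2 with h1 | h1
  · obtain rfl : r = 1 := by omega
    simp at hdvd
    exact hℓ.out.one_lt.ne' hdvd
  · refine Nat.notMem_of_lt_sInf hlt ⟨h1, ?_⟩
    rwa [← Nat.geomSum_eq hq]

theorem dvd_geomSum_mul (hdvd : ℓ ∣ ∑ i ∈ Finset.range (eNumber q ℓ), q ^ i) (k : ℕ) :
    ℓ ∣ ∑ i ∈ Finset.range (eNumber q ℓ * k), q ^ i := by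
  induction k with
  | zero => simp
  | succ k ih => rw [mul_add_one, geomSum_add]; exact dvd_add ih (hdvd.mul_left _)

/-- Lifting the exponent from q^e to q^(e k), the summand 1 being d. If e does not divide j, then j
is reduced modulo e, against the minimality of e. -/
theorem padicValNat_geomSum (hq : 2 ≤ q) (hql : ¬ ℓ ∣ q) (hd : dNumber q ℓ = 1) {j : ℕ}
    (hj : 0 < j) : padicValNat ℓ (∑ i ∈ Finset.range j, q ^ i) =
      if eNumber q ℓ ∣ j then 1 + padicValNat ℓ (j / eNumber q ℓ) else 0 := by
  obtain ⟨he, hv, hmin⟩ := eNumber_spec hq hd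
  have hdvd : ℓ ∣ ∑ i ∈ Finset.range (eNumber q ℓ), q ^ i :=
    dvd_of_one_le_padicValNat hv.ge
  split_ifs with h
  · obtain ⟨k, rfl⟩ := h
    have hk : k ≠ 0 := by rintro rfl; simp at hj
    rw [Nat.mul_div_cancel_left k (by omega)]
    have hval : ∀ i, 0 < i → padicValNat ℓ (∑ i ∈ Finset.range i, q ^ i) + padicValNat ℓ (q - 1) =
        padicValNat ℓ (q ^ i - 1) := fun i hi => by
      rw [← geomSum_mul_pred hq, padicValNat.mul (geomSum_ne_zero hi) (by omega)]
    have h1 := hval _ hj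
    -- For ℓ = 2 the number q is odd, so e = 2, and the even-exponent form of the lifting lemma is
    -- needed; there ν(q + 1) = 1 is the hypothesis d = 1.
    rcases hℓ.out.eq_two_or_odd' with rfl | hodd
    · have he2 : eNumber q 2 = 2 := by
        refine le_antisymm ?_ he
        by_contra hlt
        refine hmin 2 two_pos (by omega) ?_
        rw [Finset.sum_range_succ, Finset.sum_range_one, pow_zero, pow_one]
        omega
      rw [he2] at h1 hv ⊢
      have h2 := padicValNat.pow_two_sub_pow (x := q) (y := 1) (by omega) (by omega) hql
        (n := 2 * k) (by omega) (even_two_mul k)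
      rw [Finset.sum_range_succ, Finset.sum_range_one, pow_zero, pow_one, add_comm] at hv
      rw [one_pow, padicValNat.mul two_ne_zero hk, padicValNat.self (by norm_num), hv] at h2
      omega
    · have h2 := hval (eNumber q ℓ) (by omega)
      have h3 : ℓ ∣ q ^ eNumber q ℓ - 1 := by
        rw [← geomSum_mul_pred hq]; exact hdvd.mul_right _
      have h4 := padicValNat.pow_sub_pow hodd (x := q ^ eNumber q ℓ) (y := 1)
        (Nat.one_lt_pow (by omega) (by omega)) h3 (fun h => hql (hℓ.out.dvd_of_dvd_pow h))
        (n := k) hk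
      rw [one_pow, ← pow_mul] at h4
      omega
  · refine padicValNat.eq_zero_of_not_dvd fun hj' => ?_
    have hr : j % eNumber q ℓ ≠ 0 := fun h' => h (Nat.dvd_of_mod_eq_zero h')
    have h1 := geomSum_add q (eNumber q ℓ * (j / eNumber q ℓ)) (j % eNumber q ℓ)
    rw [Nat.div_add_mod] at h1
    rw [h1, Nat.dvd_add_right (dvd_geomSum_mul hdvd _)] at hj'
    rcases hℓ.out.dvd_mul.1 hj' with h2 | h2
    · exact hql (hℓ.out.dvd_of_dvd_pow h2)
    · exact hmin _ (Nat.pos_of_ne_zero hr) (Nat.mod_lt _ (by omega)) h2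

theorem qFactorialVal_eq (hq : 2 ≤ q) (hql : ¬ ℓ ∣ q) (hd : dNumber q ℓ = 1) (m : ℕ) :
    qFactorialVal q ℓ m = m / eNumber q ℓ + padicValNat ℓ (m / eNumber q ℓ).factorial := by
  induction m with
  | zero => simp [qFactorialVal]
  | succ m ih =>
    have h1 : qFactorialVal q ℓ (m + 1) = qFactorialVal q ℓ m +
        padicValNat ℓ (∑ i ∈ Finset.range (m + 1), q ^ i) := Finset.sum_range_succ _ _
    rw [h1, ih, padicValNat_geomSum hq hql hd (Nat.succ_pos m), Nat.succ_div]
    split_ifs with h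
    · rw [Nat.factorial_succ, padicValNat.mul (Nat.succ_ne_zero _) (Nat.factorial_ne_zero _),
        Nat.succ_eq_add_one]
      omega
    · rfl

end QNumber

/-! ### Orders of the parabolic subgroups and the valuation of their indices. -/

section Cardinality

variable {n : ℕ} {F : Type*} [Field F]

/-- Levi decomposition: the diagonal blocks are arbitrary invertible matrices, since the determinant
is the product of theirs, and the entries above them are free. -/
theorem card_blockSubgroup [Fintype F] {α : Type*} [LinearOrder α] [Fintype α] (b : Fin n → α) :
    Nat.card (blockSubgroup b : Subgroup (GL (Fin n) F)) =
      (∏ k, Nat.card (GL {i // b i = k} F)) *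
        Fintype.card F ^ Nat.card {p : Fin n × Fin n // b p.1 < b p.2} := by
  let A : (∀ k, GL {i // b i = k} F) × ({p : Fin n × Fin n // b p.1 < b p.2} → F) →
      Matrix (Fin n) (Fin n) F := fun x => Matrix.of fun i j =>
    if h : b i = b j then (x.1 (b j)).val ⟨i, h⟩ ⟨j, rfl⟩
    else if h' : b i < b j then x.2 ⟨(i, j), h'⟩ else 0
  have hA : ∀ x, (A x).BlockTriangular b := fun x i j hij => by
    simp only [A, Matrix.of_apply]
    rw [dif_neg (ne_of_gt hij), dif_neg (not_lt_of_gt hij)]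
  have hblock : ∀ x k, (A x).toSquareBlock b k = (x.1 k).val := fun x k => by
    ext ⟨i, hi⟩ ⟨j, hj⟩
    subst hj
    simp only [A, Matrix.toSquareBlock_def, Matrix.of_apply]
    rw [dif_pos hi]
  have hdet : ∀ x, (A x).det ≠ 0 := fun x => by
    rw [(hA x).det_fintype]
    refine Finset.prod_ne_zero_iff.2 fun k _ => ?_
    rw [hblock]
    exact ((x.1 k).isUnit.map Matrix.detMonoidHom).ne_zero
  let f : (∀ k, GL {i // b i = k} F) × ({p : Fin n × Fin n // b p.1 < b p.2} → F) →
      (blockSubgroup b : Subgroup (GL (Fin n) F)) := fun x =>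
    ⟨Matrix.GeneralLinearGroup.mkOfDetNeZero (A x) (hdet x), hA x⟩
  have hf : Function.Bijective f := by
    constructor
    · intro x y h
      have h1 : A x = A y := congrArg (fun g => (g.1 : GL (Fin n) F).val) h
      refine Prod.ext (funext fun k => Units.ext ?_) (funext fun ⟨⟨i, j⟩, hij⟩ => ?_)
      · rw [← hblock, ← hblock, h1]
      · have h2 := congrFun (congrFun h1 i) j
        simp only [A, Matrix.of_apply] at h2
        rwa [dif_neg (ne_of_lt hij), dif_neg (ne_of_lt hij), dif_pos hij, dif_pos hij] at h2
    · rintro ⟨g, hg⟩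
      have hg : g.val.BlockTriangular b := hg
      have hne : ∀ k, (g.val.toSquareBlock b k).det ≠ 0 := fun k => by
        have := (g.isUnit.map Matrix.detMonoidHom).ne_zero
        rw [Matrix.coe_detMonoidHom, hg.det_fintype] at this
        exact Finset.prod_ne_zero_iff.1 this k (Finset.mem_univ k)
      refine ⟨(fun k => Matrix.GeneralLinearGroup.mkOfDetNeZero _ (hne k),
        fun p => g.val p.1.1 p.1.2), Subtype.ext (Units.ext ?_)⟩
      ext i j
      change A _ i j = g.val i j
      simp only [A, Matrix.of_apply]
      split_ifs with h1 h2
      · rfl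
      · rfl
      · exact (hg (lt_of_le_of_ne (not_lt.1 h2) (Ne.symm h1))).symm
  rw [← Nat.card_congr (Equiv.ofBijective f hf), Nat.card_prod, Nat.card_pi, Nat.card_fun,
    Nat.card_eq_fintype_card (α := F)]

theorem card_GL_congr {ι κ : Type*} [Fintype ι] [DecidableEq ι] [Fintype κ] [DecidableEq κ]
    (e : ι ≃ κ) : Nat.card (GL ι F) = Nat.card (GL κ F) :=
  Nat.card_congr (Units.mapEquiv (Matrix.reindexAlgEquiv F F e).toMulEquiv).toEquiv

variable [Fintype F] {ℓ : ℕ} [hℓ : Fact ℓ.Prime]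

theorem padicValNat_prod {ι : Type*} (s : Finset ι) {f : ι → ℕ} (hf : ∀ i ∈ s, f i ≠ 0) :
    padicValNat ℓ (∏ i ∈ s, f i) = ∑ i ∈ s, padicValNat ℓ (f i) := by
  classical
  induction s using Finset.induction_on with
  | empty => simp
  | insert a s ha ih =>
    rw [Finset.prod_insert ha, Finset.sum_insert ha, padicValNat.mul (hf a (by simp))
      (Finset.prod_ne_zero_iff.2 fun i hi => hf i (Finset.mem_insert_of_mem hi)),
      ih fun i hi => hf i (Finset.mem_insert_of_mem hi)]

theorem padicValNat_pow_of_not_dvd {q : ℕ} (h : ¬ ℓ ∣ q) (k : ℕ) : padicValNat ℓ (q ^ k) = 0 :=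
  padicValNat.eq_zero_of_not_dvd fun h' => h (hℓ.out.dvd_of_dvd_pow h')

theorem padicValNat_card_GL (hql : ¬ ℓ ∣ Fintype.card F) (m : ℕ) :
    padicValNat ℓ (Nat.card (GL (Fin m) F)) = qFactorialVal (Fintype.card F) ℓ m +
      m * padicValNat ℓ (Fintype.card F - 1) := by
  have hq : 2 ≤ Fintype.card F := Fintype.one_lt_card
  set q := Fintype.card F
  have hlt : ∀ i < m, q ^ i < q ^ m := fun i hi => Nat.pow_lt_pow_right hq hi
  have hterm : ∀ i < m, padicValNat ℓ (q ^ m - q ^ i) =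
      padicValNat ℓ (∑ j ∈ Finset.range (m - 1 - i + 1), q ^ j) + padicValNat ℓ (q - 1) := by
    intro i hi
    have h1 : q ^ m - q ^ i = q ^ i * ((∑ j ∈ Finset.range (m - 1 - i + 1), q ^ j) * (q - 1)) := by
      rw [geomSum_mul_pred hq, Nat.mul_sub, mul_one, ← pow_add]
      congr 2; omega
    have h2 := geomSum_ne_zero (q := q) (Nat.succ_pos (m - 1 - i))
    rw [h1, padicValNat.mul (by positivity) (mul_ne_zero h2 (by omega)),
      padicValNat_pow_of_not_dvd hql, padicValNat.mul h2 (by omega), zero_add]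
  rw [Matrix.card_GL_field, Fin.prod_univ_eq_prod_range fun i => q ^ m - q ^ i,
    padicValNat_prod _ fun i hi => (Nat.sub_pos_of_lt (hlt i (Finset.mem_range.1 hi))).ne',
    Finset.sum_congr rfl fun i hi => hterm i (Finset.mem_range.1 hi), Finset.sum_add_distrib]
  congr 1
  · exact Finset.sum_range_reflect
      (fun j => padicValNat ℓ (∑ i ∈ Finset.range (j + 1), q ^ i)) m
  · simp

/-- The index is a q-multinomial coefficient. Powers of q are prime to ℓ, and the contributions of q
- 1 to G and to the diagonal blocks agree because the block sizes sum to n. -/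
theorem padicValNat_index_parabolicOfComposition (hql : ¬ ℓ ∣ Fintype.card F)
    (a : Composition n) :
    padicValNat ℓ (parabolicOfComposition F a).index +
      (a.blocks.map (qFactorialVal (Fintype.card F) ℓ)).sum =
      qFactorialVal (Fintype.card F) ℓ n := by
  have hfib : ∀ k, Nat.card (GL {i // a.index i = k} F) = Nat.card (GL (Fin (a.blocksFun k)) F) := by
    intro k
    refine card_GL_congr (Equiv.symm (Equiv.ofBijective
      (fun j => ⟨a.embedding k j, a.index_embedding k j⟩) ⟨fun i j h => ?_, ?_⟩))
    · exact (a.embedding k).injective (congrArg Subtype.val h)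
    · rintro ⟨i, rfl⟩
      exact ⟨a.invEmbedding i, Subtype.ext (a.embedding_comp_inv i)⟩
  have h1 := Subgroup.card_mul_index (parabolicOfComposition F a)
  have h2 := congrArg (padicValNat ℓ) h1
  have hne : ∀ k, Nat.card (GL {i // a.index i = k} F) ≠ 0 := fun k => Nat.card_pos.ne'
  rw [padicValNat.mul Nat.card_pos.ne' Subgroup.index_ne_zero_of_finite, parabolicOfComposition,
    card_blockSubgroup, padicValNat.mul (Finset.prod_ne_zero_iff.2 fun k _ => hne k)
      (pow_ne_zero _ Fintype.card_ne_zero), padicValNat_pow_of_not_dvd hql,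
    padicValNat_prod _ fun k _ => hne k, padicValNat_card_GL hql] at h2
  simp only [hfib, padicValNat_card_GL hql, Finset.sum_add_distrib] at h2
  rw [← Finset.sum_mul, a.sum_blocksFun] at h2
  have h3 : (a.blocks.map (qFactorialVal (Fintype.card F) ℓ)).sum =
      ∑ k, qFactorialVal (Fintype.card F) ℓ (a.blocksFun k) := by
    rw [← a.ofFn_blocksFun, List.map_ofFn, List.sum_ofFn]; rfl
  rw [h3, parabolicOfComposition]
  omega

end Cardinality

/-! ### Generation of L(c) by the eigenvectors of types in 𝒫*(c). -/

section Main

variable {n : ℕ} {F : Type*} [Field F] [Fintype F] [DecidableEq F] {R : Type*} [CommRing R]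
  [IsDomain R] [CharZero R] [IsLocalRing R] {ℓ : ℕ} (S : IsModularSetting F R ℓ)
  (hd : dNumber (Fintype.card F) ℓ = 1)

include S hd

/-- The eigenvectors in `L(c)` lie in every submodule that contains those of the types in
`𝒫*(c)`. -/
theorem filtration_le_of_starCompositions (c : ℕ)
    {N : Submodule (GroupAlg n F (ResField R ℓ)) (reduction n F R ℓ)}
    (hN : ∀ a ∈ starCompositions n F ℓ c, ∀ χ : ℕ → AddChar F Rˣ,
      HasType n a.blocks χ → redVec n ℓ χ ∈ N) : filtration n F R ℓ c ≤ N := by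
  have hℓ := Fact.mk S.prime
  have hq : 2 ≤ Fintype.card F := Fintype.one_lt_card
  have he := (eNumber_spec hq hd).1
  have hV := qFactorialVal_eq hq S.not_dvd hd
  refine le_of_redVec S fun χ hχ => ?_
  rw [redVec_mem_filtration_iff S] at hχ
  obtain ⟨k, hk⟩ := Nat.exists_eq_add_of_le hχ
  obtain ⟨a, ha⟩ := exists_hasType n χ
  -- The hypothesis d = 1 enters through `qFactorialVal_eq`, which supplies both the splitting and
  -- the merging property of V.
  refine redVec_mem_of_good S (V := qFactorialVal (Fintype.card F) ℓ)
    (good := GoodBlock (eNumber (Fintype.card F) ℓ) ℓ) (c := c) ?_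
    (fun m => valuation_split hV he) (valuation_merge hV he) ?_ k (n - a.length) a.blocks χ
    a.blocks_sum (fun _ h => a.blocks_pos h) ha hk ?_
  · intro l χ hsum hpos hχ
    have := padicValNat_index_parabolicOfComposition (F := F) S.not_dvd
      (⟨l, fun h => hpos _ h, hsum⟩ : Composition n)
    rwa [← charIndex_eq (a := ⟨l, fun h => hpos _ h, hsum⟩) hχ] at this
  · intro l χ hsum hpos hsort hgood hχ hc
    refine hN ⟨l, fun h => hpos _ h, hsum⟩ ⟨hsort, ?_, ?_⟩ χ hχ
    · rw [Nat.card_eq_fintype_card]; exact hgood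
    · rw [← charIndex_eq hχ, hc]
  · exact Nat.add_sub_cancel' a.length_le

theorem filtration_eq_iSup_part (c : ℕ) : filtration n F R ℓ c =
    ⨆ a ∈ starCompositions n F ℓ c, part R ℓ (parabolicOfComposition F a) := by
  refine le_antisymm (filtration_le_of_starCompositions S hd c fun a ha χ hχ => ?_)
    (iSup₂_le fun a ha => ?_)
  · refine (le_iSup₂ (f := fun a (_ : a ∈ starCompositions n F ℓ c) =>
      part R ℓ (parabolicOfComposition F a)) a ha) ?_
    exact ⟨_, Submodule.subset_span ⟨superdiagChar χ, (parabolicOfChar_eq_iff χ a).2 hχ, rfl⟩, rfl⟩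
  -- The inclusion already holds in I: the generators have index of valuation exactly c.
  · have h1 : latticePart R (parabolicOfComposition F a) ≤ latticeFiltration n F R ℓ c := by
      refine Submodule.span_le.2 ?_
      rintro _ ⟨lam, hlam, rfl⟩
      obtain ⟨χ, rfl⟩ := exists_eq_superdiagChar lam
      have h2 := (parabolicOfChar_eq_iff χ a).1 hlam
      rw [SetLike.mem_coe, eigenvector_mem_latticeFiltration_iff,
        S.pow_dvd_natCast_iff (charIndex_ne_zero χ), charIndex_eq h2, ha.2.2]
    rintro _ ⟨x, hx, rfl⟩
    exact ⟨x, h1 hx, rfl⟩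

end Main

end

end SteinbergLattice

open SteinbergLattice in
theorem mainTheorem7 (n : ℕ) (hn : 2 ≤ n) (p ℓ : ℕ) (hp : p.Prime) (hℓ : ℓ.Prime) (hpℓ : ℓ ≠ p)
    (F : Type*) [Field F] [Fintype F] [DecidableEq F] [CharP F p]
    (R : Type*) [CommRing R] [IsDomain R] [IsPrincipalIdealRing R] [IsLocalRing R] [CharZero R]
    (hR : IsLocalRing.maximalIdeal R = Ideal.span {(ℓ : R)})
    (hζ : ∃ ζ : R, IsPrimitiveRoot ζ p)
    (hd : dNumber (Nat.card F) ℓ = 1) :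
    (filtration n F R ℓ 0 = ⊤ ∧ Antitone (filtration n F R ℓ) ∧
      ∃ r : ℕ,
        StrictAntiOn (radicalSeries (GroupAlg n F (ResField R ℓ)) (reduction n F R ℓ))
          (Set.Iic r) ∧
        radicalSeries (GroupAlg n F (ResField R ℓ)) (reduction n F R ℓ) r = ⊥ ∧
        Set.range (filtration n F R ℓ) =
          radicalSeries (GroupAlg n F (ResField R ℓ)) (reduction n F R ℓ) '' Set.Iic r) ∧
    ∀ c : ℕ, IsPValue n F ℓ c →
      filtration n F R ℓ c =
        ⨆ a ∈ starCompositions n F ℓ c, part R ℓ (parabolicOfComposition F a) := by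
  have S : IsModularSetting F R ℓ :=
    { prime := hℓ
      maximalIdeal_eq := hR
      not_dvd := fun h => by
        have := Fact.mk hp
        obtain ⟨k, -, hk⟩ := FiniteField.card F p
        rw [hk] at h
        exact hpℓ ((Nat.prime_dvd_prime_iff_eq hℓ hp).1 (hℓ.dvd_of_dvd_pow h))
      exists_addChar := by
        obtain ⟨ζ, hζ⟩ := hζ
        exact exists_addChar_ne_one hp F hζ }
  rw [Nat.card_eq_fintype_card] at hd
  refine ⟨⟨filtration_zero S, filtration_antitone S, exists_radicalSeries S fun N c h =>
    filtration_le_of_starCompositions S hd c fun a ha χ hχ => h χ ?_⟩,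
    fun c _ => filtration_eq_iSup_part S hd c⟩
  rw [charIndex_eq hχ, ha.2.2]
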